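/- Let $\kappa\ge 0$, $0<b\le\infty$, and let $P$ be a real symmetric $2\times2$ matrix-valued function on $(0,b)$ with $\operatorname{tr}P(x)=0$ for almost every $x$ and such that $w_\kappa P$ is integrable on $(0,c)$ for every $c\in(0,b)$, where $w_\kappa(x)=1$ if $\kappa\ne\frac12$ and $w_{1/2}(x)=1+|\log x|$. (Thus $Q(x)=\begin{pmatrix}0&\kappa/x\\ \kappa/x&0\end{pmatrix}+P(x)$ is a perturbed radial Dirac potential with trace zero.) All branches are principal. For $l\ge-\frac12$, $\zeta\ne0$ and $x>0$ let $$\phi_l(\zeta,x)=\zeta^{-\frac{2l+1}{4}}\sqrt{\tfrac{\pi x}{2}}\,J_{l+\frac12}(\sqrt\zeta\,x),$$ $$\theta_l(\zeta,x)=-\zeta^{\frac{2l+1}{4}}\sqrt{\tfrac{\pi x}{2}}\begin{cases}\frac{-1}{\sin((l+\frac12)\pi)}J_{-l-\frac12}(\sqrt\zeta\,x),& l+\tfrac12\notin\mathbb N_0,\\ Y_{l+\frac12}(\sqrt\zeta\,x)-\frac1\pi\log(\zeta)\,J_{l+\frac12}(\sqrt\zeta\,x),& l+\tfrac12\in\mathbb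 N_0,\end{cases}$$ $K_l(\zeta,x,y)=\phi_l(\zeta,x)\theta_l(\zeta,y)-\phi_l(\zeta,y)\theta_l(\zeta,x)$, and $K_l=K_{-1-l}$ for $-1\le l<-\frac12$. For $z\ne0$ put $$\Phi_\kappa(z,x)=\begin{pmatrix} z\,\phi_\kappa(z^2,x)\\ \left(\frac{\partial}{\partial x}+\frac{\kappa}{x}\right)\phi_\kappa(z^2,x)\end{pmatrix},$$ $$K(z,x,y)=\begin{pmatrix} zK_\kappa(z^2,x,y)&\left(-\frac{\partial}{\partial x}+\frac\kappa x\right)K_{\kappa-1}(z^2,x,y)\\ \left(\frac{\partial}{\partial x}+\frac\kappa x\right)K_\kappa(z^2,x,y)& zK_{\kappa-1}(z^2,x,y)\end{pmatrix}.$$ For each $z\in\mathbb C\setminus\{0\}$ let $\Phi(z,\cdot)$ be the regular solution, that is, the continuous solution $(0,b)\to\mathbb C^2$ with $\Phi(z,x)=O(x^\kappa)$ as $x\downarrow0$ of $$\Phi(z,x)=\Phi_\kappa(z,x)+\int_0^xK(z,x,y)P(y)\Phi(z,y)\,dy,\qquad 0<x<b,$$ where the integrand is integrable. Then for every fixed $x\in(0,b)$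 $$|\Phi(z,x)-\Phi_\kappa(z,x)|=o\bigl(|z|^{-\kappa}\mathrm e^{|\operatorname{Im}z|x}\bigr)\qquad\text{as }|z|\to\infty .$$ Moreover, for every $\delta>0$ and either choice of sign, $$\Phi(z,x)\sim(\pm z)^{-\kappa}\begin{pmatrix}\sin\bigl(zx\mp\frac{\kappa\pi}2\bigr)\\ \cos\bigl(zx\mp\frac{\kappa\pi}2\bigr)\end{pmatrix}\qquad\text{as }|z|\to\infty\text{ in the sector }|\arg(\pm z)|<\pi-\delta,$$ where $u\sim v$ for $\mathbb C^2$-valued functions means $|u-v|=o(|v|)$. -/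

import Mathlib

namespace RadialDirac

/-- The Bessel function of the first kind `J_ν(w)`, `ν` real, with the principal branch of the
power.  (`Real.Gamma` vanishes at its poles, so that `1 / Γ` is `0` there, as it should be.) -/
noncomputable def besselJ (ν : ℝ) (w : ℂ) : ℂ :=
  (w / 2) ^ (ν : ℂ) *
    ∑' k : ℕ, (-(w ^ 2 / 4)) ^ k / ((k.factorial : ℂ) * (Real.Gamma (ν + k + 1) : ℂ))

/-- The digamma function at `k + 1`, that is `ψ(k + 1) = -γ + (1 + 1/2 + ⋯ + 1/k)`. -/
noncomputable def digammaSucc (k : ℕ) : ℝ :=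
  -Real.eulerMascheroniConstant + ((harmonic k : ℚ) : ℝ)

/-- The Bessel function of the second kind (Neumann function) `Y_n(w)` of integer order `n ≥ 0`,
given by its classical expansion, with the principal branch of the logarithm. -/
noncomputable def besselY (n : ℕ) (w : ℂ) : ℂ :=
  -(((w / 2) ^ n)⁻¹ / (Real.pi : ℂ)) *
      ∑ k ∈ Finset.range n, ((n - 1 - k).factorial : ℂ) / (k.factorial : ℂ) * (w ^ 2 / 4) ^ k
    + 2 / (Real.pi : ℂ) * Complex.log (w / 2) * besselJ n w
    - (w / 2) ^ n / (Real.pi : ℂ) *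
      ∑' k : ℕ, ((digammaSucc k + digammaSucc (n + k) : ℝ) : ℂ) * (-(w ^ 2 / 4)) ^ k /
        ((k.factorial : ℂ) * ((n + k).factorial : ℂ))

/-- `φ_l(ζ, x) = ζ^{-(2l+1)/4} √(πx/2) J_{l+1/2}(√ζ x)`, for `l ≥ -1/2`, `ζ ≠ 0`, `x > 0`: the
solution of `-u'' + l(l+1)/x² u = ζ u` which is regular at `0`. -/
noncomputable def phi (l : ℝ) (ζ : ℂ) (x : ℝ) : ℂ :=
  ζ ^ ((-(2 * l + 1) / 4 : ℝ) : ℂ) * (Real.sqrt (Real.pi * x / 2) : ℂ) *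
    besselJ (l + 1 / 2) (ζ ^ (1 / 2 : ℂ) * x)

/-- The second solution `θ_l(ζ, x)` of the same equation, for `l ≥ -1/2`, `ζ ≠ 0`, `x > 0`; the
first branch is the one for `l + 1/2 ∈ {0, 1, 2, …}`. -/
noncomputable def theta (l : ℝ) (ζ : ℂ) (x : ℝ) : ℂ :=
  -(ζ ^ (((2 * l + 1) / 4 : ℝ) : ℂ) * (Real.sqrt (Real.pi * x / 2) : ℂ) *
    (if l + 1 / 2 = (⌊l + 1 / 2⌋₊ : ℝ) then
      besselY ⌊l + 1 / 2⌋₊ (ζ ^ (1 / 2 : ℂ) * x)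
        - 1 / (Real.pi : ℂ) * Complex.log ζ * besselJ (l + 1 / 2) (ζ ^ (1 / 2 : ℂ) * x)
    else
      -1 / (Real.sin ((l + 1 / 2) * Real.pi) : ℂ) *
        besselJ (-l - 1 / 2) (ζ ^ (1 / 2 : ℂ) * x)))

/-- The kernel `K_l(ζ, x, y) = φ_l(ζ, x) θ_l(ζ, y) - φ_l(ζ, y) θ_l(ζ, x)` for `l ≥ -1/2`, extended
to `-1 ≤ l < -1/2` by `K_l = K_{-1-l}` (the Bessel equation only depends on `l(l+1)`, and `K_l` is
its solution in `x` with `K_l = 0` and `∂K_l/∂x = 1` at `x = y`). -/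
noncomputable def kernel (l : ℝ) (ζ : ℂ) (x y : ℝ) : ℂ :=
  if -1 / 2 ≤ l then phi l ζ x * theta l ζ y - phi l ζ y * theta l ζ x
  else phi (-1 - l) ζ x * theta (-1 - l) ζ y - phi (-1 - l) ζ y * theta (-1 - l) ζ x

/-- The regular solution `Φ_κ(z, x) = (z φ_κ(z², x), (d/dx + κ/x) φ_κ(z², x))` of the unperturbed
radial Dirac equation (with mass `0`). -/
noncomputable def freeSolution (κ : ℝ) (z : ℂ) (x : ℝ) : Fin 2 → ℂ :=
  ![z * phi κ (z ^ 2) x,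
    deriv (fun t : ℝ => phi κ (z ^ 2) t) x + ((κ / x : ℝ) : ℂ) * phi κ (z ^ 2) x]

/-- The matrix kernel `K(z, x, y)` of the variation of constants formula. -/
noncomputable def diracKernel (κ : ℝ) (z : ℂ) (x y : ℝ) : Matrix (Fin 2) (Fin 2) ℂ :=
  !![z * kernel κ (z ^ 2) x y,
      -deriv (fun t : ℝ => kernel (κ - 1) (z ^ 2) t y) x
        + ((κ / x : ℝ) : ℂ) * kernel (κ - 1) (z ^ 2) x y;
    deriv (fun t : ℝ => kernel κ (z ^ 2) t y) x + ((κ / x : ℝ) : ℂ) * kernel κ (z ^ 2) x y,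
      z * kernel (κ - 1) (z ^ 2) x y]

/-- The weight in the integrability condition on the perturbation. -/
noncomputable def weight (κ x : ℝ) : ℝ := if κ = 1 / 2 then 1 + |Real.log x| else 1

/-- `P` is a perturbation of the radial Dirac operator on `(0, b)`, `b ∈ (0, ∞]`: a real symmetric
matrix potential, integrable (for `κ = 1/2` with a logarithmic weight) on `(0, c)` for all
`c ∈ (0, b)`. -/
structure IsRadialPerturbation (κ : ℝ) (b : EReal) (P : ℝ → Matrix (Fin 2) (Fin 2) ℝ) :
    Prop where
  symm : ∀ᵐ x : ℝ, 0 < x → (x : EReal) < b → (P x).IsSymm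
  integrable : ∀ c : ℝ, 0 < c → (c : EReal) < b → ∀ i j : Fin 2,
    MeasureTheory.IntegrableOn (fun x => weight κ x * P x i j) (Set.Ioo 0 c)

/-- `u` is the regular solution at the spectral parameter `z`: the solution of the Volterra
equation `u(x) = Φ_κ(z, x) + ∫₀ˣ K(z, x, y) P(y) u(y) dy` on `(0, b)` in the class of continuous
functions with `u(x) = O(x^κ)` as `x → 0` (in which it is unique). -/
structure IsRegularSolution (κ : ℝ) (b : EReal) (P : ℝ → Matrix (Fin 2) (Fin 2) ℝ) (z : ℂ)
    (u : ℝ → Fin 2 → ℂ) : Prop where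
  continuousOn : ContinuousOn u {x : ℝ | 0 < x ∧ (x : EReal) < b}
  regular : u =O[nhdsWithin 0 (Set.Ioi 0)] fun x : ℝ => x ^ κ
  integrable : ∀ x : ℝ, 0 < x → (x : EReal) < b →
    IntervalIntegrable
      (fun y => (diracKernel κ z x y * (P y).map (fun r : ℝ => (r : ℂ))).mulVec (u y))
      MeasureTheory.volume 0 x
  equation : ∀ x : ℝ, 0 < x → (x : EReal) < b →
    u x = freeSolution κ z x +
      ∫ y in (0 : ℝ)..x,
        (diracKernel κ z x y * (P y).map (fun r : ℝ => (r : ℂ))).mulVec (u y)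

end RadialDirac

/-!
The idea is to treat the Volterra equation in the coordinates `u₂ ± i u₁` (`coordPlus`,
`coordMinus`), in which the free Dirac system reads `a' = iza + (κ/x) b`, `b' = -izb + (κ/x) a`
(`IsDiracSolution`). A trace-free symmetric potential is off-diagonal there. Hence, to
leading order, the integrand of the first iterate `∫ K P Φ_κ` pairs `e^{±iz(x-y)}` from the kernel
with `e^{∓izy}` from the free solution only, and so it oscillates like `e^{∓2izy}` in `y`.
The Riemann-Lebesgue lemma makes it small relative to the size of the free solution, and Gronwall's
inequality carries this over to `Φ - Φ_κ`. With a trace, there would be a non-oscillating term of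
the same order as the free solution.

* All Bessel functions are reduced to entire power series in `-ζx²/4`: `phi` and `theta` are
  solutions of the Bessel equation with Wronskian one, so that the kernel `K(z, x, y)` is the
  propagator of the free system, up to a constant matrix (`diracKernel_isDiracSolution`).
  Everything about `K` is then derived from the differential equation.
* An energy estimate for `x ≲ 1/|z|`, and for larger `x` one after the change of variables
  `a - (iκ/2zx) b`, `b + (iκ/2zx) a`, which removes the term `κ/x` up to `O(1/(|z| x²))`, give
  the growth `min(x, (κ+1)/|z|)^κ e^{|Im z| x}` (`IsDiracSolution.pairNorm_le`) and the free
  evolution by `e^{±iz(x-y)}` up to `O(1/|z|)` (`IsDiracSolution.norm_sub_exp_le`).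
* The asymptotics of the free solution (`exists_free_asymptotics`) come from the same change of
  variables, applied along the arcs `|w| = R` of the right half plane: the solution has to be known
  only at `w = -iR`, where Poisson's integral representation of the Bessel functions and Laplace's
  method give the limit. The left half plane is reached by parity, and this is where the sector
  comes in: the branch of `z^{-κ}` jumps, which is harmless only for an exponentially small
  coordinate.
* `tendsto_integral_mul_of_tendsto_primitive` is the Riemann-Lebesgue lemma,
  `tendsto_zero_of_integral_inequality` the Gronwall lemma, and `tendsto_coordNorm_sub_div` combines
  them. All estimates are relative to `scale κ z x`, so they hold down to `x = 0` and the
  integrability of `P` near `0` is all that is needed.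
-/

namespace RadialDirac

/-! ### Entire power series -/

/-- The coefficient sequence `c` defines an entire function: `∑ ‖c k‖ R ^ k < ∞` for all `R ≥ 0`. -/
def IsEntireSeq (c : ℕ → ℂ) : Prop := ∀ R : ℝ, 0 ≤ R → Summable fun k => ‖c k‖ * R ^ k

/-- The value `∑ c k u ^ k` of the power series with coefficients `c`. -/
noncomputable def powerSum (c : ℕ → ℂ) (u : ℂ) : ℂ := ∑' k, c k * u ^ k

/-- The coefficients of `u f'(u)`, where `f` has coefficients `c`. -/
def eulerSeq (c : ℕ → ℂ) (k : ℕ) : ℂ := k * c k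

theorem IsEntireSeq.summable {c : ℕ → ℂ} (hc : IsEntireSeq c) (u : ℂ) :
    Summable fun k => c k * u ^ k := by
  refine Summable.of_norm ?_
  simpa [norm_mul, norm_pow] using hc ‖u‖ (norm_nonneg u)

theorem IsEntireSeq.of_le {c d : ℕ → ℂ} (hc : IsEntireSeq c) (h : ∀ k, ‖d k‖ ≤ ‖c k‖) :
    IsEntireSeq d := fun R hR =>
  (hc R hR).of_nonneg_of_le (fun k => by positivity)
    (fun k => mul_le_mul_of_nonneg_right (h k) (by positivity))

theorem IsEntireSeq.euler {c : ℕ → ℂ} (hc : IsEntireSeq c) : IsEntireSeq (eulerSeq c) := by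
  intro R hR
  refine (hc (2 * R) (by positivity)).of_nonneg_of_le (fun k => by positivity) (fun k => ?_)
  have h2 : (k : ℝ) ≤ 2 ^ k := by exact_mod_cast (Nat.lt_two_pow_self (n := k)).le
  rw [eulerSeq, norm_mul, Complex.norm_natCast, mul_pow]
  calc (k : ℝ) * ‖c k‖ * R ^ k = k * (‖c k‖ * R ^ k) := by ring
    _ ≤ 2 ^ k * (‖c k‖ * R ^ k) := by gcongr
    _ = _ := by ring

theorem IsEntireSeq.add {c d : ℕ → ℂ} (hc : IsEntireSeq c) (hd : IsEntireSeq d) :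
    IsEntireSeq fun k => c k + d k := by
  intro R hR
  refine ((hc R hR).add (hd R hR)).of_nonneg_of_le (fun k => by positivity) (fun k => ?_)
  rw [← add_mul]
  exact mul_le_mul_of_nonneg_right (norm_add_le _ _) (by positivity)

theorem IsEntireSeq.const_mul {c : ℕ → ℂ} (hc : IsEntireSeq c) (a : ℂ) :
    IsEntireSeq fun k => a * c k := by
  intro R hR
  simpa [mul_assoc] using (hc R hR).mul_left ‖a‖

theorem powerSum_zero (c : ℕ → ℂ) : powerSum c 0 = c 0 := by
  rw [powerSum, tsum_eq_single 0 (fun k hk => by simp [hk])]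
  simp

theorem powerSum_eq_head {c : ℕ → ℂ} (hc : IsEntireSeq c) (u : ℂ) :
    powerSum c u = c 0 + u * ∑' k, c (k + 1) * u ^ k := by
  rw [powerSum, (hc.summable u).tsum_eq_zero_add, ← tsum_mul_left]
  congr 1
  · simp
  · exact tsum_congr fun k => by ring

theorem hasDerivAt_powerSum {c : ℕ → ℂ} (hc : IsEntireSeq c) (u : ℂ) :
    HasDerivAt (powerSum c) (∑' k, ((k + 1 : ℕ) * c (k + 1)) * u ^ k) u := by
  set R : ℝ := ‖u‖ + 1 with hR
  have hR1 : 1 ≤ R := by have := norm_nonneg u; linarith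
  have hsum := hc.euler R (by linarith)
  have key : HasDerivAt (fun v => ∑' k, c k * v ^ k) (∑' k, c k * (k * u ^ (k - 1))) u := by
    refine hasDerivAt_tsum_of_isPreconnected hsum (t := Metric.ball 0 R) Metric.isOpen_ball
      (convex_ball _ _).isPreconnected (fun k y _ => (hasDerivAt_pow k y).const_mul (c k))
      (fun k y hy => ?_) (y₀ := 0) (Metric.mem_ball_self (by linarith)) (hc.summable 0) ?_
    · rw [mem_ball_zero_iff] at hy
      rw [eulerSeq, norm_mul, norm_mul, norm_mul, norm_pow]
      rcases k with _ | k
      · simp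
      · rw [Nat.add_sub_cancel]
        have : ‖y‖ ^ k ≤ R ^ (k + 1) :=
          (pow_le_pow_left₀ (norm_nonneg _) hy.le k).trans (pow_le_pow_right₀ hR1 (Nat.le_succ k))
        calc _ = ‖((k + 1 : ℕ) : ℂ)‖ * ‖c (k + 1)‖ * ‖y‖ ^ k := by ring
          _ ≤ _ := by gcongr
    · rw [mem_ball_zero_iff]; linarith
  refine key.congr_deriv ?_
  have hs : Summable fun k => c k * (k * u ^ (k - 1)) := by
    refine Summable.of_norm (hsum.of_nonneg_of_le (fun k => by positivity) (fun k => ?_))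
    rw [eulerSeq, norm_mul, norm_mul, norm_mul, norm_pow]
    rcases k with _ | k
    · simp
    · rw [Nat.add_sub_cancel]
      have : ‖u‖ ^ k ≤ R ^ (k + 1) :=
        (pow_le_pow_left₀ (norm_nonneg _) (by linarith) k).trans
          (pow_le_pow_right₀ hR1 (Nat.le_succ k))
      calc _ = ‖((k + 1 : ℕ) : ℂ)‖ * ‖c (k + 1)‖ * ‖u‖ ^ k := by ring
        _ ≤ _ := by gcongr
  rw [hs.tsum_eq_zero_add]
  simp only [Nat.add_sub_cancel]
  simp
  exact tsum_congr fun k => by ring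

theorem powerSum_euler {c : ℕ → ℂ} (hc : IsEntireSeq c) (u : ℂ) :
    powerSum (eulerSeq c) u = u * ∑' k, ((k + 1 : ℕ) * c (k + 1)) * u ^ k := by
  rw [powerSum_eq_head hc.euler]
  simp [eulerSeq]

theorem continuous_powerSum {c : ℕ → ℂ} (hc : IsEntireSeq c) : Continuous (powerSum c) :=
  continuous_iff_continuousAt.2 fun u => (hasDerivAt_powerSum hc u).continuousAt

/-- Along a path `w`, the function `f(-w² / 4)` has the derivative `(2 w' / w) (u f'(u))` at
`u = -w² / 4`. -/
theorem hasDerivAt_powerSum_path {c : ℕ → ℂ} (hc : IsEntireSeq c) {w : ℝ → ℂ} {w' : ℂ} {t : ℝ}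
    (hw : HasDerivAt w w' t) (h0 : w t ≠ 0) :
    HasDerivAt (fun s => powerSum c (-(w s ^ 2 / 4)))
      (2 * w' / w t * powerSum (eulerSeq c) (-(w t ^ 2 / 4))) t := by
  have h1 : HasDerivAt (fun s => -(w s ^ 2 / 4)) (-(2 * w t * w' / 4)) t := by
    have := ((hw.pow 2).div_const 4).neg
    simpa using! this
  have h2 := (hasDerivAt_powerSum hc (-(w t ^ 2 / 4))).comp t h1
  rw [powerSum_euler hc]
  convert! h2 using 1
  field_simp

/-- The second-order recursion of coefficients that makes `E(u) - 2 log(x/2) B(u)`, with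
`u = -(k x)² / 4`, a solution of the Bessel equation after multiplication with a power of `x`. -/
theorem powerSum_euler_euler {e b : ℕ → ℂ} {μ : ℂ} (he : IsEntireSeq e) (hb : IsEntireSeq b)
    (h0 : μ * b 0 = 0)
    (h : ∀ k : ℕ, (k + 1) * (k + 1 + μ) * e (k + 1) = e k + (2 * (k + 1) + μ) * b (k + 1)) (u : ℂ) :
    powerSum (eulerSeq (eulerSeq e)) u + μ * powerSum (eulerSeq e) u
      = u * powerSum e u + 2 * powerSum (eulerSeq b) u + μ * powerSum b u := by
  have s1 := (he.euler.euler.summable u)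
  have s2 := (he.euler.summable u).mul_left μ
  have s3 := (he.summable u).mul_left u
  have s4 := (hb.euler.summable u).mul_left 2
  have s5 := (hb.summable u).mul_left μ
  have hl := (s1.add s2)
  have hr := (s4.add s5)
  simp only [powerSum]
  rw [← tsum_mul_left, ← tsum_mul_left, ← tsum_mul_left, ← tsum_mul_left, ← s1.tsum_add s2,
    add_assoc, ← s4.tsum_add s5, hl.tsum_eq_zero_add, hr.tsum_eq_zero_add]
  have hz : ∀ X Y Z : ℂ, X + (0 + Y) = Z → X + (2 * 0 + Y) = Z := by intros; simp_all
  have hr' : Summable fun k : ℕ => 2 * (eulerSeq b (k + 1) * u ^ (k + 1))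
      + μ * (b (k + 1) * u ^ (k + 1)) := (summable_nat_add_iff 1).2 hr
  have : (∑' k : ℕ, u * (e k * u ^ k)) + ∑' k : ℕ, (2 * (eulerSeq b (k + 1) * u ^ (k + 1))
      + μ * (b (k + 1) * u ^ (k + 1))) = ∑' k : ℕ, (eulerSeq (eulerSeq e) (k + 1) * u ^ (k + 1)
      + μ * (eulerSeq e (k + 1) * u ^ (k + 1))) := by
    rw [← s3.tsum_add hr']
    refine tsum_congr fun k => ?_
    simp only [eulerSeq]
    push_cast
    linear_combination (-(u ^ (k + 1))) * h k
  rw [← this]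
  simp only [eulerSeq]
  linear_combination -h0

/-! ### The Bessel–Clifford function -/

/-- The coefficients `1 / (k! Γ(ν + k + 1))` of the Bessel–Clifford function `C_ν`, for which
`J_ν(w) = (w / 2) ^ ν C_ν(-w² / 4)`.  As `Real.Gamma` vanishes at its poles, these are the right
coefficients for all real `ν`. -/
noncomputable def cliffordSeq (ν : ℝ) (k : ℕ) : ℂ :=
  1 / ((k.factorial : ℂ) * (Real.Gamma (ν + k + 1) : ℂ))

theorem inv_Gamma_eq (s : ℝ) : 1 / Real.Gamma s = s / Real.Gamma (s + 1) := by
  rcases eq_or_ne s 0 with rfl | hs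
  · simp [Real.Gamma_zero]
  · rw [Real.Gamma_add_one hs]
    rcases eq_or_ne (Real.Gamma s) 0 with h | h
    · simp [h]
    · field_simp

/-- This is `C_ν' = C_{ν+1}` on coefficients. -/
theorem succ_mul_cliffordSeq (ν : ℝ) (k : ℕ) :
    (k + 1 : ℕ) * cliffordSeq ν (k + 1) = cliffordSeq (ν + 1) k := by
  have hk : ((k : ℂ) + 1) ≠ 0 := by exact_mod_cast k.succ_ne_zero
  have hf : (k.factorial : ℂ) ≠ 0 := by exact_mod_cast k.factorial_ne_zero
  simp only [cliffordSeq, Nat.factorial_succ]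
  push_cast
  rw [show ν + (k + 1) + 1 = ν + 1 + k + 1 by ring]
  rw [mul_one_div, mul_assoc, mul_comm ((k : ℂ) + 1), ← div_div, ← div_div, ← div_div]
  field_simp

theorem cliffordSeq_pred (ν : ℝ) (k : ℕ) :
    (ν + k : ℂ) * cliffordSeq ν k = cliffordSeq (ν - 1) k := by
  have h := inv_Gamma_eq (ν + k)
  have h' : (1 / (Real.Gamma (ν + k) : ℂ)) = (ν + k) / (Real.Gamma (ν + k + 1) : ℂ) := by
    exact_mod_cast congrArg ((↑) : ℝ → ℂ) h
  have hf : (k.factorial : ℂ) ≠ 0 := by exact_mod_cast k.factorial_ne_zero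
  simp only [cliffordSeq]
  rw [show ν - 1 + k + 1 = ν + k by ring, ← div_div, ← div_div, div_eq_mul_one_div _
    (Real.Gamma (ν + k) : ℂ), h']
  ring

theorem cliffordSeq_succ (ν : ℝ) (k : ℕ) :
    (k + 1) * (k + 1 + (ν : ℂ)) * cliffordSeq ν (k + 1) = cliffordSeq ν k := by
  have h1 := succ_mul_cliffordSeq ν k
  have h2 := cliffordSeq_pred (ν + 1) k
  rw [add_sub_cancel_right] at h2
  push_cast at h1 h2
  linear_combination (ν + 1 + k : ℂ) * h1 + h2

theorem isEntireSeq_of_ratio {c : ℕ → ℂ} {ν : ℝ}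
    (h : ∀ k : ℕ, (k + 1) * (k + 1 + (ν : ℂ)) * c (k + 1) = c k) : IsEntireSeq c := by
  intro R hR
  refine summable_of_ratio_norm_eventually_le (r := 1 / 2) (by norm_num) ?_
  obtain ⟨N, hN⟩ := exists_nat_ge (|ν| + 2 * R)
  filter_upwards [Filter.eventually_ge_atTop N] with k hk
  have hk' : (N : ℝ) ≤ k := by exact_mod_cast hk
  have hν := neg_abs_le ν
  have hν0 := abs_nonneg ν
  have h1 : (2 * R : ℝ) ≤ k + 1 + ν := by linarith
  have h2 : ‖((k : ℂ) + 1)‖ = k + 1 := by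
    rw [← Nat.cast_succ, Complex.norm_natCast]; simp
  have h3 : (2 * R : ℝ) ≤ ‖((k : ℂ) + 1 + (ν : ℂ))‖ := by
    have : ((k : ℂ) + 1 + (ν : ℂ)) = ((k + 1 + ν : ℝ) : ℂ) := by push_cast; ring
    rw [this, Complex.norm_real]
    exact h1.trans (le_abs_self _)
  have h4 := congrArg norm (h k)
  rw [norm_mul, norm_mul, h2] at h4
  have h5 : 2 * R * ‖c (k + 1)‖ ≤ ‖c k‖ := by
    rw [← h4]
    have : (0 : ℝ) ≤ k := by positivity
    have hn := norm_nonneg (c (k + 1))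
    have := mul_le_mul_of_nonneg_right h3 hn
    have h6 : 0 ≤ ‖((k : ℂ) + 1 + (ν : ℂ))‖ * ‖c (k + 1)‖ := by positivity
    nlinarith
  rw [Real.norm_of_nonneg (by positivity), Real.norm_of_nonneg (by positivity), pow_succ]
  have : 0 ≤ R ^ k := by positivity
  nlinarith

theorem isEntireSeq_clifford (ν : ℝ) : IsEntireSeq (cliffordSeq ν) :=
  isEntireSeq_of_ratio (cliffordSeq_succ ν)

theorem powerSum_euler_clifford (ν : ℝ) (u : ℂ) :
    powerSum (eulerSeq (cliffordSeq ν)) u = u * powerSum (cliffordSeq (ν + 1)) u := by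
  rw [powerSum_euler (isEntireSeq_clifford ν)]
  simp only [succ_mul_cliffordSeq, powerSum]

theorem powerSum_clifford_pred (ν : ℝ) (u : ℂ) :
    ν * powerSum (cliffordSeq ν) u + powerSum (eulerSeq (cliffordSeq ν)) u
      = powerSum (cliffordSeq (ν - 1)) u := by
  have hc := isEntireSeq_clifford ν
  simp only [powerSum]
  rw [← tsum_mul_left, ← ((hc.summable u).mul_left _).tsum_add (hc.euler.summable u)]
  refine tsum_congr fun k => ?_
  rw [← cliffordSeq_pred, eulerSeq]
  ring

theorem besselJ_eq (ν : ℝ) (w : ℂ) :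
    besselJ ν w = (w / 2) ^ (ν : ℂ) * powerSum (cliffordSeq ν) (-(w ^ 2 / 4)) := by
  rw [besselJ, powerSum]
  congr 1
  refine tsum_congr fun k => ?_
  rw [cliffordSeq]
  ring

/-! ### The Bessel equation -/

/-- `x ^ (1/2 + μ) (E(u) - 2 log(x/2) B(u))` with `u = -(k x)² / 4`, where `E` and `B` are the entire
functions with coefficients `e` and `b`.  Both `φ_l` and `θ_l` are multiples of such a function. -/
noncomputable def besselSeries (μ : ℝ) (k : ℂ) (e b : ℕ → ℂ) (x : ℝ) : ℂ :=
  ((x ^ (1 / 2 + μ) : ℝ) : ℂ) * (powerSum e (-((k * x) ^ 2 / 4))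
    - 2 * (Real.log (x / 2) : ℂ) * powerSum b (-((k * x) ^ 2 / 4)))

/-- The derivative of `besselSeries`. -/
noncomputable def besselSeriesDeriv (μ : ℝ) (k : ℂ) (e b : ℕ → ℂ) (x : ℝ) : ℂ :=
  ((x ^ (μ - 1 / 2) : ℝ) : ℂ) *
    ((1 / 2 + μ) * (powerSum e (-((k * x) ^ 2 / 4))
      - 2 * (Real.log (x / 2) : ℂ) * powerSum b (-((k * x) ^ 2 / 4)))
    + 2 * powerSum (eulerSeq e) (-((k * x) ^ 2 / 4))
    - 4 * (Real.log (x / 2) : ℂ) * powerSum (eulerSeq b) (-((k * x) ^ 2 / 4))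
    - 2 * powerSum b (-((k * x) ^ 2 / 4)))

/-- `f` solves the Bessel equation `f'' = (m / x² - ζ) f` on `(0, ∞)`, and `f'` is its derivative. -/
structure IsBesselSolution (m ζ : ℂ) (f f' : ℝ → ℂ) : Prop where
  deriv_left : ∀ x : ℝ, 0 < x → HasDerivAt f (f' x) x
  deriv_right : ∀ x : ℝ, 0 < x → HasDerivAt f' ((m / x ^ 2 - ζ) * f x) x

theorem hasDerivAt_log_half {x : ℝ} (hx : 0 < x) :
    HasDerivAt (fun t : ℝ => (Real.log (t / 2) : ℂ)) (1 / x) x := by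
  have h := ((Real.hasDerivAt_log (x := x / 2) (by positivity)).comp x
    ((hasDerivAt_id x).div_const 2)).ofReal_comp
  refine h.congr_deriv ?_
  push_cast
  have : (x : ℂ) ≠ 0 := by exact_mod_cast hx.ne'
  field_simp

theorem hasDerivAt_rpow_cast {x : ℝ} (hx : 0 < x) (p : ℝ) :
    HasDerivAt (fun t : ℝ => ((t ^ p : ℝ) : ℂ)) (p / x * ((x ^ p : ℝ) : ℂ)) x := by
  refine (Real.hasDerivAt_rpow_const (p := p) (Or.inl hx.ne')).ofReal_comp.congr_deriv ?_
  rw [Real.rpow_sub_one hx.ne']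
  push_cast
  ring

theorem hasDerivAt_powerSum_mul {c : ℕ → ℂ} (hc : IsEntireSeq c) {k : ℂ} (hk : k ≠ 0) {x : ℝ}
    (hx : 0 < x) :
    HasDerivAt (fun t : ℝ => powerSum c (-((k * t) ^ 2 / 4)))
      (2 / x * powerSum (eulerSeq c) (-((k * x) ^ 2 / 4))) x := by
  have hx' : (x : ℂ) ≠ 0 := by exact_mod_cast hx.ne'
  have hw : HasDerivAt (fun t : ℝ => k * (t : ℂ)) (k * 1) x :=
    (hasDerivAt_id x).ofReal_comp.const_mul k
  refine (hasDerivAt_powerSum_path hc hw (mul_ne_zero hk hx')).congr_deriv ?_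
  field_simp

theorem isBesselSolution_besselSeries {μ : ℝ} {k : ℂ} (hk : k ≠ 0) {e b : ℕ → ℂ}
    (he : IsEntireSeq e) (hb : IsEntireSeq b) (h0 : (μ : ℂ) * b 0 = 0)
    (hrec : ∀ j : ℕ, (j + 1) * (j + 1 + (μ : ℂ)) * e (j + 1)
      = e j + (2 * (j + 1) + μ) * b (j + 1))
    (hrecb : ∀ j : ℕ, (j + 1) * (j + 1 + (μ : ℂ)) * b (j + 1) = b j) :
    IsBesselSolution ((μ ^ 2 - 1 / 4 : ℝ) : ℂ) (k ^ 2) (besselSeries μ k e b)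
      (besselSeriesDeriv μ k e b) := by
  have hz : IsEntireSeq fun _ => 0 := fun R _ => by simp [summable_zero]
  constructor
  · intro x hx
    have hx' : (x : ℂ) ≠ 0 := by exact_mod_cast hx.ne'
    have hE := hasDerivAt_powerSum_mul he hk hx
    have hB := hasDerivAt_powerSum_mul hb hk hx
    have hL := hasDerivAt_log_half hx
    refine ((hasDerivAt_rpow_cast hx (1 / 2 + μ)).mul
      (hE.sub ((hL.const_mul 2).mul hB))).congr_deriv ?_
    have hp : x ^ (1 / 2 + μ) = x ^ (μ - 1 / 2) * x := by
      rw [← Real.rpow_add_one hx.ne']; congr 1; ring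
    rw [besselSeriesDeriv, hp]
    simp only [Pi.sub_apply, Pi.mul_apply]
    push_cast
    field_simp
    ring
  · intro x hx
    have hx' : (x : ℂ) ≠ 0 := by exact_mod_cast hx.ne'
    have hE := hasDerivAt_powerSum_mul he hk hx
    have hB := hasDerivAt_powerSum_mul hb hk hx
    have hE' := hasDerivAt_powerSum_mul he.euler hk hx
    have hB' := hasDerivAt_powerSum_mul hb.euler hk hx
    have hL := hasDerivAt_log_half hx
    have r1 := powerSum_euler_euler he hb h0 hrec (-((k * x) ^ 2 / 4))
    have r2 := powerSum_euler_euler (e := b) (μ := (μ : ℂ)) hb hz (by simp)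
      (by intro j; simpa using hrecb j) (-((k * x) ^ 2 / 4))
    have hz' : powerSum (eulerSeq fun _ => 0) (-((k * x) ^ 2 / 4)) = 0 := by
      simp [powerSum, eulerSeq]
    have hz'' : powerSum (fun _ => 0) (-((k * x) ^ 2 / 4)) = 0 := by
      simp [powerSum]
    rw [hz', hz''] at r2
    refine ((hasDerivAt_rpow_cast hx (μ - 1 / 2)).mul
      (((((hE.sub ((hL.const_mul 2).mul hB)).const_mul (1 / 2 + (μ : ℂ))).add
        (hE'.const_mul 2)).sub ((hL.const_mul 4).mul hB')).sub (hB.const_mul 2))).congr_deriv ?_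
    have hp : x ^ (1 / 2 + μ) = x ^ (μ - 1 / 2) * x := by
      rw [← Real.rpow_add_one hx.ne']; congr 1; ring
    rw [besselSeries, hp]
    simp only [Pi.add_apply, Pi.sub_apply, Pi.mul_apply]
    generalize powerSum e (-((k * x) ^ 2 / 4)) = E0 at *
    generalize powerSum b (-((k * x) ^ 2 / 4)) = B0 at *
    generalize powerSum (eulerSeq e) (-((k * x) ^ 2 / 4)) = E1 at *
    generalize powerSum (eulerSeq b) (-((k * x) ^ 2 / 4)) = B1 at *
    generalize powerSum (eulerSeq (eulerSeq e)) (-((k * x) ^ 2 / 4)) = E2 at *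
    generalize powerSum (eulerSeq (eulerSeq b)) (-((k * x) ^ 2 / 4)) = B2 at *
    push_cast
    generalize ((x ^ (μ - 1 / 2) : ℝ) : ℂ) = X at *
    generalize (Real.log (x / 2) : ℂ) = L at *
    generalize (μ : ℂ) = m at *
    field_simp
    linear_combination 64 * X * r1 - 128 * X * L * r2

/-- The Wronskian of two solutions of the Bessel equation of the form `besselSeries` with opposite
exponents.  The logarithmic terms cancel, so that it is the value at `u = 0` of an entire function of
`u` which is constant. -/
theorem wronskian_besselSeries {ν : ℝ} {k : ℂ} {g e b : ℕ → ℂ} {m ζ : ℂ}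
    (hg : IsEntireSeq g) (he : IsEntireSeq e) (hb : IsEntireSeq b)
    (h1 : IsBesselSolution m ζ (besselSeries ν k g fun _ => 0)
      (besselSeriesDeriv ν k g fun _ => 0))
    (h2 : IsBesselSolution m ζ (besselSeries (-ν) k e b) (besselSeriesDeriv (-ν) k e b))
    (hL : ∀ u, ν * powerSum g u * powerSum b u + powerSum (eulerSeq g) u * powerSum b u
      - powerSum g u * powerSum (eulerSeq b) u = 0) {x : ℝ} (hx : 0 < x) :
    besselSeriesDeriv ν k g (fun _ => 0) x * besselSeries (-ν) k e b x
      - besselSeries ν k g (fun _ => 0) x * besselSeriesDeriv (-ν) k e b x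
      = 2 * ν * g 0 * e 0 + 2 * g 0 * b 0 := by
  set W : ℝ → ℂ := fun x => besselSeriesDeriv ν k g (fun _ => 0) x * besselSeries (-ν) k e b x
      - besselSeries ν k g (fun _ => 0) x * besselSeriesDeriv (-ν) k e b x with hW
  set H : ℂ → ℂ := fun u => 2 * ν * powerSum g u * powerSum e u
    + 2 * powerSum (eulerSeq g) u * powerSum e u - 2 * powerSum g u * powerSum (eulerSeq e) u
    + 2 * powerSum g u * powerSum b u with hH
  have hz' : ∀ u, powerSum (eulerSeq fun _ => 0) u = 0 := by
      simp [powerSum, eulerSeq]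
  have hz'' : ∀ u, powerSum (fun _ => 0) u = 0 := by
      simp [powerSum]
  have hWH : ∀ t : ℝ, 0 < t → W t = H (-((k * t) ^ 2 / 4)) := by
    intro t ht
    have hl := hL (-((k * t) ^ 2 / 4))
    have e1 : ((t ^ (ν - 1 / 2) : ℝ) : ℂ) * ((t ^ (1 / 2 + -ν) : ℝ) : ℂ) = 1 := by
      rw [← Complex.ofReal_mul, ← Real.rpow_add ht]; ring_nf; simp
    have e2 : ((t ^ (1 / 2 + ν) : ℝ) : ℂ) * ((t ^ (-ν - 1 / 2) : ℝ) : ℂ) = 1 := by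
      rw [← Complex.ofReal_mul, ← Real.rpow_add ht]; ring_nf; simp
    simp only [hW, hH, besselSeries, besselSeriesDeriv, hz', hz'']
    generalize powerSum e (-((k * t) ^ 2 / 4)) = E0 at *
    generalize powerSum b (-((k * t) ^ 2 / 4)) = B0 at *
    generalize powerSum g (-((k * t) ^ 2 / 4)) = G0 at *
    generalize powerSum (eulerSeq e) (-((k * t) ^ 2 / 4)) = E1 at *
    generalize powerSum (eulerSeq b) (-((k * t) ^ 2 / 4)) = B1 at *
    generalize powerSum (eulerSeq g) (-((k * t) ^ 2 / 4)) = G1 at *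
    generalize (Real.log (t / 2) : ℂ) = L at *
    push_cast
    linear_combination ((1 / 2 + (ν : ℂ)) * G0 + 2 * G1) * (E0 - 2 * L * B0) * e1
      - G0 * ((1 / 2 - (ν : ℂ)) * (E0 - 2 * L * B0) + 2 * E1 - 4 * L * B1 - 2 * B0) * e2
      - 4 * L * hl
  have hd : ∀ t : ℝ, 0 < t → HasDerivAt W 0 t := by
    intro t ht
    refine (((h1.deriv_right t ht).mul (h2.deriv_left t ht)).sub
      ((h1.deriv_left t ht).mul (h2.deriv_right t ht))).congr_deriv ?_
    ring
  have hconst : ∀ t : ℝ, 0 < t → W t = W x := fun t ht =>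
    isOpen_Ioi.is_const_of_deriv_eq_zero (s := Set.Ioi (0 : ℝ)) (convex_Ioi 0).isPreconnected
      (fun t ht => (hd t ht).differentiableAt.differentiableWithinAt)
      (fun t ht => (hd t ht).deriv) ht hx
  have hcont : Continuous fun t : ℝ => H (-((k * t) ^ 2 / 4)) := by
    have c1 := continuous_powerSum hg
    have c2 := continuous_powerSum he
    have c3 := continuous_powerSum hb
    have c4 := continuous_powerSum hg.euler
    have c5 := continuous_powerSum he.euler
    have : Continuous H := by
      simp only [hH]; fun_prop
    refine this.comp ?_
    fun_prop
  have t1 := (hcont.tendsto 0).mono_left (nhdsWithin_le_nhds (s := Set.Ioi (0 : ℝ)))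
  have t2 : Filter.Tendsto (fun t : ℝ => H (-((k * t) ^ 2 / 4))) (nhdsWithin 0 (Set.Ioi (0 : ℝ)))
      (nhds (W x)) := by
    refine tendsto_const_nhds.congr' ?_
    filter_upwards [self_mem_nhdsWithin] with t ht
    rw [← hWH t ht, hconst t ht]
  have := tendsto_nhds_unique t2 t1
  change W x = _
  rw [this]
  simp [hH, powerSum_zero, eulerSeq]

theorem log_cpow_half (ζ : ℂ) (hζ : ζ ≠ 0) : Complex.log (ζ ^ (1 / 2 : ℂ)) = Complex.log ζ / 2 := by
  have h1 := Complex.neg_pi_lt_log_im ζ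
  have h2 := Complex.log_im_le_pi ζ
  have h3 := Real.pi_pos
  have him : (Complex.log ζ * (1 / 2)).im = (Complex.log ζ).im / 2 := by
    rw [show Complex.log ζ * (1 / 2) = Complex.log ζ / (2 : ℝ) by push_cast; ring,
      Complex.div_ofReal_im]
  rw [Complex.cpow_def_of_ne_zero hζ, Complex.log_exp (by rw [him]; linarith)
    (by rw [him]; linarith)]
  ring

theorem cpow_half_ne_zero {ζ : ℂ} (hζ : ζ ≠ 0) : ζ ^ (1 / 2 : ℂ) ≠ 0 := by
  simp [Complex.cpow_eq_zero_iff, hζ]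

theorem cpow_half_sq (ζ : ℂ) : (ζ ^ (1 / 2 : ℂ)) ^ 2 = ζ := by
  rw [← Complex.cpow_nat_mul]
  norm_num

theorem cpow_half_mul_cpow {ζ : ℂ} (hζ : ζ ≠ 0) {r : ℝ} (hr : 0 < r) (ν : ℝ) :
    (ζ ^ (1 / 2 : ℂ) * r) ^ (ν : ℂ) = ζ ^ ((ν / 2 : ℝ) : ℂ) * ((r ^ ν : ℝ) : ℂ) := by
  have hk := cpow_half_ne_zero hζ
  have hr' : (r : ℂ) ≠ 0 := by exact_mod_cast hr.ne'
  rw [Complex.cpow_def_of_ne_zero (mul_ne_zero hk hr'), Complex.log_mul_ofReal r hr _ hk,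
    log_cpow_half ζ hζ, Complex.ofReal_cpow hr.le, Complex.cpow_def_of_ne_zero hζ,
    Complex.cpow_def_of_ne_zero hr', ← Complex.exp_add, Complex.ofReal_log hr.le]
  congr 1
  push_cast
  ring

theorem sqrt_mul_rpow_half {x : ℝ} (hx : 0 < x) (ν : ℝ) :
    √(Real.pi * x / 2) * (x / 2) ^ ν = √Real.pi * 2 ^ (-ν - 1 / 2) * x ^ (1 / 2 + ν) := by
  have h2 : (0 : ℝ) < x / 2 := by positivity
  rw [mul_div_assoc, Real.sqrt_mul Real.pi_pos.le, mul_assoc, mul_assoc, Real.sqrt_eq_rpow (x / 2),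
    ← Real.rpow_add h2, Real.div_rpow hx.le (by norm_num), show -ν - 1 / 2 = -(1 / 2 + ν) by ring,
    Real.rpow_neg (by norm_num)]
  field_simp

theorem phi_eq {l : ℝ} {ζ : ℂ} (hζ : ζ ≠ 0) {x : ℝ} (hx : 0 < x) :
    phi l ζ x = ((√Real.pi * 2 ^ (-(l + 1 / 2) - 1 / 2) : ℝ) : ℂ) *
      besselSeries (l + 1 / 2) (ζ ^ (1 / 2 : ℂ)) (cliffordSeq (l + 1 / 2)) (fun _ => 0) x := by
  have hs := congrArg ((↑) : ℝ → ℂ) (sqrt_mul_rpow_half hx (l + 1 / 2))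
  have hc : ζ ^ ((-(2 * l + 1) / 4 : ℝ) : ℂ) * ζ ^ (((l + 1 / 2) / 2 : ℝ) : ℂ) = 1 := by
    rw [← Complex.cpow_add _ _ hζ, ← Complex.ofReal_add,
      show -(2 * l + 1) / 4 + (l + 1 / 2) / 2 = 0 by ring]
    simp
  have hz : powerSum (fun _ => 0) (-((ζ ^ (1 / 2 : ℂ) * x) ^ 2 / 4)) = 0 := by simp [powerSum]
  rw [phi, besselJ_eq, besselSeries, hz,
    mul_div_assoc (ζ ^ (1 / 2 : ℂ)), show (x : ℂ) / 2 = ((x / 2 : ℝ) : ℂ) by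
    push_cast; ring, cpow_half_mul_cpow hζ (by positivity)]
  push_cast at hs ⊢
  generalize powerSum (cliffordSeq _) _ = C at *
  push_cast at hc
  linear_combination (↑√(Real.pi * x / 2) * ((((x / 2) ^ (l + 1 / 2) : ℝ) : ℂ)) * C) * hc + C * hs

theorem theta_eq_of_not_nat {l : ℝ} (hl : l + 1 / 2 ≠ (⌊l + 1 / 2⌋₊ : ℝ)) {ζ : ℂ} (hζ : ζ ≠ 0)
    {x : ℝ} (hx : 0 < x) :
    theta l ζ x = ((√Real.pi * 2 ^ ((l + 1 / 2) - 1 / 2) / Real.sin ((l + 1 / 2) * Real.pi) : ℝ) : ℂ)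
      * besselSeries (-(l + 1 / 2)) (ζ ^ (1 / 2 : ℂ)) (cliffordSeq (-(l + 1 / 2))) (fun _ => 0) x := by
  have hs := congrArg ((↑) : ℝ → ℂ) (sqrt_mul_rpow_half hx (-(l + 1 / 2)))
  have hc : ζ ^ (((2 * l + 1) / 4 : ℝ) : ℂ) * ζ ^ ((-(l + 1 / 2) / 2 : ℝ) : ℂ) = 1 := by
    rw [← Complex.cpow_add _ _ hζ, ← Complex.ofReal_add,
      show (2 * l + 1) / 4 + -(l + 1 / 2) / 2 = 0 by ring]
    simp
  have hz : powerSum (fun _ => 0) (-((ζ ^ (1 / 2 : ℂ) * x) ^ 2 / 4)) = 0 := by simp [powerSum]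
  rw [theta, if_neg hl, show -l - 1 / 2 = -(l + 1 / 2) by ring, besselJ_eq, besselSeries, hz,
    mul_div_assoc (ζ ^ (1 / 2 : ℂ)), show (x : ℂ) / 2 = ((x / 2 : ℝ) : ℂ) by
    push_cast; ring, cpow_half_mul_cpow hζ (by positivity)]
  rw [neg_neg] at hs
  push_cast at hs hc ⊢
  generalize powerSum (cliffordSeq _) _ = C at *
  generalize Complex.sin _ = s at *
  linear_combination (↑√(Real.pi * x / 2) * ((((x / 2) ^ (-(l + 1 / 2)) : ℝ) : ℂ)) * C / s) * hc
    + C / s * hs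

/-- The coefficients of `(-u) ^ n C_n(u)`. -/
noncomputable def neumannLogSeq (n k : ℕ) : ℂ := if k < n then 0 else (-1) ^ n * cliffordSeq n (k - n)

/-- The coefficients of the entire function that accompanies the logarithmic term in `θ_l` for
`l + 1/2 = n`. -/
noncomputable def neumannSeq (n k : ℕ) : ℂ :=
  if k < n then (-1) ^ k * ((n - 1 - k).factorial : ℂ) / (k.factorial : ℂ)
  else (-1) ^ n * ((digammaSucc (k - n) + digammaSucc k : ℝ) : ℂ) /
    (((k - n).factorial : ℂ) * (k.factorial : ℂ))

theorem isEntireSeq_of_shift {c : ℕ → ℂ} (n : ℕ) (h : IsEntireSeq fun k => c (k + n)) :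
    IsEntireSeq c := by
  intro R hR
  rw [← summable_nat_add_iff n]
  refine ((h R hR).mul_right (R ^ n)).congr fun k => ?_
  rw [pow_add]
  ring

theorem isEntireSeq_neumannLog (n : ℕ) : IsEntireSeq (neumannLogSeq n) := by
  refine isEntireSeq_of_shift n ?_
  simpa [neumannLogSeq] using (isEntireSeq_clifford n).const_mul ((-1) ^ n)

theorem cliffordSeq_nat (n k : ℕ) :
    cliffordSeq n k = 1 / ((k.factorial : ℂ) * ((n + k).factorial : ℂ)) := by
  have : Real.Gamma (n + k + 1) = (n + k).factorial := by
    rw [← Real.Gamma_nat_eq_factorial]; push_cast; rfl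
  rw [cliffordSeq, this, Complex.ofReal_natCast]

theorem abs_digammaSucc_le (k : ℕ) : |digammaSucc k| ≤ k + 1 := by
  have h1 := Real.one_half_lt_eulerMascheroniConstant
  have h2 := Real.eulerMascheroniConstant_lt_two_thirds
  have h3 : (0 : ℝ) ≤ ((harmonic k : ℚ) : ℝ) ∧ ((harmonic k : ℚ) : ℝ) ≤ k := by
    induction k with
    | zero => simp
    | succ k ih =>
      rw [harmonic_succ]
      push_cast
      have : ((k : ℝ) + 1)⁻¹ ≤ 1 := inv_le_one_of_one_le₀ (by linarith [k.cast_nonneg (α := ℝ)])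
      have : 0 ≤ ((k : ℝ) + 1)⁻¹ := by positivity
      constructor <;> linarith [ih.1, ih.2]
  rw [digammaSucc, abs_le]
  have : (0 : ℝ) ≤ k := k.cast_nonneg
  constructor <;> linarith [h3.1, h3.2]

theorem isEntireSeq_neumann (n : ℕ) : IsEntireSeq (neumannSeq n) := by
  refine isEntireSeq_of_shift n ?_
  have hc := isEntireSeq_clifford n
  have h1 : IsEntireSeq fun k => (2 * n + 2 : ℂ) * cliffordSeq n k + 2 * eulerSeq (cliffordSeq n) k :=
    (hc.const_mul _).add (hc.euler.const_mul 2)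
  refine h1.of_le fun k => ?_
  have e1 : (2 * n + 2 : ℂ) * cliffordSeq n k + 2 * eulerSeq (cliffordSeq n) k
      = ((2 * (n + k + 1) : ℕ) : ℂ) * cliffordSeq n k := by
    rw [eulerSeq]; push_cast; ring
  have e2 : neumannSeq n (k + n) = (-1) ^ n * ((digammaSucc k + digammaSucc (k + n) : ℝ) : ℂ) *
      cliffordSeq n k := by
    rw [neumannSeq, if_neg (by omega), cliffordSeq_nat, Nat.add_sub_cancel, add_comm n k]
    ring
  rw [e1, e2, norm_mul, norm_mul, norm_mul, Complex.norm_natCast, Complex.norm_real, norm_pow,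
    norm_neg, norm_one, one_pow, one_mul]
  gcongr
  have a1 := abs_digammaSucc_le k
  have a2 := abs_digammaSucc_le (k + n)
  have a3 := abs_add_le (digammaSucc k) (digammaSucc (k + n))
  rw [Real.norm_eq_abs]
  push_cast at a2 ⊢
  linarith [n.cast_nonneg (α := ℝ)]

theorem neumannLogSeq_succ (n j : ℕ) :
    (j + 1) * (j + 1 + ((-n : ℝ) : ℂ)) * neumannLogSeq n (j + 1) = neumannLogSeq n j := by
  rcases lt_trichotomy (j + 1) n with h | h | h
  · simp [neumannLogSeq, h, show j < n by omega]
  · subst h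
    simp [neumannLogSeq]
  · obtain ⟨i, rfl⟩ : ∃ i, j = n + i := ⟨j - n, by omega⟩
    rw [neumannLogSeq, neumannLogSeq, if_neg (by omega), if_neg (by omega),
      show n + i + 1 - n = i + 1 by omega, Nat.add_sub_cancel_left, ← cliffordSeq_succ n i]
    push_cast
    ring

theorem digammaSucc_succ (k : ℕ) : (digammaSucc (k + 1) : ℂ) = digammaSucc k + 1 / (k + 1) := by
  rw [digammaSucc, digammaSucc, harmonic_succ]
  push_cast
  ring

theorem neumannSeq_succ (n j : ℕ) :
    (j + 1) * (j + 1 + ((-n : ℝ) : ℂ)) * neumannSeq n (j + 1)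
      = neumannSeq n j + (2 * (j + 1) + ((-n : ℝ) : ℂ)) * neumannLogSeq n (j + 1) := by
  have hj : (j.factorial : ℂ) ≠ 0 := by exact_mod_cast j.factorial_ne_zero
  have hj1 : (j + 1 : ℂ) ≠ 0 := by exact_mod_cast j.succ_ne_zero
  rcases lt_trichotomy (j + 1) n with h | h | h
  · obtain ⟨i, rfl⟩ : ∃ i, n = j + 1 + 1 + i := ⟨n - (j + 1 + 1), by omega⟩
    rw [neumannSeq, neumannSeq, neumannLogSeq, if_pos h, if_pos (by omega), if_pos h,
      show j + 1 + 1 + i - 1 - (j + 1) = i by omega, show j + 1 + 1 + i - 1 - j = i + 1 by omega,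
      Nat.factorial_succ, Nat.factorial_succ]
    push_cast
    field_simp
    ring
  · subst h
    rw [neumannSeq, neumannSeq, neumannLogSeq, if_neg (by omega), if_pos (by omega),
      if_neg (by omega), Nat.sub_self, cliffordSeq_nat, show j + 1 - 1 - j = 0 by omega,
      add_zero, Nat.factorial_succ]
    push_cast
    field_simp
    simp
    ring
  · obtain ⟨i, rfl⟩ : ∃ i, j = n + i := ⟨j - n, by omega⟩
    have hi : (i.factorial : ℂ) ≠ 0 := by exact_mod_cast i.factorial_ne_zero
    have hi1 : (i + 1 : ℂ) ≠ 0 := by exact_mod_cast i.succ_ne_zero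
    rw [neumannSeq, neumannSeq, neumannLogSeq, if_neg (by omega), if_neg (by omega),
      if_neg (by omega), show n + i + 1 - n = i + 1 by omega, Nat.add_sub_cancel_left,
      cliffordSeq_nat, Nat.factorial_succ, Nat.factorial_succ, ← add_assoc, Nat.factorial_succ]
    push_cast
    rw [digammaSucc_succ, digammaSucc_succ]
    push_cast at hj1 ⊢
    field_simp
    ring

theorem powerSum_neumannLog (n : ℕ) (u : ℂ) :
    powerSum (neumannLogSeq n) u = (-u) ^ n * powerSum (cliffordSeq n) u := by
  rw [powerSum, ← ((isEntireSeq_neumannLog n).summable u).sum_add_tsum_nat_add n,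
    Finset.sum_eq_zero, zero_add, powerSum, ← tsum_mul_left]
  · refine tsum_congr fun k => ?_
    rw [neumannLogSeq, if_neg (by omega), Nat.add_sub_cancel, neg_pow]
    ring
  · intro k hk
    rw [neumannLogSeq, if_pos (Finset.mem_range.1 hk), zero_mul]

theorem powerSum_euler_neumannLog (n : ℕ) (u : ℂ) :
    powerSum (eulerSeq (neumannLogSeq n)) u = (-u) ^ n * (n * powerSum (cliffordSeq n) u
      + powerSum (eulerSeq (cliffordSeq n)) u) := by
  have hc := isEntireSeq_clifford n
  rw [powerSum, ← ((isEntireSeq_neumannLog n).euler.summable u).sum_add_tsum_nat_add n,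
    Finset.sum_eq_zero, zero_add, powerSum, powerSum, ← tsum_mul_left,
    ← ((hc.summable u).mul_left _).tsum_add (hc.euler.summable u), ← tsum_mul_left]
  · refine tsum_congr fun k => ?_
    rw [eulerSeq, eulerSeq, neumannLogSeq, if_neg (by omega), Nat.add_sub_cancel, neg_pow]
    push_cast
    ring
  · intro k hk
    rw [eulerSeq, neumannLogSeq, if_pos (Finset.mem_range.1 hk), mul_zero, zero_mul]

theorem powerSum_neumann (n : ℕ) (u : ℂ) :
    powerSum (neumannSeq n) u =
      ∑ k ∈ Finset.range n, ((n - 1 - k).factorial : ℂ) / (k.factorial : ℂ) * (-u) ^ k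
      + (-u) ^ n * ∑' k : ℕ, ((digammaSucc k + digammaSucc (n + k) : ℝ) : ℂ) * u ^ k /
        ((k.factorial : ℂ) * ((n + k).factorial : ℂ)) := by
  rw [powerSum, ← ((isEntireSeq_neumann n).summable u).sum_add_tsum_nat_add n, ← tsum_mul_left]
  congr 1
  · refine Finset.sum_congr rfl fun k hk => ?_
    rw [neumannSeq, if_pos (Finset.mem_range.1 hk), neg_pow u]
    ring
  · refine tsum_congr fun k => ?_
    rw [neumannSeq, if_neg (by omega), Nat.add_sub_cancel, neg_pow u, add_comm n k]
    ring

theorem theta_eq_of_nat {l : ℝ} {n : ℕ} (hl : l + 1 / 2 = n) {ζ : ℂ} (hζ : ζ ≠ 0)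
    {x : ℝ} (hx : 0 < x) :
    theta l ζ x = ((√Real.pi * 2 ^ ((n : ℝ) - 1 / 2) / Real.pi : ℝ) : ℂ)
      * besselSeries (-n) (ζ ^ (1 / 2 : ℂ)) (neumannSeq n) (neumannLogSeq n) x := by
  have hs := congrArg ((↑) : ℝ → ℂ) (sqrt_mul_rpow_half hx (-n))
  have hx' : (x : ℂ) ≠ 0 := by exact_mod_cast hx.ne'
  have hk := cpow_half_ne_zero hζ
  have hlog : Complex.log (ζ ^ (1 / 2 : ℂ) * x / 2) = (Real.log (x / 2) : ℂ)
      + Complex.log ζ / 2 := by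
    rw [mul_div_assoc, show (x : ℂ) / 2 = ((x / 2 : ℝ) : ℂ) by push_cast; ring,
      Complex.log_mul_ofReal _ (by positivity) _ hk, log_cpow_half ζ hζ]
  have hpow : ζ ^ (((2 * l + 1) / 4 : ℝ) : ℂ) = (ζ ^ (1 / 2 : ℂ)) ^ n := by
    rw [← Complex.cpow_nat_mul, show (2 * l + 1) / 4 = (n : ℝ) / 2 by rw [← hl]; ring]
    push_cast
    congr 1
    ring
  have hu : ∀ w : ℂ, (-(-(w ^ 2 / 4))) ^ n = (w / 2) ^ n * (w / 2) ^ n := by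
    intro w; rw [← mul_pow]; congr 1; ring
  have hfl : ⌊l + 1 / 2⌋₊ = n := by rw [hl]; simp
  rw [theta, hfl, if_pos hl, hpow, besselY, hl, hlog, besselJ_eq, besselSeries, powerSum_neumann,
    powerSum_neumannLog, hu]
  simp only [neg_neg]
  rw [Real.rpow_neg (by positivity), Real.rpow_natCast] at hs
  have h2 : (((-n : ℝ)) : ℝ) = -(n : ℝ) := rfl
  generalize (∑ k ∈ Finset.range n, ((n - 1 - k).factorial : ℂ) / (k.factorial : ℂ) *
    ((ζ ^ (1 / 2 : ℂ) * x) ^ 2 / 4) ^ k) = S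
  generalize (∑' k : ℕ, ((digammaSucc k + digammaSucc (n + k) : ℝ) : ℂ) *
    (-((ζ ^ (1 / 2 : ℂ) * x) ^ 2 / 4)) ^ k / ((k.factorial : ℂ) * ((n + k).factorial : ℂ))) = D
  generalize powerSum _ _ = C
  rw [Complex.ofReal_natCast, Complex.cpow_natCast]
  set k := ζ ^ (1 / 2 : ℂ) with hkdef
  have e1 : (k * x / 2) ^ n = k ^ n * ((x : ℂ) / 2) ^ n := by rw [← mul_pow]; congr 1; ring
  rw [e1]
  have hkn : k ^ n ≠ 0 := pow_ne_zero _ hk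
  have hxn : ((x : ℂ) / 2) ^ n ≠ 0 := pow_ne_zero _ (by simpa using hx')
  have hpi : (Real.pi : ℂ) ≠ 0 := by exact_mod_cast Real.pi_ne_zero
  rw [neg_neg] at hs
  push_cast at hs ⊢
  generalize ((x : ℂ) / 2) ^ n = X at *
  generalize k ^ n = K at *
  generalize (Real.log (x / 2) : ℂ) = L at *
  have hs2 : (√(Real.pi * x / 2) : ℂ) = (√Real.pi : ℂ) * (((2 : ℝ) ^ ((n : ℝ) - 1 / 2) : ℝ) : ℂ)
      * ((x ^ (1 / 2 + -(n : ℝ)) : ℝ) : ℂ) * X := by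
    rw [← hs]
    field_simp
  rw [hs2]
  field_simp
  ring

theorem IsBesselSolution.const_mul {m ζ : ℂ} {f f' : ℝ → ℂ} (h : IsBesselSolution m ζ f f') (c : ℂ) :
    IsBesselSolution m ζ (fun x => c * f x) (fun x => c * f' x) where
  deriv_left x hx := (h.deriv_left x hx).const_mul c
  deriv_right x hx := ((h.deriv_right x hx).const_mul c).congr_deriv (by ring)

theorem IsBesselSolution.congr {m ζ : ℂ} {f g f' : ℝ → ℂ} (h : IsBesselSolution m ζ f f')
    (hg : ∀ x, 0 < x → g x = f x) : IsBesselSolution m ζ g f' where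
  deriv_left x hx := (h.deriv_left x hx).congr_of_eventuallyEq (by
    filter_upwards [lt_mem_nhds hx] with t ht using hg t ht)
  deriv_right x hx := by rw [hg x hx]; exact h.deriv_right x hx

/-- `φ_l` and `θ_l` solve the Bessel equation and have Wronskian `1`. -/
theorem exists_isBesselSolution_phi_theta {l : ℝ} (hl : -1 / 2 ≤ l) {ζ : ℂ} (hζ : ζ ≠ 0) :
    ∃ φ' θ' : ℝ → ℂ, IsBesselSolution (l * (l + 1) : ℝ) ζ (phi l ζ) φ' ∧
      IsBesselSolution (l * (l + 1) : ℝ) ζ (theta l ζ) θ' ∧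
      ∀ x, 0 < x → φ' x * theta l ζ x - phi l ζ x * θ' x = 1 := by
  have hk := cpow_half_ne_zero hζ
  have hk2 := cpow_half_sq ζ
  have hz : IsEntireSeq fun _ => 0 := fun R _ => by simp [summable_zero]
  have hm : ∀ s : ℝ, s = l + 1 / 2 ∨ s = -(l + 1 / 2) → s ^ 2 - 1 / 4 = l * (l + 1) := by
    rintro s (rfl | rfl) <;> ring
  have hsol : ∀ s : ℝ, (s = l + 1 / 2 ∨ s = -(l + 1 / 2)) → IsBesselSolution (l * (l + 1) : ℝ) ζ
      (besselSeries s (ζ ^ (1 / 2 : ℂ)) (cliffordSeq s) fun _ => 0)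
      (besselSeriesDeriv s (ζ ^ (1 / 2 : ℂ)) (cliffordSeq s) fun _ => 0) := by
    intro s hs
    have := isBesselSolution_besselSeries (μ := s) hk (isEntireSeq_clifford s) hz (by simp)
      (by intro j; simpa using cliffordSeq_succ s j) (by simp)
    rwa [hk2, hm s hs] at this
  have hφ := hsol _ (Or.inl rfl)
  by_cases hn : l + 1 / 2 = (⌊l + 1 / 2⌋₊ : ℝ)
  · generalize ⌊l + 1 / 2⌋₊ = n at hn
    have hθ : IsBesselSolution (l * (l + 1) : ℝ) ζ
        (besselSeries (-(l + 1 / 2)) (ζ ^ (1 / 2 : ℂ)) (neumannSeq n) (neumannLogSeq n))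
        (besselSeriesDeriv (-(l + 1 / 2)) (ζ ^ (1 / 2 : ℂ)) (neumannSeq n) (neumannLogSeq n)) := by
      have := isBesselSolution_besselSeries (μ := -(n : ℝ)) hk (isEntireSeq_neumann n)
        (isEntireSeq_neumannLog n)
        (by rcases n with _ | n <;> simp [neumannLogSeq]) (neumannSeq_succ n)
        (neumannLogSeq_succ n)
      rw [← hn] at this
      rwa [hk2, hm _ (Or.inr rfl)] at this
    refine ⟨_, _, (hφ.const_mul _).congr fun x hx => phi_eq hζ hx,
      (hθ.const_mul ((√Real.pi * 2 ^ ((n : ℝ) - 1 / 2) / Real.pi : ℝ) : ℂ)).congr fun x hx => ?_,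
      fun x hx => ?_⟩
    · rw [theta_eq_of_nat hn hζ hx, hn]
    · have hW := wronskian_besselSeries (isEntireSeq_clifford _) (isEntireSeq_neumann n)
        (isEntireSeq_neumannLog n) hφ hθ ?_ hx
      · rw [phi_eq hζ hx, theta_eq_of_nat hn hζ hx, ← hn]
        have hab : ((√Real.pi * 2 ^ (-(l + 1 / 2) - 1 / 2) : ℝ) : ℂ)
            * ((√Real.pi * 2 ^ ((l + 1 / 2) - 1 / 2) / Real.pi : ℝ) : ℂ) = 1 / 2 := by
          rw [← Complex.ofReal_mul]
          have h2 : (2 : ℝ) ^ (-(l + 1 / 2) - 1 / 2) * 2 ^ ((l + 1 / 2) - 1 / 2) = 1 / 2 := by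
            rw [← Real.rpow_add (by norm_num),
              show -(l + 1 / 2) - 1 / 2 + (l + 1 / 2 - 1 / 2) = -1 by ring, Real.rpow_neg_one]
            norm_num
          have h3 : √Real.pi * √Real.pi = Real.pi := Real.mul_self_sqrt Real.pi_pos.le
          have : √Real.pi * 2 ^ (-(l + 1 / 2) - 1 / 2) *
              (√Real.pi * 2 ^ ((l + 1 / 2) - 1 / 2) / Real.pi) = 1 / 2 := by
            rw [mul_div_assoc', mul_mul_mul_comm, h2, h3]
            field_simp [Real.pi_ne_zero]
          rw [this]; norm_num
        have hval : 2 * ((l + 1 / 2 : ℝ) : ℂ) * cliffordSeq (l + 1 / 2) 0 * neumannSeq n 0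
            + 2 * cliffordSeq (l + 1 / 2) 0 * neumannLogSeq n 0 = 2 := by
          rw [hn, cliffordSeq_nat]
          rcases n with _ | n
          · simp [neumannLogSeq, cliffordSeq]
          · have : (n.factorial : ℂ) ≠ 0 := by exact_mod_cast n.factorial_ne_zero
            have h1 : (n + 1 : ℂ) ≠ 0 := by exact_mod_cast n.succ_ne_zero
            simp [neumannLogSeq, neumannSeq, Nat.factorial_succ]
            field_simp
        rw [hval] at hW
        linear_combination (1 / 2 : ℂ) * hW + (besselSeriesDeriv (l + 1 / 2) (ζ ^ (1 / 2 : ℂ))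
          (cliffordSeq (l + 1 / 2)) (fun _ => 0) x * besselSeries (-(l + 1 / 2))
          (ζ ^ (1 / 2 : ℂ)) (neumannSeq n) (neumannLogSeq n) x
          - besselSeries (l + 1 / 2) (ζ ^ (1 / 2 : ℂ)) (cliffordSeq (l + 1 / 2)) (fun _ => 0) x *
          besselSeriesDeriv (-(l + 1 / 2)) (ζ ^ (1 / 2 : ℂ)) (neumannSeq n) (neumannLogSeq n) x)
          * hab
      · intro u
        rw [powerSum_neumannLog, powerSum_euler_neumannLog, hn]
        push_cast
        ring
  · have hθ := hsol _ (Or.inr rfl)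
    refine ⟨_, _, (hφ.const_mul _).congr fun x hx => phi_eq hζ hx,
      (hθ.const_mul _).congr fun x hx => theta_eq_of_not_nat hn hζ hx, fun x hx => ?_⟩
    have hW := wronskian_besselSeries (isEntireSeq_clifford _) (isEntireSeq_clifford _)
      hz hφ hθ (by simp [powerSum, eulerSeq]) hx
    rw [phi_eq hζ hx, theta_eq_of_not_nat hn hζ hx]
    set ν := l + 1 / 2 with hν
    have hν0 : ν ≠ 0 := by
      intro h; apply hn; rw [h]; simp
    have hpos : 0 < ν := lt_of_le_of_ne (by rw [hν]; linarith) (Ne.symm hν0)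
    have hsin : Real.sin (ν * Real.pi) ≠ 0 := by
      intro h
      obtain ⟨m, hm⟩ := Real.sin_eq_zero_iff.1 h
      have h1 : (m : ℝ) = ν := mul_right_cancel₀ Real.pi_ne_zero hm
      have h2 : 0 ≤ m := by
        have : (0 : ℝ) ≤ m := by rw [h1]; exact hpos.le
        exact_mod_cast this
      lift m to ℕ using h2
      apply hn
      rw [← h1]
      simp
    have hval : 2 * (ν : ℂ) * cliffordSeq ν 0 * cliffordSeq (-ν) 0
        = 2 * (Real.sin (ν * Real.pi) : ℂ) / (Real.pi : ℂ) := by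
      have h1 := Real.Gamma_mul_Gamma_one_sub ν
      have h2 := Real.Gamma_add_one hν0
      have h3 : Real.Gamma (ν + 1) * Real.Gamma (-ν + 1) = ν * Real.pi / Real.sin (ν * Real.pi) := by
        rw [h2, show -ν + 1 = 1 - ν by ring, mul_assoc, h1, mul_comm Real.pi ν]; ring
      have h4 : 2 * ν * (1 / Real.Gamma (ν + 1)) * (1 / Real.Gamma (-ν + 1))
          = 2 * Real.sin (ν * Real.pi) / Real.pi := by
        rw [mul_assoc, one_div_mul_one_div, h3]
        field_simp
      have h5 := congrArg ((↑) : ℝ → ℂ) h4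
      push_cast at h5
      simp only [cliffordSeq]
      simpa using h5
    have hab : ((√Real.pi * 2 ^ (-ν - 1 / 2) : ℝ) : ℂ)
        * ((√Real.pi * 2 ^ (ν - 1 / 2) / Real.sin (ν * Real.pi) : ℝ) : ℂ)
        * (2 * (Real.sin (ν * Real.pi) : ℂ) / (Real.pi : ℂ)) = 1 := by
      have h2 : (2 : ℝ) ^ (-ν - 1 / 2) * 2 ^ (ν - 1 / 2) = 1 / 2 := by
        rw [← Real.rpow_add (by norm_num),
          show -ν - 1 / 2 + (ν - 1 / 2) = -1 by ring, Real.rpow_neg_one]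
        norm_num
      have : √Real.pi * 2 ^ (-ν - 1 / 2) * (√Real.pi * 2 ^ (ν - 1 / 2) / Real.sin (ν * Real.pi))
          * (2 * Real.sin (ν * Real.pi) / Real.pi) = 1 := by
        have h3 : √Real.pi * √Real.pi = Real.pi := Real.mul_self_sqrt Real.pi_pos.le
        have hp := Real.pi_ne_zero
        generalize Real.sin (ν * Real.pi) = s at *
        generalize (2 : ℝ) ^ (-ν - 1 / 2) = p at *
        generalize (2 : ℝ) ^ (ν - 1 / 2) = q at *
        generalize √Real.pi = r at *
        field_simp
        linear_combination 2 * p * q * h3 + 2 * Real.pi * h2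
      exact_mod_cast congrArg ((↑) : ℝ → ℂ) this
    rw [hval] at hW
    rw [mul_zero, add_zero] at hW
    rw [← hW] at hab
    linear_combination hab

/-- The structure of the kernel `K_l(ζ, x, y)` for all `l`: it is `f(x) g(y) - f(y) g(x)` for two
solutions of the Bessel equation with Wronskian `1`. -/
theorem exists_kernel_eq {l : ℝ} {ζ : ℂ} (hζ : ζ ≠ 0) :
    ∃ f f' g g' : ℝ → ℂ, IsBesselSolution (l * (l + 1) : ℝ) ζ f f' ∧
      IsBesselSolution (l * (l + 1) : ℝ) ζ g g' ∧
      (∀ x, 0 < x → f' x * g x - f x * g' x = 1) ∧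
      ∀ x y, kernel l ζ x y = f x * g y - f y * g x := by
  by_cases h : -1 / 2 ≤ l
  · obtain ⟨φ', θ', h1, h2, h3⟩ := exists_isBesselSolution_phi_theta h hζ
    exact ⟨_, _, _, _, h1, h2, h3, fun x y => by rw [kernel, if_pos h]⟩
  · obtain ⟨φ', θ', h1, h2, h3⟩ := exists_isBesselSolution_phi_theta (l := -1 - l)
      (by linarith) hζ
    rw [show (-1 - l) * (-1 - l + 1) = l * (l + 1) by ring] at h1 h2
    exact ⟨_, _, _, _, h1, h2, h3, fun x y => by rw [kernel, if_neg h]⟩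

/-! ### The free Dirac system -/

/-- The coordinate `u₂ + i u₁`, in which the principal part of the Dirac system is diagonal. -/
noncomputable def coordPlus (v : Fin 2 → ℂ) : ℂ := v 1 + Complex.I * v 0

/-- The coordinate `u₂ - i u₁`, in which the principal part of the Dirac system is diagonal. -/
noncomputable def coordMinus (v : Fin 2 → ℂ) : ℂ := v 1 - Complex.I * v 0

/-- `a = u₂ + i u₁` and `b = u₂ - i u₁` for a solution `u` of the free radial Dirac system
`u₁' = -(κ/x) u₁ + z u₂`, `u₂' = (κ/x) u₂ - z u₁` on `(0, ∞)`. -/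
structure IsDiracSolution (κ : ℝ) (z : ℂ) (a b : ℝ → ℂ) : Prop where
  deriv_left : ∀ x : ℝ, 0 < x → HasDerivAt a (Complex.I * z * a x + κ / x * b x) x
  deriv_right : ∀ x : ℝ, 0 < x → HasDerivAt b (-(Complex.I * z * b x) + κ / x * a x) x

theorem IsDiracSolution.congr {κ : ℝ} {z : ℂ} {a b a₁ b₁ : ℝ → ℂ} (h : IsDiracSolution κ z a b)
    (ha : ∀ x, 0 < x → a₁ x = a x) (hb : ∀ x, 0 < x → b₁ x = b x) :
    IsDiracSolution κ z a₁ b₁ where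
  deriv_left x hx := by
    rw [ha x hx, hb x hx]
    refine (h.deriv_left x hx).congr_of_eventuallyEq ?_
    filter_upwards [lt_mem_nhds hx] with t ht using ha t ht
  deriv_right x hx := by
    rw [ha x hx, hb x hx]
    refine (h.deriv_right x hx).congr_of_eventuallyEq ?_
    filter_upwards [lt_mem_nhds hx] with t ht using hb t ht

theorem IsDiracSolution.of_components {κ : ℝ} {z : ℂ} {u₁ u₂ : ℝ → ℂ}
    (h1 : ∀ x : ℝ, 0 < x → HasDerivAt u₁ (-(κ / x * u₁ x) + z * u₂ x) x)
    (h2 : ∀ x : ℝ, 0 < x → HasDerivAt u₂ (κ / x * u₂ x - z * u₁ x) x) :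
    IsDiracSolution κ z (fun x => u₂ x + Complex.I * u₁ x) (fun x => u₂ x - Complex.I * u₁ x) where
  deriv_left x hx := by
    refine ((h2 x hx).add ((h1 x hx).const_mul Complex.I)).congr_deriv ?_
    linear_combination (-(z * u₁ x)) * Complex.I_sq
  deriv_right x hx := by
    refine ((h2 x hx).sub ((h1 x hx).const_mul Complex.I)).congr_deriv ?_
    linear_combination (-(z * u₁ x)) * Complex.I_sq

theorem hasDerivAt_const_div (κ : ℝ) {x : ℝ} (hx : 0 < x) :
    HasDerivAt (fun t : ℝ => (κ : ℂ) / t) (-(κ / x ^ 2)) x := by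
  have hx' : (x : ℂ) ≠ 0 := by exact_mod_cast hx.ne'
  have h := ((hasDerivAt_id x).ofReal_comp.inv hx').const_mul (κ : ℂ)
  simp only [div_eq_mul_inv]
  refine h.congr_deriv ?_
  simp [div_eq_mul_inv]

/-- A solution `f` of the Bessel equation with `l = κ` gives the solution `(z f, f' + (κ/x) f)` of
the free Dirac system. -/
theorem IsBesselSolution.components_up {κ : ℝ} {z : ℂ} {f f' : ℝ → ℂ}
    (h : IsBesselSolution (κ * (κ + 1) : ℝ) (z ^ 2) f f') :
    IsDiracSolution κ z (fun x => (f' x + κ / x * f x) + Complex.I * (z * f x))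
      (fun x => (f' x + κ / x * f x) - Complex.I * (z * f x)) := by
  refine IsDiracSolution.of_components (u₁ := fun x => z * f x)
    (u₂ := fun x => f' x + κ / x * f x) (fun x hx => ?_) (fun x hx => ?_)
  · exact ((h.deriv_left x hx).const_mul z).congr_deriv (by ring)
  · refine ((h.deriv_right x hx).add
      ((hasDerivAt_const_div κ hx).mul (h.deriv_left x hx))).congr_deriv ?_
    push_cast
    ring

/-- A solution `f` of the Bessel equation with `l = κ - 1` gives the solution `(-f' + (κ/x) f, z f)`
of the free Dirac system. -/
theorem IsBesselSolution.components_down {κ : ℝ} {z : ℂ} {f f' : ℝ → ℂ}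
    (h : IsBesselSolution ((κ - 1) * (κ - 1 + 1) : ℝ) (z ^ 2) f f') :
    IsDiracSolution κ z (fun x => z * f x + Complex.I * (-f' x + κ / x * f x))
      (fun x => z * f x - Complex.I * (-f' x + κ / x * f x)) := by
  refine IsDiracSolution.of_components (u₁ := fun x => -f' x + κ / x * f x)
    (u₂ := fun x => z * f x) (fun x hx => ?_) (fun x hx => ?_)
  · refine ((h.deriv_right x hx).neg.add
      ((hasDerivAt_const_div κ hx).mul (h.deriv_left x hx))).congr_deriv ?_
    push_cast
    ring
  · exact ((h.deriv_left x hx).const_mul z).congr_deriv (by ring)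

theorem IsDiracSolution.linear {κ : ℝ} {z : ℂ} {a b a₁ b₁ : ℝ → ℂ} (h : IsDiracSolution κ z a b)
    (h₁ : IsDiracSolution κ z a₁ b₁) (c c₁ : ℂ) :
    IsDiracSolution κ z (fun x => c * a x + c₁ * a₁ x) (fun x => c * b x + c₁ * b₁ x) where
  deriv_left x hx := (((h.deriv_left x hx).const_mul c).add
    ((h₁.deriv_left x hx).const_mul c₁)).congr_deriv (by ring)
  deriv_right x hx := (((h.deriv_right x hx).const_mul c).add
    ((h₁.deriv_right x hx).const_mul c₁)).congr_deriv (by ring)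

theorem IsBesselSolution.comb {m ζ : ℂ} {f f' g g' : ℝ → ℂ} (hf : IsBesselSolution m ζ f f')
    (hg : IsBesselSolution m ζ g g') (c d : ℂ) :
    IsBesselSolution m ζ (fun x => f x * c - d * g x) (fun x => f' x * c - d * g' x) where
  deriv_left x hx := ((hf.deriv_left x hx).mul_const c).sub ((hg.deriv_left x hx).const_mul d)
  deriv_right x hx := (((hf.deriv_right x hx).mul_const c).sub
    ((hg.deriv_right x hx).const_mul d)).congr_deriv (by ring)

theorem exists_kernel_deriv {l : ℝ} {ζ : ℂ} (hζ : ζ ≠ 0) :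
    ∃ k' : ℝ → ℝ → ℂ, (∀ y, IsBesselSolution (l * (l + 1) : ℝ) ζ (fun x => kernel l ζ x y)
        (fun x => k' x y)) ∧
      (∀ y, 0 < y → kernel l ζ y y = 0 ∧ k' y y = 1) ∧
      ∀ x, ContinuousOn (fun y => kernel l ζ x y) (Set.Ioi 0) ∧
        ContinuousOn (fun y => k' x y) (Set.Ioi 0) := by
  obtain ⟨f, f', g, g', hf, hg, hW, hk⟩ := exists_kernel_eq (l := l) hζ
  have cf : ContinuousOn f (Set.Ioi 0) := fun x hx =>
    (hf.deriv_left x hx).continuousAt.continuousWithinAt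
  have cg : ContinuousOn g (Set.Ioi 0) := fun x hx =>
    (hg.deriv_left x hx).continuousAt.continuousWithinAt
  refine ⟨fun x y => f' x * g y - f y * g' x, fun y => ?_, fun y hy => ⟨?_, hW y hy⟩,
    fun x => ⟨?_, ?_⟩⟩
  · simpa only [hk] using hf.comb hg (g y) (f y)
  · rw [hk, sub_self]
  · simp only [hk]
    exact (continuousOn_const.mul cg).sub (cf.mul continuousOn_const)
  · exact (continuousOn_const.mul cg).sub (cf.mul continuousOn_const)

/-- For fixed `y` and `c`, the function `x ↦ K(z, x, y) c` solves the free Dirac system, with the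
initial value `(-c₂, c₁)` at `x = y`. -/
theorem diracKernel_isDiracSolution {κ : ℝ} {z : ℂ} (hz : z ≠ 0) :
    (∀ (y : ℝ) (c : Fin 2 → ℂ), IsDiracSolution κ z
      (fun x => coordPlus ((diracKernel κ z x y).mulVec c))
      (fun x => coordMinus ((diracKernel κ z x y).mulVec c))) ∧
    (∀ (y : ℝ) (c : Fin 2 → ℂ), 0 < y →
      coordPlus ((diracKernel κ z y y).mulVec c) = -Complex.I * coordPlus c ∧
      coordMinus ((diracKernel κ z y y).mulVec c) = Complex.I * coordMinus c) ∧
    ∀ x : ℝ, 0 < x → ∀ i j, ContinuousOn (fun y => diracKernel κ z x y i j) (Set.Ioi 0) := by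
  have hz2 : z ^ 2 ≠ 0 := pow_ne_zero 2 hz
  obtain ⟨k', h1, h2, h3⟩ := exists_kernel_deriv (l := κ) hz2
  obtain ⟨m', g1, g2, g3⟩ := exists_kernel_deriv (l := κ - 1) hz2
  have dk : ∀ x, 0 < x → ∀ y, deriv (fun t : ℝ => kernel κ (z ^ 2) t y) x = k' x y :=
    fun x hx y => ((h1 y).deriv_left x hx).deriv
  have dm : ∀ x, 0 < x → ∀ y, deriv (fun t : ℝ => kernel (κ - 1) (z ^ 2) t y) x = m' x y :=
    fun x hx y => ((g1 y).deriv_left x hx).deriv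
  refine ⟨fun y c => ?_, fun y c hy => ?_, fun x hx i j => ?_⟩
  · refine ((h1 y).components_up.linear (g1 y).components_down (c 0) (c 1)).congr
      (fun x hx => ?_) (fun x hx => ?_)
    · simp only [coordPlus, diracKernel, Matrix.mulVec, dotProduct, Fin.sum_univ_two, dk x hx, dm x hx]
      simp
      ring
    · simp only [coordMinus, diracKernel, Matrix.mulVec, dotProduct, Fin.sum_univ_two, dk x hx,
        dm x hx]
      simp
      ring
  · constructor
    · simp only [coordPlus, diracKernel, Matrix.mulVec, dotProduct, Fin.sum_univ_two, dk y hy,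
        dm y hy, h2 y hy, g2 y hy]
      simp
      linear_combination (c 0) * Complex.I_sq
    · simp only [coordMinus, diracKernel, Matrix.mulVec, dotProduct, Fin.sum_univ_two, dk y hy,
        dm y hy, h2 y hy, g2 y hy]
      simp
      linear_combination (c 0) * Complex.I_sq
  · have a1 := (h3 x).1
    have a2 := (h3 x).2
    have a3 := (g3 x).1
    have a4 := (g3 x).2
    fin_cases i <;> fin_cases j <;> simp [diracKernel, dk x hx, dm x hx] <;> fun_prop

/-! ### The regular solution of the free Dirac system -/

/-- The first component of the free regular solution is `x ^ κ` times this function of `w = z x`. -/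
noncomputable def freeFst (κ : ℝ) (w : ℂ) : ℂ :=
  ((√Real.pi * 2 ^ (-κ - 1) : ℝ) : ℂ) * w * powerSum (cliffordSeq (κ + 1 / 2)) (-(w ^ 2 / 4))

/-- The second component of the free regular solution is `x ^ κ` times this function of `w = z x`. -/
noncomputable def freeSnd (κ : ℝ) (w : ℂ) : ℂ :=
  ((√Real.pi * 2 ^ (-κ) : ℝ) : ℂ) * powerSum (cliffordSeq (κ - 1 / 2)) (-(w ^ 2 / 4))

theorem freeSolution_eq {κ : ℝ} {z : ℂ} (hz : z ≠ 0) {x : ℝ} (hx : 0 < x) :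
    freeSolution κ z x 0 = ((x ^ κ : ℝ) : ℂ) * freeFst κ (z * x) ∧
    freeSolution κ z x 1 = ((x ^ κ : ℝ) : ℂ) * freeSnd κ (z * x) := by
  have hz2 : z ^ 2 ≠ 0 := pow_ne_zero 2 hz
  have hx' : (x : ℂ) ≠ 0 := by exact_mod_cast hx.ne'
  set k := (z ^ 2) ^ (1 / 2 : ℂ) with hk
  have hk2 : (k * x) ^ 2 = (z * x) ^ 2 := by rw [mul_pow, mul_pow, hk, cpow_half_sq]
  have hzs : IsEntireSeq fun _ => 0 := fun R _ => by simp [summable_zero]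
  have h0 : ∀ u, powerSum (fun _ => 0) u = 0 := by simp [powerSum]
  have h0' : ∀ u, powerSum (eulerSeq fun _ => 0) u = 0 := by simp [powerSum, eulerSeq]
  have hsol := (isBesselSolution_besselSeries (μ := κ + 1 / 2) (cpow_half_ne_zero hz2)
    (isEntireSeq_clifford (κ + 1 / 2)) hzs (by simp)
    (by intro j; simpa using cliffordSeq_succ (κ + 1 / 2) j) (by simp)).const_mul
    ((√Real.pi * 2 ^ (-(κ + 1 / 2) - 1 / 2) : ℝ) : ℂ)
  have hd := ((hsol.congr fun t ht => phi_eq (l := κ) hz2 ht).deriv_left x hx).deriv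
  have hpow : x ^ (1 / 2 + (κ + 1 / 2)) = x ^ κ * x := by
    rw [← Real.rpow_add_one hx.ne']; congr 1; ring
  have hpow' : x ^ (κ + 1 / 2 - 1 / 2) = x ^ κ := by congr 1; ring
  have h2 : (2 : ℝ) ^ (-(κ + 1 / 2) - 1 / 2) = 2 ^ (-κ - 1) := by congr 1; ring
  constructor
  · simp only [freeSolution, Matrix.cons_val_zero]
    rw [phi_eq hz2 hx, besselSeries, h0, ← hk, hk2, hpow, h2, freeFst]
    push_cast
    ring
  · simp only [freeSolution, Matrix.cons_val_one, Matrix.cons_val_zero]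
    have hp := powerSum_clifford_pred (κ + 1 / 2) (-((z * x) ^ 2 / 4))
    have h3 : (2 : ℝ) ^ (-κ) = 2 * 2 ^ (-κ - 1) := by
      rw [Real.rpow_sub_one (by norm_num)]; ring
    rw [show (fun t : ℝ => phi κ (z ^ 2) t) = phi κ (z ^ 2) from rfl, hd, phi_eq hz2 hx,
      besselSeries, besselSeriesDeriv, h0, h0', ← hk, hk2, hpow, hpow', h2, freeSnd, h3,
      show κ - 1 / 2 = κ + 1 / 2 - 1 by ring, ← hp]
    push_cast
    field_simp
    ring

/-! ### Growth of solutions of the free Dirac system -/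

/-- The Euclidean norm of the pair `(a, b)`. -/
noncomputable def pairNorm (a b : ℂ) : ℝ := ‖(!₂[a, b] : EuclideanSpace ℂ (Fin 2))‖

theorem pairNorm_nonneg (a b : ℂ) : 0 ≤ pairNorm a b := norm_nonneg _

theorem pairNorm_sq (a b : ℂ) : pairNorm a b ^ 2 = ‖a‖ ^ 2 + ‖b‖ ^ 2 := by
  simp [pairNorm, EuclideanSpace.norm_sq_eq, Fin.sum_univ_two]

theorem pairNorm_add_le (a b c d : ℂ) :
    pairNorm (a + c) (b + d) ≤ pairNorm a b + pairNorm c d := by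
  have : (!₂[a + c, b + d] : EuclideanSpace ℂ (Fin 2)) = !₂[a, b] + !₂[c, d] := by
    ext i; fin_cases i <;> simp
  rw [pairNorm, this]
  exact norm_add_le _ _

theorem pairNorm_mul (c a b : ℂ) : pairNorm (c * a) (c * b) = ‖c‖ * pairNorm a b := by
  have : (!₂[c * a, c * b] : EuclideanSpace ℂ (Fin 2)) = c • !₂[a, b] := by
    ext i; fin_cases i <;> simp
  rw [pairNorm, this, norm_smul, pairNorm]

theorem pairNorm_comm (a b : ℂ) : pairNorm a b = pairNorm b a := by
  refine (sq_eq_sq₀ (pairNorm_nonneg _ _) (pairNorm_nonneg _ _)).1 ?_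
  rw [pairNorm_sq, pairNorm_sq, add_comm]

theorem pairNorm_neg_left (a b : ℂ) : pairNorm (-a) b = pairNorm a b := by
  refine (sq_eq_sq₀ (pairNorm_nonneg _ _) (pairNorm_nonneg _ _)).1 ?_
  rw [pairNorm_sq, pairNorm_sq, norm_neg]

theorem norm_le_pairNorm_left (a b : ℂ) : ‖a‖ ≤ pairNorm a b := by
  refine le_of_sq_le_sq₀ ?_ (pairNorm_nonneg _ _)
  rw [pairNorm_sq]
  nlinarith [sq_nonneg ‖b‖]
where
  le_of_sq_le_sq₀ {x y : ℝ} (h : x ^ 2 ≤ y ^ 2) (hy : 0 ≤ y) : x ≤ y := abs_le_of_sq_le_sq' h hy |>.2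

theorem norm_le_pairNorm_right (a b : ℂ) : ‖b‖ ≤ pairNorm a b := by
  rw [pairNorm_comm]; exact norm_le_pairNorm_left b a

theorem pairNorm_le_add (a b : ℂ) : pairNorm a b ≤ ‖a‖ + ‖b‖ := by
  refine (abs_le_of_sq_le_sq' ?_ (by positivity)).2
  rw [pairNorm_sq]
  nlinarith [norm_nonneg a, norm_nonneg b]

/-- The energy estimate: a differential inequality for the square of the norm, integrated. -/
theorem pairNorm_le_of_energy {a b a' b' : ℝ → ℂ} {A c : ℝ → ℝ} {y x : ℝ} (hyx : y ≤ x)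
    (ha : ∀ t ∈ Set.Icc y x, HasDerivAt a (a' t) t) (hb : ∀ t ∈ Set.Icc y x, HasDerivAt b (b' t) t)
    (hA : ∀ t ∈ Set.Icc y x, HasDerivAt A (c t) t)
    (h : ∀ t ∈ Set.Icc y x, inner ℝ (a t) (a' t) + inner ℝ (b t) (b' t)
      ≤ c t * pairNorm (a t) (b t) ^ 2) :
    pairNorm (a x) (b x) ≤ pairNorm (a y) (b y) * Real.exp (A x - A y) := by
  set F : ℝ → ℝ := fun t => (‖a t‖ ^ 2 + ‖b t‖ ^ 2) * Real.exp (-(2 * A t)) with hF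
  have hFd : ∀ t ∈ Set.Icc y x, HasDerivAt F ((2 * inner ℝ (a t) (a' t)
      + 2 * inner ℝ (b t) (b' t)) * Real.exp (-(2 * A t))
      + (‖a t‖ ^ 2 + ‖b t‖ ^ 2) * (Real.exp (-(2 * A t)) * -(2 * c t))) t := fun t ht =>
    ((ha t ht).norm_sq.add (hb t ht).norm_sq).mul ((hA t ht).const_mul 2).neg.exp
  have hanti : AntitoneOn F (Set.Icc y x) := by
    refine antitoneOn_of_deriv_nonpos (convex_Icc y x)
      (fun t ht => (hFd t ht).continuousAt.continuousWithinAt)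
      (fun t ht => (hFd t (interior_subset ht)).differentiableAt.differentiableWithinAt)
      (fun t ht => ?_)
    rw [(hFd t (interior_subset ht)).deriv]
    have h1 := h t (interior_subset ht)
    rw [pairNorm_sq] at h1
    have h2 := Real.exp_pos (-(2 * A t))
    nlinarith
  have h3 : F x ≤ F y := hanti (Set.left_mem_Icc.2 hyx) (Set.right_mem_Icc.2 hyx) hyx
  refine (abs_le_of_sq_le_sq' ?_ (mul_nonneg (pairNorm_nonneg _ _) (Real.exp_pos _).le)).2
  rw [mul_pow, pairNorm_sq, pairNorm_sq, ← Real.exp_nat_mul]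
  have h4 : Real.exp ((2 : ℕ) * (A x - A y)) = Real.exp (-(2 * A y)) * Real.exp (2 * A x) := by
    rw [← Real.exp_add]; congr 1; push_cast; ring
  have h5 : Real.exp (-(2 * A x)) * Real.exp (2 * A x) = 1 := by
    rw [← Real.exp_add]; simp
  rw [h4, ← mul_assoc]
  calc ‖a x‖ ^ 2 + ‖b x‖ ^ 2 = F x * Real.exp (2 * A x) := by
        simp only [hF]; rw [mul_assoc, h5, mul_one]
    _ ≤ F y * Real.exp (2 * A x) := by gcongr

theorem inner_I_mul (z a : ℂ) : inner ℝ a (Complex.I * z * a) = -z.im * ‖a‖ ^ 2 := by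
  rw [Complex.inner, ← Complex.normSq_eq_norm_sq, Complex.normSq_apply]
  simp
  ring

theorem IsDiracSolution.swap {κ : ℝ} {z : ℂ} {a b : ℝ → ℂ} (h : IsDiracSolution κ z a b) :
    IsDiracSolution κ (-z) b a where
  deriv_left x hx := (h.deriv_right x hx).congr_deriv (by ring)
  deriv_right x hx := (h.deriv_left x hx).congr_deriv (by ring)

theorem abs_im_energy_le (s u v : ℝ) (hu : 0 ≤ u) (hv : 0 ≤ v) : -s * u + s * v ≤ |s| * (u + v) := by
  have h1 := neg_le_abs s
  have h2 := le_abs_self s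
  nlinarith

/-- The growth estimate that is sharp for `x ≲ 1 / |z|`. -/
theorem IsDiracSolution.pairNorm_le_near {κ : ℝ} (hκ : 0 ≤ κ) {z : ℂ} {a b : ℝ → ℂ}
    (h : IsDiracSolution κ z a b) {y x : ℝ} (hy : 0 < y) (hyx : y ≤ x) :
    pairNorm (a x) (b x)
      ≤ (x / y) ^ κ * Real.exp (|z.im| * (x - y)) * pairNorm (a y) (b y) := by
  have hx : 0 < x := hy.trans_le hyx
  have key := pairNorm_le_of_energy (A := fun t => κ * Real.log t + |z.im| * t)
    (c := fun t => κ * t⁻¹ + |z.im| * 1) hyx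
    (fun t ht => h.deriv_left t (hy.trans_le ht.1)) (fun t ht => h.deriv_right t (hy.trans_le ht.1))
    (fun t ht => ((Real.hasDerivAt_log (hy.trans_le ht.1).ne').const_mul κ).add
      ((hasDerivAt_id t).const_mul _)) ?_
  · refine key.trans_eq ?_
    rw [mul_comm, Real.rpow_def_of_pos (by positivity), Real.log_div hx.ne' hy.ne', ← Real.exp_add]
    congr 2
    ring
  · intro t ht
    have ht0 : 0 < t := hy.trans_le ht.1
    rw [inner_add_right, inner_add_right, inner_neg_right, inner_I_mul, inner_I_mul, pairNorm_sq]
    have hs : ∀ c d : ℂ, inner ℝ c ((κ : ℂ) / t * d) = κ * t⁻¹ * inner ℝ c d := by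
      intro c d
      have : (κ : ℂ) / t * d = (κ * t⁻¹ : ℝ) • d := by
        rw [Complex.real_smul]; push_cast; rw [div_eq_mul_inv]
      rw [this, inner_smul_right]
    rw [hs, hs, real_inner_comm]
    have h1 := real_inner_le_norm (a t) (b t)
    rw [real_inner_comm] at h1
    have h2 := abs_im_energy_le z.im (‖a t‖ ^ 2) (‖b t‖ ^ 2) (by positivity) (by positivity)
    have h3 : 0 ≤ κ * t⁻¹ := by positivity
    have h4 : 2 * inner ℝ (b t) (a t) ≤ ‖a t‖ ^ 2 + ‖b t‖ ^ 2 := by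
      nlinarith [sq_nonneg (‖a t‖ - ‖b t‖)]
    nlinarith

/-- The change of variables `a - (iκ / 2w) b` removes the term of order `1/w` from the Dirac system,
along any path `w`. -/
theorem hasDerivAt_gauge {κ : ℝ} {w a b : ℝ → ℂ} {w' : ℂ} {t : ℝ} (h0 : w t ≠ 0)
    (hw : HasDerivAt w w' t) (ha : HasDerivAt a (w' * (Complex.I * a t + κ / w t * b t)) t)
    (hb : HasDerivAt b (w' * (-(Complex.I * b t) + κ / w t * a t)) t) :
    HasDerivAt (fun s => a s - Complex.I * κ / 2 / w s * b s)
      (w' * (Complex.I * (a t - Complex.I * κ / 2 / w t * b t)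
        - Complex.I * κ / 2 / w t ^ 2 * (κ * a t - b t))) t := by
  have hi : HasDerivAt (fun s => Complex.I * κ / 2 / w s)
      (Complex.I * κ / 2 * (-w' / w t ^ 2)) t := by
    simpa only [div_eq_mul_inv] using! (hw.inv h0).const_mul (Complex.I * κ / 2)
  refine (ha.sub (hi.mul hb)).congr_deriv ?_
  field_simp
  linear_combination (2 * b t * w t * κ * w') * Complex.I_sq

theorem IsDiracSolution.hasDerivAt_gauge_left {κ : ℝ} {z : ℂ} (hz : z ≠ 0) {a b : ℝ → ℂ}
    (h : IsDiracSolution κ z a b) {t : ℝ} (ht : 0 < t) :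
    HasDerivAt (fun s : ℝ => a s - Complex.I * κ / 2 / (z * s) * b s)
      (z * (Complex.I * (a t - Complex.I * κ / 2 / (z * t) * b t)
        - Complex.I * κ / 2 / (z * t) ^ 2 * (κ * a t - b t))) t := by
  have ht' : (t : ℂ) ≠ 0 := by exact_mod_cast ht.ne'
  have hw : HasDerivAt (fun s : ℝ => z * (s : ℂ)) z t := by
    simpa using (hasDerivAt_id t).ofReal_comp.const_mul z
  refine hasDerivAt_gauge (w := fun s : ℝ => z * (s : ℂ)) (mul_ne_zero hz ht') hw
    ((h.deriv_left t ht).congr_deriv ?_) ((h.deriv_right t ht).congr_deriv ?_) <;> field_simp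

theorem norm_gauge_coeff {κ : ℝ} (hκ : 0 ≤ κ) (w : ℂ) :
    ‖Complex.I * κ / 2 / w‖ = κ / (2 * ‖w‖) := by
  simp [abs_of_nonneg hκ, div_div]

theorem norm_gauge_remainder {κ : ℝ} (hκ : 0 ≤ κ) (w a b : ℂ) :
    ‖Complex.I * κ / 2 / w ^ 2 * (κ * a - b)‖ ≤ κ * (κ + 1) / 2 / ‖w‖ ^ 2 * pairNorm a b := by
  rw [norm_mul, norm_gauge_coeff hκ, norm_pow]
  have h1 : ‖(κ : ℂ) * a - b‖ ≤ (κ + 1) * pairNorm a b := by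
    refine (norm_sub_le _ _).trans ?_
    rw [norm_mul, Complex.norm_real, Real.norm_of_nonneg hκ]
    nlinarith [norm_le_pairNorm_left a b, norm_le_pairNorm_right a b]
  calc κ / (2 * ‖w‖ ^ 2) * ‖(κ : ℂ) * a - b‖
      ≤ κ / (2 * ‖w‖ ^ 2) * ((κ + 1) * pairNorm a b) := by gcongr
    _ = _ := by rw [div_mul_eq_mul_div, div_div, div_mul_eq_mul_div]; ring

/-- The change of variables of `hasDerivAt_gauge` and its inverse are bounded for `|w| ≥ κ + 1`. -/
theorem pairNorm_gauge {κ : ℝ} (hκ : 0 ≤ κ) {w : ℂ} (hw : κ + 1 ≤ ‖w‖) (a b : ℂ) :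
    pairNorm (a - Complex.I * κ / 2 / w * b) (b + Complex.I * κ / 2 / w * a) ≤ 3 / 2 * pairNorm a b ∧
    pairNorm a b ≤
      2 * pairNorm (a - Complex.I * κ / 2 / w * b) (b + Complex.I * κ / 2 / w * a) := by
  set ε := Complex.I * κ / 2 / w with hε
  have hε2 : ‖ε‖ ≤ 1 / 2 := by
    rw [hε, norm_gauge_coeff hκ, div_le_div_iff₀ (by linarith) (by norm_num)]
    linarith
  have hn := pairNorm_nonneg a b
  have h1 : pairNorm (ε * -b) (ε * a) = ‖ε‖ * pairNorm a b := by
    rw [pairNorm_mul, pairNorm_neg_left, pairNorm_comm]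
  have h2 : pairNorm (ε * b) (ε * -a) = ‖ε‖ * pairNorm a b := by
    rw [pairNorm_mul, pairNorm_comm, pairNorm_neg_left]
  have t1 := pairNorm_add_le a b (ε * -b) (ε * a)
  have t2 := pairNorm_add_le (a - ε * b) (b + ε * a) (ε * b) (ε * -a)
  rw [h1] at t1
  rw [h2] at t2
  rw [show a + ε * -b = a - ε * b by ring] at t1
  rw [show a - ε * b + ε * b = a by ring, show b + ε * a + ε * -a = b by ring] at t2
  constructor <;> nlinarith

/-- The growth estimate that is sharp for `x ≳ 1 / |z|`: there the term `κ/x` has no effect, as it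
is oscillating in the appropriate coordinates. -/
theorem IsDiracSolution.pairNorm_le_far {κ : ℝ} (hκ : 0 ≤ κ) {z : ℂ} {a b : ℝ → ℂ}
    (h : IsDiracSolution κ z a b) {y x : ℝ} (hy : 0 < y) (hzy : κ + 1 ≤ ‖z‖ * y) (hyx : y ≤ x) :
    pairNorm (a x) (b x)
      ≤ 3 * Real.exp (2 * κ) * Real.exp (|z.im| * (x - y)) * pairNorm (a y) (b y) := by
  have hz : z ≠ 0 := by rintro rfl; simp at hzy; linarith
  have hz' : 0 < ‖z‖ := norm_pos_iff.2 hz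
  have hx : 0 < x := hy.trans_le hyx
  have hw : ∀ t, y ≤ t → κ + 1 ≤ ‖z * (t : ℂ)‖ := by
    intro t ht
    rw [norm_mul, Complex.norm_real, Real.norm_of_nonneg (hy.le.trans ht)]
    exact hzy.trans (by gcongr)
  set V : ℝ → ℂ := fun s => a s - Complex.I * κ / 2 / (z * s) * b s with hV
  set W : ℝ → ℂ := fun s => b s + Complex.I * κ / 2 / (z * s) * a s with hW
  have hWd : ∀ t : ℝ, 0 < t → HasDerivAt W (-z * (Complex.I * W t
        - Complex.I * κ / 2 / (-z * t) ^ 2 * (κ * b t - a t))) t := by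
    intro t ht
    have h1 := h.swap.hasDerivAt_gauge_left (neg_ne_zero.2 hz) ht
    have h2 : W = fun s : ℝ => b s - Complex.I * κ / 2 / (-z * s) * a s := by
      funext s
      simp only [hW]
      rw [neg_mul, div_neg]
      ring
    rw [h2]
    exact h1
  -- The exponent has the derivative `|Im z| + 2κ(κ+1)/(|z| t²)`, whose second term has an integral of
  -- at most `2κ`, as `|z| y ≥ κ + 1`.
  have key := pairNorm_le_of_energy (a := V) (b := W)
    (A := fun t => |z.im| * t - 2 * κ * (κ + 1) / ‖z‖ * t⁻¹)
    (c := fun t => |z.im| * 1 - 2 * κ * (κ + 1) / ‖z‖ * (-(t ^ 2)⁻¹)) hyx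
    (fun t ht => h.hasDerivAt_gauge_left hz (hy.trans_le ht.1))
    (fun t ht => hWd t (hy.trans_le ht.1))
    (fun t ht => ((hasDerivAt_id t).const_mul _).sub
      ((hasDerivAt_inv (hy.trans_le ht.1).ne').const_mul _)) ?_
  · have g1 := (pairNorm_gauge hκ (hw y le_rfl) (a y) (b y)).1
    have g2 := (pairNorm_gauge hκ (hw x hyx) (a x) (b x)).2
    have hexp : Real.exp (|z.im| * x - 2 * κ * (κ + 1) / ‖z‖ * x⁻¹
        - (|z.im| * y - 2 * κ * (κ + 1) / ‖z‖ * y⁻¹))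
        ≤ Real.exp (2 * κ) * Real.exp (|z.im| * (x - y)) := by
      rw [← Real.exp_add]
      refine Real.exp_le_exp.2 ?_
      have h1 : 0 ≤ 2 * κ * (κ + 1) / ‖z‖ * x⁻¹ := by positivity
      have h2 : 2 * κ * (κ + 1) / ‖z‖ * y⁻¹ ≤ 2 * κ := by
        rw [← div_eq_mul_inv, div_div, div_le_iff₀ (by positivity)]
        nlinarith
      nlinarith
    calc pairNorm (a x) (b x) ≤ 2 * pairNorm (V x) (W x) := g2
      _ ≤ 2 * (pairNorm (V y) (W y) * (Real.exp (2 * κ) * Real.exp (|z.im| * (x - y)))) := by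
        have := pairNorm_nonneg (V y) (W y)
        gcongr
        exact key.trans (by gcongr)
      _ ≤ 2 * (3 / 2 * pairNorm (a y) (b y) * (Real.exp (2 * κ) * Real.exp (|z.im| * (x - y)))) := by
        gcongr
      _ = _ := by ring
  · intro t ht
    have ht0 : 0 < t := hy.trans_le ht.1
    have g := (pairNorm_gauge hκ (hw t ht.1) (a t) (b t)).2
    change pairNorm (a t) (b t) ≤ 2 * pairNorm (V t) (W t) at g
    set M := pairNorm (V t) (W t) with hM
    have hM0 : 0 ≤ M := pairNorm_nonneg _ _
    have hV1 : ‖V t‖ ≤ M := norm_le_pairNorm_left _ _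
    have hW1 : ‖W t‖ ≤ M := norm_le_pairNorm_right _ _
    have hr1 : ‖z * (Complex.I * κ / 2 / (z * t) ^ 2 * (κ * a t - b t))‖
        ≤ κ * (κ + 1) / ‖z‖ * (t ^ 2)⁻¹ * M := by
      rw [norm_mul]
      have := norm_gauge_remainder hκ (z * t) (a t) (b t)
      rw [norm_mul z, Complex.norm_real, Real.norm_of_nonneg ht0.le] at this
      calc _ ≤ ‖z‖ * (κ * (κ + 1) / 2 / (‖z‖ * t) ^ 2 * (2 * M)) := by
            gcongr
            exact this.trans (by gcongr)
        _ = _ := by field_simp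
    have hr2 : ‖z * (Complex.I * κ / 2 / (-z * t) ^ 2 * (κ * b t - a t))‖
        ≤ κ * (κ + 1) / ‖z‖ * (t ^ 2)⁻¹ * M := by
      rw [norm_mul]
      have := norm_gauge_remainder hκ (-z * t) (b t) (a t)
      rw [norm_mul (-z), norm_neg, Complex.norm_real, Real.norm_of_nonneg ht0.le, pairNorm_comm] at this
      calc _ ≤ ‖z‖ * (κ * (κ + 1) / 2 / (‖z‖ * t) ^ 2 * (2 * M)) := by
            gcongr
            exact this.trans (by gcongr)
        _ = _ := by field_simp
    have e1 : inner ℝ (V t) (z * (Complex.I * V t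
        - Complex.I * κ / 2 / (z * t) ^ 2 * (κ * a t - b t)))
        ≤ -z.im * ‖V t‖ ^ 2 + M * (κ * (κ + 1) / ‖z‖ * (t ^ 2)⁻¹ * M) := by
      rw [mul_sub, ← mul_assoc, mul_comm z Complex.I, inner_sub_right, inner_I_mul, sub_eq_add_neg]
      gcongr
      rw [← inner_neg_right]
      refine (real_inner_le_norm _ _).trans ?_
      rw [norm_neg]
      gcongr
    have e2 : inner ℝ (W t) (-z * (Complex.I * W t
        - Complex.I * κ / 2 / (-z * t) ^ 2 * (κ * b t - a t)))
        ≤ z.im * ‖W t‖ ^ 2 + M * (κ * (κ + 1) / ‖z‖ * (t ^ 2)⁻¹ * M) := by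
      rw [neg_mul, mul_sub, ← mul_assoc, mul_comm z Complex.I, inner_neg_right, inner_sub_right,
        inner_I_mul, neg_sub, sub_eq_add_neg, add_comm]
      gcongr ?_ + ?_
      · exact le_of_eq (by ring)
      · refine (real_inner_le_norm _ _).trans ?_
        gcongr
    have e3 := abs_im_energy_le z.im (‖V t‖ ^ 2) (‖W t‖ ^ 2) (by positivity) (by positivity)
    have e4 : M ^ 2 = ‖V t‖ ^ 2 + ‖W t‖ ^ 2 := pairNorm_sq _ _
    rw [← e4] at e3
    change inner ℝ (V t) (z * (Complex.I * V t
        - Complex.I * κ / 2 / (z * t) ^ 2 * (κ * a t - b t))) + _ ≤ _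
    have e5 : 2 * (M * (κ * (κ + 1) / ‖z‖ * (t ^ 2)⁻¹ * M))
      = 2 * κ * (κ + 1) / ‖z‖ * (t ^ 2)⁻¹ * M ^ 2 := by ring
    linarith

/-- The order of magnitude of the free regular solution: `x ^ κ` as long as `|z| x ≤ κ + 1` and
constant afterwards. -/
noncomputable def growth (κ : ℝ) (z : ℂ) (x : ℝ) : ℝ := (min x ((κ + 1) / ‖z‖)) ^ κ

theorem growth_pos {κ : ℝ} (hκ : 0 ≤ κ) {z : ℂ} (hz : z ≠ 0) {x : ℝ} (hx : 0 < x) :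
    0 < growth κ z x := by
  have := norm_pos_iff.2 hz
  exact Real.rpow_pos_of_pos (lt_min hx (by positivity)) κ

/-- Growth of the solutions of the free Dirac system. -/
theorem IsDiracSolution.pairNorm_le {κ : ℝ} (hκ : 0 ≤ κ) {z : ℂ} (hz : z ≠ 0) {a b : ℝ → ℂ}
    (h : IsDiracSolution κ z a b) {y x : ℝ} (hy : 0 < y) (hyx : y ≤ x) :
    pairNorm (a x) (b x) ≤ 3 * Real.exp (2 * κ) * (growth κ z x / growth κ z y)
      * Real.exp (|z.im| * (x - y)) * pairNorm (a y) (b y) := by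
  have hz' : 0 < ‖z‖ := norm_pos_iff.2 hz
  have hx : 0 < x := hy.trans_le hyx
  set T := (κ + 1) / ‖z‖ with hT
  have hT0 : 0 < T := by positivity
  have hTz : ‖z‖ * T = κ + 1 := by rw [hT]; field_simp
  have hn := pairNorm_nonneg (a y) (b y)
  have h3 : 1 ≤ 3 * Real.exp (2 * κ) := by
    have := Real.one_le_exp (show 0 ≤ 2 * κ by linarith)
    linarith
  rw [growth, growth, ← hT]
  rcases le_total x T with hxT | hxT
  · rw [min_eq_left hxT, min_eq_left (hyx.trans hxT), ← Real.div_rpow hx.le hy.le]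
    refine (h.pairNorm_le_near hκ hy hyx).trans ?_
    gcongr ?_ * _ * _
    exact le_mul_of_one_le_left (by positivity) h3
  · rw [min_eq_right hxT]
    rcases le_total T y with hyT | hyT
    · rw [min_eq_right hyT, div_self (Real.rpow_pos_of_pos hT0 κ).ne', mul_one]
      refine h.pairNorm_le_far hκ hy ?_ hyx
      rw [← hTz]; gcongr
    · rw [min_eq_left hyT, ← Real.div_rpow hT0.le hy.le]
      have h1 := h.pairNorm_le_far hκ hT0 hTz.ge hxT
      have h2 := h.pairNorm_le_near hκ hy hyT
      refine h1.trans ?_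
      calc _ ≤ 3 * Real.exp (2 * κ) * Real.exp (|z.im| * (x - T)) *
            ((T / y) ^ κ * Real.exp (|z.im| * (T - y)) * pairNorm (a y) (b y)) := by gcongr
        _ = 3 * Real.exp (2 * κ) * (T / y) ^ κ * (Real.exp (|z.im| * (x - T))
            * Real.exp (|z.im| * (T - y))) * pairNorm (a y) (b y) := by ring
        _ = _ := by
            rw [← Real.exp_add]
            congr 3
            ring

theorem norm_exp_I_mul (z : ℂ) (t : ℝ) : ‖Complex.exp (Complex.I * z * t)‖ = Real.exp (-z.im * t) := by
  rw [Complex.norm_exp]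
  simp

/-- Away from `0`, solutions of the free Dirac system evolve for large `|z|` as for `κ = 0`. -/
theorem IsDiracSolution.norm_sub_exp_le {κ : ℝ} (hκ : 0 ≤ κ) {z : ℂ} {a b : ℝ → ℂ}
    (h : IsDiracSolution κ z a b) {y x : ℝ} (hy : 0 < y) (hzy : κ + 1 ≤ ‖z‖ * y) (hyx : y ≤ x) :
    ‖a x - Complex.exp (Complex.I * z * (x - y : ℝ)) * a y‖
      ≤ 3 * Real.exp (2 * κ) * (κ + 1) ^ 2 * (x / y ^ 2) / ‖z‖ * Real.exp (|z.im| * (x - y))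
        * pairNorm (a y) (b y) := by
  have hz : z ≠ 0 := by rintro rfl; simp at hzy; linarith
  have hz' : 0 < ‖z‖ := norm_pos_iff.2 hz
  have hx : 0 < x := hy.trans_le hyx
  set K := 3 * Real.exp (2 * κ) with hK
  have hK1 : 1 ≤ K := by
    have := Real.one_le_exp (show 0 ≤ 2 * κ by linarith)
    rw [hK]; linarith
  set n := pairNorm (a y) (b y) with hn
  have hn0 : 0 ≤ n := pairNorm_nonneg _ _
  set V : ℝ → ℂ := fun s => a s - Complex.I * κ / 2 / (z * s) * b s with hV
  set ex : ℝ → ℂ := fun s => Complex.exp (-(Complex.I * z * s)) with hex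
  have hexd : ∀ t : ℝ, HasDerivAt ex (ex t * -(Complex.I * z)) t := by
    intro t
    have : HasDerivAt (fun s : ℝ => -(Complex.I * z * (s : ℂ))) (-(Complex.I * z)) t := by
      simpa using! ((hasDerivAt_id t).ofReal_comp.const_mul (Complex.I * z)).neg
    exact this.cexp
  have hexn : ∀ t : ℝ, ‖ex t‖ = Real.exp (z.im * t) := by
    intro t
    simp only [hex]
    rw [Complex.norm_exp]
    simp
  have hbound : ∀ t ∈ Set.Ico y x, ‖ex t * -(z * (Complex.I * κ / 2 / (z * t) ^ 2
      * (κ * a t - b t)))‖ ≤ Real.exp (z.im * x) * (κ * (κ + 1) / 2 / (‖z‖ * y ^ 2) *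
        (K * Real.exp (|z.im| * (x - y)) * n)) := by
    intro t ht
    have ht0 : 0 < t := hy.trans_le ht.1
    have h1 := h.pairNorm_le_far hκ hy hzy ht.1
    have h2 := norm_gauge_remainder hκ (z * t) (a t) (b t)
    rw [norm_mul z, Complex.norm_real, Real.norm_of_nonneg ht0.le] at h2
    rw [norm_mul, hexn, norm_neg, norm_mul]
    have h3 : Real.exp (z.im * t) * Real.exp (|z.im| * (t - y))
        ≤ Real.exp (z.im * x) * Real.exp (|z.im| * (x - y)) := by
      rw [← Real.exp_add, ← Real.exp_add]
      refine Real.exp_le_exp.2 ?_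
      nlinarith [neg_abs_le z.im, ht.2.le]
    calc _ ≤ Real.exp (z.im * t) * (‖z‖ * (κ * (κ + 1) / 2 / (‖z‖ * t) ^ 2 *
            (K * Real.exp (|z.im| * (t - y)) * n))) := by
          gcongr
          exact h2.trans (by gcongr)
      _ = (Real.exp (z.im * t) * Real.exp (|z.im| * (t - y))) *
          (κ * (κ + 1) / 2 / (‖z‖ * t ^ 2) * (K * n)) := by field_simp
      _ ≤ (Real.exp (z.im * x) * Real.exp (|z.im| * (x - y))) *
          (κ * (κ + 1) / 2 / (‖z‖ * y ^ 2) * (K * n)) := by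
          gcongr
          exact ht.1
      _ = _ := by ring
  have hmv := norm_image_sub_le_of_norm_deriv_le_segment' (f := fun t => ex t * V t)
    (f' := fun t => ex t * -(z * (Complex.I * κ / 2 / (z * t) ^ 2 * (κ * a t - b t))))
    (fun t ht => (((hexd t).mul (h.hasDerivAt_gauge_left hz (hy.trans_le ht.1))).congr_deriv
      (by ring)).hasDerivWithinAt) hbound x (Set.right_mem_Icc.2 hyx)
  have hεx : ‖Complex.I * κ / 2 / (z * x) * b x‖ ≤ κ / (2 * (‖z‖ * y)) *
      (K * Real.exp (|z.im| * (x - y)) * n) := by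
    rw [norm_mul, norm_gauge_coeff hκ, norm_mul, Complex.norm_real, Real.norm_of_nonneg hx.le]
    have := (norm_le_pairNorm_right (a x) (b x)).trans (h.pairNorm_le_far hκ hy hzy hyx)
    gcongr
  have hεy : ‖Complex.I * κ / 2 / (z * y) * b y‖ ≤ κ / (2 * (‖z‖ * y)) * n := by
    rw [norm_mul, norm_gauge_coeff hκ, norm_mul, Complex.norm_real, Real.norm_of_nonneg hy.le]
    have := norm_le_pairNorm_right (a y) (b y)
    gcongr
  have hexx : ‖Complex.exp (Complex.I * z * x)‖ * Real.exp (z.im * x) = 1 := by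
    rw [norm_exp_I_mul, ← Real.exp_add]; simp
  have hxy : ‖Complex.exp (Complex.I * z * (x - y : ℝ))‖ ≤ Real.exp (|z.im| * (x - y)) := by
    rw [norm_exp_I_mul]
    refine Real.exp_le_exp.2 ?_
    have := neg_le_abs z.im
    nlinarith
  have e1 : Complex.exp (Complex.I * z * x) * ex x = 1 := by
    simp only [hex]; rw [← Complex.exp_add]; simp
  have e2 : Complex.exp (Complex.I * z * x) * ex y
      = Complex.exp (Complex.I * z * (x - y : ℝ)) := by
    simp only [hex]; rw [← Complex.exp_add]; congr 1; push_cast; ring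
  have hid : a x - Complex.exp (Complex.I * z * (x - y : ℝ)) * a y
      = Complex.exp (Complex.I * z * x) * (ex x * V x - ex y * V y)
        + Complex.I * κ / 2 / (z * x) * b x
        - Complex.exp (Complex.I * z * (x - y : ℝ)) * (Complex.I * κ / 2 / (z * y) * b y) := by
    rw [← e2]
    have : Complex.exp (Complex.I * z * x) * (ex x * V x) = V x := by rw [← mul_assoc, e1, one_mul]
    rw [mul_sub, this]
    simp only [hV]
    ring
  rw [hid]
  refine (norm_sub_le _ _).trans ((add_le_add_left (norm_add_le _ _) _).trans ?_)
  rw [norm_mul, norm_mul (Complex.exp _)]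
  set Ex := Real.exp (|z.im| * (x - y)) with hEx
  have hEx0 : 0 < Ex := Real.exp_pos _
  have b1 : ‖Complex.exp (Complex.I * z * x)‖ * ‖ex x * V x - ex y * V y‖
      ≤ κ * (κ + 1) / 2 / (‖z‖ * y ^ 2) * (K * Ex * n) * (x - y) := by
    calc _ ≤ ‖Complex.exp (Complex.I * z * x)‖ * (Real.exp (z.im * x) *
          (κ * (κ + 1) / 2 / (‖z‖ * y ^ 2) * (K * Ex * n)) * (x - y)) := by gcongr
      _ = (‖Complex.exp (Complex.I * z * x)‖ * Real.exp (z.im * x)) *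
          (κ * (κ + 1) / 2 / (‖z‖ * y ^ 2) * (K * Ex * n) * (x - y)) := by ring
      _ = _ := by rw [hexx, one_mul]
  have b3 : ‖Complex.exp (Complex.I * z * (x - y : ℝ))‖ * ‖Complex.I * κ / 2 / (z * y) * b y‖
      ≤ Ex * (κ / (2 * (‖z‖ * y)) * n) := by gcongr
  have b3' : Ex * (κ / (2 * (‖z‖ * y)) * n) ≤ κ / (2 * (‖z‖ * y)) * (K * Ex * n) := by
    have : 0 ≤ κ / (2 * (‖z‖ * y)) * (Ex * n) := by positivity
    nlinarith
  refine (add_le_add (add_le_add b1 hεx) (b3.trans b3')).trans ?_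
  have : κ * (κ + 1) / 2 / (‖z‖ * y ^ 2) * (K * Ex * n) * (x - y)
      + κ / (2 * (‖z‖ * y)) * (K * Ex * n) + κ / (2 * (‖z‖ * y)) * (K * Ex * n)
      = (κ * (κ + 1) / 2 * (x - y) + κ * y) * (K * Ex * n / (‖z‖ * y ^ 2)) := by
    field_simp
    ring
  rw [this]
  have h4 : κ * (κ + 1) / 2 * (x - y) + κ * y ≤ (κ + 1) ^ 2 * x := by
    nlinarith [mul_nonneg hκ hx.le, mul_nonneg hκ hy.le, mul_nonneg hκ (mul_nonneg hκ hx.le),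
      mul_nonneg hκ (mul_nonneg hκ hy.le), mul_nonneg hκ (sub_nonneg.2 hyx)]
  calc _ ≤ (κ + 1) ^ 2 * x * (K * Ex * n / (‖z‖ * y ^ 2)) := by gcongr
    _ = _ := by field_simp

/-! ### Poisson's integral and its growth -/

theorem continuous_poisson_weight {κ : ℝ} (hκ : 0 ≤ κ) : Continuous fun t : ℝ => (1 - t ^ 2) ^ κ :=
  (continuous_const.sub (continuous_pow 2)).rpow_const fun _ => Or.inr hκ

theorem integral_poisson_weight {κ : ℝ} (hκ : 0 ≤ κ) :
    ∫ t in (-1 : ℝ)..1, (1 - t ^ 2) ^ κ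
      = √Real.pi * Real.Gamma (κ + 1) / Real.Gamma (κ + 3 / 2) := by
  have hbeta : (∫ x in (0 : ℝ)..1, x ^ κ * (1 - x) ^ κ)
      = Real.Gamma (κ + 1) * Real.Gamma (κ + 1) / Real.Gamma (2 * κ + 2) := by
    have hre : 0 < ((κ + 1 : ℝ) : ℂ).re := by rw [Complex.ofReal_re]; linarith
    have h := Complex.Gamma_mul_Gamma_eq_betaIntegral hre hre
    rw [Complex.betaIntegral] at h
    have hi : (∫ x in (0 : ℝ)..1, (x : ℂ) ^ (((κ + 1 : ℝ) : ℂ) - 1)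
        * (1 - (x : ℂ)) ^ (((κ + 1 : ℝ) : ℂ) - 1))
        = ((∫ x in (0 : ℝ)..1, x ^ κ * (1 - x) ^ κ : ℝ) : ℂ) := by
      rw [← intervalIntegral.integral_ofReal]
      refine intervalIntegral.integral_congr fun x hx => ?_
      rw [Set.uIcc_of_le zero_le_one] at hx
      rw [Complex.ofReal_mul, Complex.ofReal_cpow hx.1, Complex.ofReal_cpow (by linarith [hx.2])]
      push_cast
      simp
    rw [hi, ← Complex.ofReal_add, Complex.Gamma_ofReal, Complex.Gamma_ofReal] at h
    have h' : Real.Gamma (κ + 1) * Real.Gamma (κ + 1) = Real.Gamma (κ + 1 + (κ + 1))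
        * ∫ x in (0 : ℝ)..1, x ^ κ * (1 - x) ^ κ := by exact_mod_cast h
    rw [h', show κ + 1 + (κ + 1) = 2 * κ + 2 by ring,
      mul_div_cancel_left₀ _ (Real.Gamma_pos_of_pos (by linarith)).ne']
  have hsub := intervalIntegral.integral_comp_mul_sub (a := 0) (b := 1)
    (fun t : ℝ => (1 - t ^ 2) ^ κ) (c := 2) (by norm_num) 1
  have hpt : (∫ x in (0 : ℝ)..1, (1 - (2 * x - 1) ^ 2) ^ κ)
      = 4 ^ κ * ∫ x in (0 : ℝ)..1, x ^ κ * (1 - x) ^ κ := by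
    rw [← intervalIntegral.integral_const_mul]
    refine intervalIntegral.integral_congr fun x hx => ?_
    rw [Set.uIcc_of_le zero_le_one] at hx
    rw [← Real.mul_rpow hx.1 (by linarith [hx.2]), ← Real.mul_rpow (by norm_num)
      (mul_nonneg hx.1 (by linarith [hx.2]))]
    congr 1
    ring
  norm_num at hsub
  rw [hpt, hbeta] at hsub
  have hdup := Real.Gamma_mul_Gamma_add_half (κ + 1)
  rw [show κ + 1 + 1 / 2 = κ + 3 / 2 by ring, show 2 * (κ + 1) = 2 * κ + 2 by ring] at hdup
  have g1 : Real.Gamma (κ + 3 / 2) ≠ 0 := (Real.Gamma_pos_of_pos (by linarith)).ne'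
  have g2 : Real.Gamma (2 * κ + 2) ≠ 0 := (Real.Gamma_pos_of_pos (by linarith)).ne'
  have h4 : (4 : ℝ) ^ κ * 2 * (2 : ℝ) ^ (1 - (2 * κ + 2)) = 1 := by
    rw [show (4 : ℝ) = 2 ^ (2 : ℝ) by norm_num, ← Real.rpow_mul (by norm_num),
      ← Real.rpow_add_one (by norm_num), ← Real.rpow_add (by norm_num)]
    rw [show 2 * κ + 1 + (1 - (2 * κ + 2)) = 0 by ring, Real.rpow_zero]
  have hI : (∫ t in (-1 : ℝ)..1, (1 - t ^ 2) ^ κ)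
      = 2 * (4 ^ κ * (Real.Gamma (κ + 1) * Real.Gamma (κ + 1) / Real.Gamma (2 * κ + 2))) := by
    rw [hsub]; ring
  rw [hI, eq_div_iff g1]
  generalize Real.Gamma (κ + 3 / 2) = G at *
  generalize Real.Gamma (2 * κ + 2) = H at *
  generalize Real.Gamma (κ + 1) = F at *
  field_simp
  linear_combination (2 * 4 ^ κ * F) * hdup + F * H * √Real.pi * h4

/-- The even moments of the weight `(1 - t²) ^ κ`. -/
theorem integral_pow_mul_poisson_weight {κ : ℝ} (hκ : 0 ≤ κ) (k : ℕ) :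
    ∫ t in (-1 : ℝ)..1, t ^ (2 * k) * (1 - t ^ 2) ^ κ
      = ((2 * k).factorial : ℝ) / (4 ^ k * k.factorial) *
        (√Real.pi * Real.Gamma (κ + 1) / Real.Gamma (κ + 3 / 2 + k)) := by
  have hc := continuous_poisson_weight hκ
  induction k with
  | zero => simpa using integral_poisson_weight hκ
  | succ k ih =>
    have hder : ∀ t : ℝ, HasDerivAt (fun s : ℝ => s ^ (2 * k + 1) * (1 - s ^ 2) ^ (κ + 1))
        ((2 * k + 1) * t ^ (2 * k) * (1 - t ^ 2) ^ (κ + 1)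
          - 2 * (κ + 1) * (t ^ (2 * k + 2) * (1 - t ^ 2) ^ κ)) t := by
      intro t
      have h1 : HasDerivAt (fun s : ℝ => 1 - s ^ 2) (-(2 * t)) t := by
        simpa using (hasDerivAt_pow 2 t).const_sub 1
      have h2 := (hasDerivAt_pow (2 * k + 1) t).mul
        (h1.rpow_const (p := κ + 1) (Or.inr (by linarith)))
      refine h2.congr_deriv ?_
      rw [add_sub_cancel_right]
      push_cast
      ring
    have hcont1 : Continuous fun t : ℝ => t ^ (2 * k) * (1 - t ^ 2) ^ κ := by fun_prop
    have hcont2 : Continuous fun t : ℝ => t ^ (2 * k + 2) * (1 - t ^ 2) ^ κ := by fun_prop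
    have hcont3 : Continuous fun t : ℝ => (1 - t ^ 2) ^ (κ + 1) :=
      continuous_poisson_weight (by linarith)
    have hint := intervalIntegral.integral_eq_sub_of_hasDerivAt (a := -1) (b := 1)
      (fun t _ => hder t) (Continuous.intervalIntegrable (by fun_prop) _ _)
    have hcongr : (∫ t in (-1 : ℝ)..1, ((2 * k + 1) * t ^ (2 * k) * (1 - t ^ 2) ^ (κ + 1)
          - 2 * (κ + 1) * (t ^ (2 * k + 2) * (1 - t ^ 2) ^ κ)))
        = ∫ t in (-1 : ℝ)..1, ((2 * k + 1) * (t ^ (2 * k) * (1 - t ^ 2) ^ κ)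
          - (2 * k + 2 * κ + 3) * (t ^ (2 * k + 2) * (1 - t ^ 2) ^ κ)) := by
      refine intervalIntegral.integral_congr fun t ht => ?_
      rw [Set.uIcc_of_le (by norm_num)] at ht
      have h0 : 0 ≤ 1 - t ^ 2 := by nlinarith [ht.1, ht.2]
      rw [Real.rpow_add_one' h0 (by linarith)]
      ring
    rw [hcongr, intervalIntegral.integral_sub ((hcont1.const_mul _).intervalIntegrable _ _)
      ((hcont2.const_mul _).intervalIntegrable _ _), intervalIntegral.integral_const_mul,
      intervalIntegral.integral_const_mul, ih] at hint
    have hz : (0 : ℝ) ^ (κ + 1) = 0 := Real.zero_rpow (by linarith)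
    norm_num [hz] at hint
    have hG : Real.Gamma (κ + 3 / 2 + (k + 1)) = (κ + 3 / 2 + k) * Real.Gamma (κ + 3 / 2 + k) := by
      rw [← add_assoc, Real.Gamma_add_one (by positivity)]
    have hG0 : Real.Gamma (κ + 3 / 2 + k) ≠ 0 := (Real.Gamma_pos_of_pos (by positivity)).ne'
    have hk0 : (κ + 3 / 2 + k) ≠ 0 := by positivity
    have hk1 : (2 * k + 2 * κ + 3 : ℝ) ≠ 0 := by positivity
    have hf0 : (k.factorial : ℝ) ≠ 0 := by positivity
    rw [show 2 * (k + 1) = 2 * k + 2 by ring]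
    have hsolve : (∫ t in (-1 : ℝ)..1, t ^ (2 * k + 2) * (1 - t ^ 2) ^ κ)
        = (2 * k + 1) * (((2 * k).factorial : ℝ) / (4 ^ k * k.factorial) *
        (√Real.pi * Real.Gamma (κ + 1) / Real.Gamma (κ + 3 / 2 + k))) / (2 * k + 2 * κ + 3) := by
      rw [eq_div_iff hk1]; linarith
    rw [hsolve, Nat.factorial_succ, Nat.factorial_succ, Nat.factorial_succ]
    push_cast
    rw [hG]
    field_simp
    ring

/-- Poisson's integral for the modified Bessel function of order `κ + 1/2`. -/
theorem integral_exp_mul_poisson_weight {κ : ℝ} (hκ : 0 ≤ κ) (R : ℝ) :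
    HasSum (fun k : ℕ => (R ^ 2 / 4) ^ k / (k.factorial * Real.Gamma (κ + 3 / 2 + k)))
      ((√Real.pi * Real.Gamma (κ + 1))⁻¹ *
        ∫ t in (-1 : ℝ)..1, Real.exp (R * t) * (1 - t ^ 2) ^ κ) := by
  have hc := continuous_poisson_weight hκ
  have hcosh : (∫ t in (-1 : ℝ)..1, Real.exp (R * t) * (1 - t ^ 2) ^ κ)
      = ∫ t in (-1 : ℝ)..1, Real.cosh (R * t) * (1 - t ^ 2) ^ κ := by
    have h1 := intervalIntegral.integral_comp_neg (a := -1) (b := 1)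
      (fun t : ℝ => Real.exp (R * t) * (1 - t ^ 2) ^ κ)
    rw [neg_neg] at h1
    have h2 : (∫ t in (-1 : ℝ)..1, Real.cosh (R * t) * (1 - t ^ 2) ^ κ)
        = (1 / 2) * ((∫ t in (-1 : ℝ)..1, Real.exp (R * t) * (1 - t ^ 2) ^ κ)
        + ∫ t in (-1 : ℝ)..1, Real.exp (R * -t) * (1 - (-t) ^ 2) ^ κ) := by
      rw [← intervalIntegral.integral_add (Continuous.intervalIntegrable (by fun_prop) _ _)
        (Continuous.intervalIntegrable (by simp only [neg_sq]; fun_prop) _ _),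
        ← intervalIntegral.integral_const_mul]
      refine intervalIntegral.integral_congr fun t _ => ?_
      rw [Real.cosh_eq, neg_sq, mul_neg]
      ring
    rw [h2, h1]
    ring
  rw [hcosh]
  have hsum : HasSum (fun k : ℕ => ∫ t in (-1 : ℝ)..1,
      (R * t) ^ (2 * k) / (2 * k).factorial * (1 - t ^ 2) ^ κ)
      (∫ t in (-1 : ℝ)..1, Real.cosh (R * t) * (1 - t ^ 2) ^ κ) := by
    refine intervalIntegral.hasSum_integral_of_dominated_convergence
      (fun (k : ℕ) _ => |R| ^ (2 * k) / (2 * k).factorial) (fun k => ?_) (fun k => ?_) ?_ ?_ ?_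
    · exact Continuous.aestronglyMeasurable (by fun_prop)
    · refine Filter.Eventually.of_forall fun t ht => ?_
      rw [Set.uIoc_of_le (by norm_num)] at ht
      have h0 : 0 ≤ 1 - t ^ 2 := by nlinarith [ht.1, ht.2]
      have h1 : (1 - t ^ 2) ^ κ ≤ 1 := Real.rpow_le_one h0 (by nlinarith) hκ
      have h2 : |t| ≤ 1 := abs_le.2 ⟨ht.1.le, ht.2⟩
      rw [norm_mul, Real.norm_of_nonneg (Real.rpow_nonneg h0 κ), norm_div, norm_pow, norm_mul,
        Real.norm_eq_abs, Real.norm_eq_abs, Real.norm_natCast]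
      calc _ ≤ (|R| * 1) ^ (2 * k) / ((2 * k).factorial : ℝ) * 1 := by gcongr
        _ = _ := by simp
    · exact Filter.Eventually.of_forall fun t _ => (Real.hasSum_cosh |R|).summable
    · exact intervalIntegrable_const
    · exact Filter.Eventually.of_forall fun t _ => (Real.hasSum_cosh (R * t)).mul_right _
  refine (hsum.mul_left (√Real.pi * Real.Gamma (κ + 1))⁻¹).congr_fun ?_
  intro k
  have h1 : (∫ t in (-1 : ℝ)..1, (R * t) ^ (2 * k) / (2 * k).factorial * (1 - t ^ 2) ^ κ)
      = R ^ (2 * k) / (2 * k).factorial * ∫ t in (-1 : ℝ)..1, t ^ (2 * k) * (1 - t ^ 2) ^ κ := by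
    rw [← intervalIntegral.integral_const_mul]
    refine intervalIntegral.integral_congr fun t _ => ?_
    rw [mul_pow]
    ring
  rw [h1, integral_pow_mul_poisson_weight hκ, div_pow, ← pow_mul]
  have hG0 : Real.Gamma (κ + 3 / 2 + k) ≠ 0 := (Real.Gamma_pos_of_pos (by positivity)).ne'
  have hG1 : Real.Gamma (κ + 1) ≠ 0 := (Real.Gamma_pos_of_pos (by positivity)).ne'
  have hf0 : (k.factorial : ℝ) ≠ 0 := by positivity
  have hf1 : ((2 * k).factorial : ℝ) ≠ 0 := by positivity
  have hpi : √Real.pi ≠ 0 := by positivity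
  field_simp

/-- Laplace's method for Poisson's integral. -/
theorem tendsto_poisson_integral {κ : ℝ} (hκ : 0 ≤ κ) :
    Filter.Tendsto (fun R : ℝ => R ^ (κ + 1) * Real.exp (-R) *
      ∫ t in (-1 : ℝ)..1, Real.exp (R * t) * (1 - t ^ 2) ^ κ) Filter.atTop
      (nhds (2 ^ κ * Real.Gamma (κ + 1))) := by
  have hlim : (∫ s in Set.Ioi (0 : ℝ), Real.exp (-s) * (s * 2) ^ κ)
      = 2 ^ κ * Real.Gamma (κ + 1) := by
    rw [Real.Gamma_eq_integral (by linarith), ← MeasureTheory.integral_const_mul]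
    refine MeasureTheory.setIntegral_congr_fun measurableSet_Ioi fun s hs => ?_
    rw [Real.mul_rpow (le_of_lt hs) (by norm_num), add_sub_cancel_right]
    ring
  have hint : MeasureTheory.IntegrableOn (fun s : ℝ => Real.exp (-s) * (s * 2) ^ κ)
      (Set.Ioi 0) := by
    have := (Real.GammaIntegral_convergent (s := κ + 1) (by linarith)).mul_const (2 ^ κ)
    refine MeasureTheory.IntegrableOn.congr_fun this (fun s hs => ?_) measurableSet_Ioi
    rw [Real.mul_rpow (le_of_lt hs) (by norm_num), add_sub_cancel_right]
    ring
  rw [← hlim]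
  have key : Filter.Tendsto (fun R : ℝ => ∫ s in Set.Ioi (0 : ℝ),
      (Set.Ioc 0 (2 * R)).indicator (fun s => Real.exp (-s) * (s * (2 - s / R)) ^ κ) s)
      Filter.atTop (nhds (∫ s in Set.Ioi (0 : ℝ), Real.exp (-s) * (s * 2) ^ κ)) := by
    refine MeasureTheory.tendsto_integral_filter_of_dominated_convergence
      (fun s => Real.exp (-s) * (s * 2) ^ κ) ?_ ?_ hint ?_
    · refine Filter.Eventually.of_forall fun R => ?_
      refine (Continuous.aestronglyMeasurable ?_).indicator measurableSet_Ioc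
      exact (Real.continuous_exp.comp continuous_neg).mul
        (Continuous.rpow_const (by fun_prop) fun _ => Or.inr hκ)
    · filter_upwards [Filter.eventually_gt_atTop 0] with R hR
      filter_upwards [MeasureTheory.ae_restrict_mem measurableSet_Ioi] with s hs
      have hs0 : (0 : ℝ) < s := hs
      by_cases hsR : s ∈ Set.Ioc 0 (2 * R)
      · rw [Set.indicator_of_mem hsR]
        have h2 : 0 ≤ 2 - s / R := by
          rw [sub_nonneg, div_le_iff₀ hR]; exact hsR.2
        have h3 : 0 ≤ s / R := by positivity
        rw [norm_mul, Real.norm_of_nonneg (Real.exp_pos _).le,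
          Real.norm_of_nonneg (Real.rpow_nonneg (by positivity) _)]
        gcongr
        linarith
      · rw [Set.indicator_of_notMem hsR, norm_zero]
        positivity
    · filter_upwards [MeasureTheory.ae_restrict_mem measurableSet_Ioi] with s hs
      have hs0 : (0 : ℝ) < s := hs
      have h1 : Filter.Tendsto (fun R : ℝ => Real.exp (-s) * (s * (2 - s / R)) ^ κ) Filter.atTop
          (nhds (Real.exp (-s) * (s * (2 - 0)) ^ κ)) := by
        refine Filter.Tendsto.const_mul _ (Filter.Tendsto.rpow_const ?_ (Or.inr hκ))
        exact ((tendsto_const_nhds (x := s)).div_atTop Filter.tendsto_id).const_sub 2 |>.const_mul s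
      rw [sub_zero] at h1
      refine h1.congr' ?_
      filter_upwards [Filter.eventually_ge_atTop s] with R hR
      rw [Set.indicator_of_mem]
      exact ⟨hs0, by linarith⟩
  refine key.congr' ?_
  filter_upwards [Filter.eventually_gt_atTop 0] with R hR
  rw [MeasureTheory.setIntegral_indicator measurableSet_Ioc, Set.inter_eq_right.2
    (fun s hs => hs.1), ← intervalIntegral.integral_of_le (by linarith)]
  have hsub := intervalIntegral.integral_comp_sub_div (a := 0) (b := 2 * R)
    (fun t : ℝ => Real.exp (R * t) * (1 - t ^ 2) ^ κ) hR.ne' 1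
  rw [mul_div_cancel_right₀ _ hR.ne', zero_div, sub_zero, show (1 : ℝ) - 2 = -1 by norm_num,
    smul_eq_mul] at hsub
  rw [Real.rpow_add_one hR.ne']
  have : R ^ κ * R * Real.exp (-R) * ∫ t in (-1 : ℝ)..1, Real.exp (R * t) * (1 - t ^ 2) ^ κ
    = R ^ κ * Real.exp (-R) * (R * ∫ t in (-1 : ℝ)..1, Real.exp (R * t) * (1 - t ^ 2) ^ κ) := by
    ring
  rw [this, ← hsub, ← intervalIntegral.integral_const_mul]
  refine intervalIntegral.integral_congr fun s hs => ?_
  rw [Set.uIcc_of_le (by linarith)] at hs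
  have h2 : 0 ≤ 2 - s / R := by
    rw [sub_nonneg, div_le_iff₀ hR]; exact hs.2
  have h3 : 0 ≤ s / R := div_nonneg hs.1 hR.le
  have e1 : (1 - (1 - s / R) ^ 2) = s / R * (2 - s / R) := by ring
  have e2 : s * (2 - s / R) = R * (s / R * (2 - s / R)) := by field_simp
  have e3 : Real.exp (-s) = Real.exp (-R) * Real.exp (R * (1 - s / R)) := by
    rw [← Real.exp_add]; congr 1; field_simp; ring
  rw [e1, e2, e3, Real.mul_rpow hR.le (mul_nonneg h3 h2)]
  ring

theorem tendsto_freeFst_neg_I {κ : ℝ} (hκ : 0 ≤ κ) :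
    Filter.Tendsto (fun R : ℝ => ((R ^ κ * Real.exp (-R) : ℝ) : ℂ) *
      (2 * Complex.I * freeFst κ (-Complex.I * R))) Filter.atTop (nhds 1) := by
  have h := (tendsto_poisson_integral hκ).const_mul
    (2 * (√Real.pi * 2 ^ (-κ - 1)) * (√Real.pi * Real.Gamma (κ + 1))⁻¹)
  have hG1 : Real.Gamma (κ + 1) ≠ 0 := (Real.Gamma_pos_of_pos (by positivity)).ne'
  have hone : 2 * (√Real.pi * 2 ^ (-κ - 1)) * (√Real.pi * Real.Gamma (κ + 1))⁻¹
      * (2 ^ κ * Real.Gamma (κ + 1)) = 1 := by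
    have h2 : (2 : ℝ) ^ (-κ - 1) * 2 ^ κ = 1 / 2 := by
      rw [← Real.rpow_add (by norm_num), show -κ - 1 + κ = -1 by ring, Real.rpow_neg_one]; norm_num
    have hpi : √Real.pi ≠ 0 := by positivity
    field_simp
    linarith
  rw [hone] at h
  have h' := (Complex.continuous_ofReal.tendsto _).comp h
  rw [Complex.ofReal_one] at h'
  refine h'.congr' ?_
  filter_upwards [Filter.eventually_gt_atTop 0] with R hR
  have hs := (integral_exp_mul_poisson_weight hκ R).tsum_eq
  have hu : -((-Complex.I * (R : ℂ)) ^ 2 / 4) = ((R ^ 2 / 4 : ℝ) : ℂ) := by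
    push_cast
    rw [mul_pow, neg_sq, Complex.I_sq]
    ring
  have hp : powerSum (cliffordSeq (κ + 1 / 2)) (-((-Complex.I * (R : ℂ)) ^ 2 / 4))
      = (((√Real.pi * Real.Gamma (κ + 1))⁻¹ *
        ∫ t in (-1 : ℝ)..1, Real.exp (R * t) * (1 - t ^ 2) ^ κ : ℝ) : ℂ) := by
    rw [← hs, hu, powerSum, Complex.ofReal_tsum]
    refine tsum_congr fun k => ?_
    rw [cliffordSeq, show κ + 1 / 2 + k + 1 = κ + 3 / 2 + k by ring]
    push_cast
    ring
  rw [freeFst, hp, Function.comp_apply, Real.rpow_add_one hR.ne']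
  push_cast
  linear_combination (2 * (R : ℂ) ^ (1 : ℕ) * ((R ^ κ : ℝ) : ℂ) * Complex.exp (-R) * ((√Real.pi : ℝ) : ℂ)
    * (((2 : ℝ) ^ (-κ - 1) : ℝ) : ℂ) * (((√Real.pi : ℝ) : ℂ) * ((Real.Gamma (κ + 1) : ℝ) : ℂ))⁻¹ *
    ((∫ t in (-1 : ℝ)..1, Real.exp (R * t) * (1 - t ^ 2) ^ κ : ℝ) : ℂ)) * Complex.I_sq

/-! ### Asymptotics of the free regular solution -/

/-- `u₂ + i u₁` for the free regular solution, up to the factor `x ^ κ`. -/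
noncomputable def freePlus (κ : ℝ) (w : ℂ) : ℂ := freeSnd κ w + Complex.I * freeFst κ w

/-- `u₂ - i u₁` for the free regular solution, up to the factor `x ^ κ`. -/
noncomputable def freeMinus (κ : ℝ) (w : ℂ) : ℂ := freeSnd κ w - Complex.I * freeFst κ w

theorem coordPlus_freeSolution {κ : ℝ} {z : ℂ} (hz : z ≠ 0) {x : ℝ} (hx : 0 < x) :
    coordPlus (freeSolution κ z x) = ((x ^ κ : ℝ) : ℂ) * freePlus κ (z * x) := by
  rw [coordPlus, (freeSolution_eq hz hx).1, (freeSolution_eq hz hx).2, freePlus]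
  ring

theorem coordMinus_freeSolution {κ : ℝ} {z : ℂ} (hz : z ≠ 0) {x : ℝ} (hx : 0 < x) :
    coordMinus (freeSolution κ z x) = ((x ^ κ : ℝ) : ℂ) * freeMinus κ (z * x) := by
  rw [coordMinus, (freeSolution_eq hz hx).1, (freeSolution_eq hz hx).2, freeMinus]
  ring

theorem conj_powerSum_clifford (ν : ℝ) (u : ℂ) :
    (starRingEnd ℂ) (powerSum (cliffordSeq ν) u)
      = powerSum (cliffordSeq ν) ((starRingEnd ℂ) u) := by
  rw [powerSum, powerSum, Complex.conj_tsum]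
  refine tsum_congr fun k => ?_
  simp [cliffordSeq]

theorem conj_freePlus (κ : ℝ) (w : ℂ) :
    (starRingEnd ℂ) (freePlus κ w) = freeMinus κ ((starRingEnd ℂ) w) := by
  simp only [freePlus, freeMinus, freeFst, freeSnd, map_add, map_mul, conj_powerSum_clifford,
    Complex.conj_I, Complex.conj_ofReal, map_neg, map_div₀, map_pow,
    map_ofNat]
  ring

theorem freeFst_neg (κ : ℝ) (w : ℂ) : freeFst κ (-w) = -freeFst κ w := by
  rw [freeFst, freeFst, neg_sq]; ring

theorem freeSnd_neg (κ : ℝ) (w : ℂ) : freeSnd κ (-w) = freeSnd κ w := by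
  rw [freeSnd, freeSnd, neg_sq]

theorem continuous_freeFst (κ : ℝ) : Continuous (freeFst κ) := by
  have := continuous_powerSum (isEntireSeq_clifford (κ + 1 / 2))
  unfold freeFst
  fun_prop

theorem continuous_freeSnd (κ : ℝ) : Continuous (freeSnd κ) := by
  have := continuous_powerSum (isEntireSeq_clifford (κ - 1 / 2))
  unfold freeSnd
  fun_prop

/-- The Dirac system for the components of the free regular solution, along any path. -/
theorem hasDerivAt_free {κ : ℝ} {w : ℝ → ℂ} {w' : ℂ} {t : ℝ} (hw : HasDerivAt w w' t)
    (h0 : w t ≠ 0) :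
    HasDerivAt (fun s => freeFst κ (w s))
      (w' * (freeSnd κ (w t) - 2 * κ / w t * freeFst κ (w t))) t ∧
    HasDerivAt (fun s => freeSnd κ (w s)) (-(w' * freeFst κ (w t))) t := by
  have h1 := hasDerivAt_powerSum_path (isEntireSeq_clifford (κ + 1 / 2)) hw h0
  have h2 := hasDerivAt_powerSum_path (isEntireSeq_clifford (κ - 1 / 2)) hw h0
  have e1 := powerSum_clifford_pred (κ + 1 / 2) (-(w t ^ 2 / 4))
  have e2 := powerSum_euler_clifford (κ - 1 / 2) (-(w t ^ 2 / 4))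
  rw [show κ + 1 / 2 - 1 = κ - 1 / 2 by ring] at e1
  rw [show κ - 1 / 2 + 1 = κ + 1 / 2 by ring] at e2
  have h3 : ((√Real.pi * 2 ^ (-κ) : ℝ) : ℂ) = 2 * ((√Real.pi * 2 ^ (-κ - 1) : ℝ) : ℂ) := by
    rw [Real.rpow_sub_one (by norm_num)]; push_cast; ring
  constructor
  · refine ((hw.const_mul _).mul h1).congr_deriv ?_
    rw [freeFst, freeSnd, h3, ← e1]
    push_cast
    field_simp
    ring
  · refine (h2.const_mul _).congr_deriv ?_
    rw [freeFst, h3, e2]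
    field_simp
    ring

theorem freeSolution_isDiracSolution {κ : ℝ} (hκ : 0 ≤ κ) {z : ℂ} (hz : z ≠ 0) :
    IsDiracSolution κ z (fun x => coordPlus (freeSolution κ z x))
      (fun x => coordMinus (freeSolution κ z x)) := by
  obtain ⟨φ', -, h, -⟩ := exists_isBesselSolution_phi_theta (l := κ) (by linarith)
    (pow_ne_zero 2 hz)
  refine h.components_up.congr (fun x hx => ?_) (fun x hx => ?_)
  · rw [coordPlus, freeSolution, show (fun t : ℝ => phi κ (z ^ 2) t) = phi κ (z ^ 2) from rfl,
      (h.deriv_left x hx).deriv]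
    simp
  · rw [coordMinus, freeSolution, show (fun t : ℝ => phi κ (z ^ 2) t) = phi κ (z ^ 2) from rfl,
      (h.deriv_left x hx).deriv]
    simp

/-- The constant in the bound for the free regular solution. -/
noncomputable def freeConst (κ : ℝ) : ℝ :=
  3 * Real.exp (2 * κ) * pairNorm (freePlus κ 0) (freeMinus κ 0)

theorem freeConst_nonneg (κ : ℝ) : 0 ≤ freeConst κ :=
  mul_nonneg (by positivity) (pairNorm_nonneg _ _)

theorem continuous_pairNorm_free (κ : ℝ) :
    Continuous fun w => pairNorm (freePlus κ w) (freeMinus κ w) := by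
  have h1 := continuous_freeFst κ
  have h2 := continuous_freeSnd κ
  have : (fun w => pairNorm (freePlus κ w) (freeMinus κ w))
      = fun w => √(‖freePlus κ w‖ ^ 2 + ‖freeMinus κ w‖ ^ 2) := by
    funext w
    rw [← pairNorm_sq, Real.sqrt_sq (pairNorm_nonneg _ _)]
  rw [this]
  unfold freePlus freeMinus
  fun_prop

theorem pairNorm_freeSolution_le {κ : ℝ} (hκ : 0 ≤ κ) {z : ℂ} (hz : z ≠ 0) {x : ℝ} (hx : 0 < x) :
    pairNorm (coordPlus (freeSolution κ z x)) (coordMinus (freeSolution κ z x))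
      ≤ freeConst κ * growth κ z x * Real.exp (|z.im| * x) := by
  have hz' : 0 < ‖z‖ := norm_pos_iff.2 hz
  have hsol := freeSolution_isDiracSolution hκ hz
  have hcont : Continuous fun y : ℝ => 3 * Real.exp (2 * κ) * growth κ z x
      * Real.exp (|z.im| * (x - y)) * pairNorm (freePlus κ (z * y)) (freeMinus κ (z * y)) := by
    have := (continuous_pairNorm_free κ).comp
      (show Continuous fun y : ℝ => z * (y : ℂ) by fun_prop)
    simp only [Function.comp_def] at this
    fun_prop
  have ht := (hcont.tendsto 0).mono_left (nhdsWithin_le_nhds (s := Set.Ioi (0 : ℝ)))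
  simp only [Complex.ofReal_zero, mul_zero, sub_zero] at ht
  have hle := ge_of_tendsto (b := pairNorm (coordPlus (freeSolution κ z x))
    (coordMinus (freeSolution κ z x))) ht ?_
  · refine hle.trans_eq ?_
    rw [freeConst]; ring
  · have hT : 0 < min x ((κ + 1) / ‖z‖) := lt_min hx (by positivity)
    filter_upwards [Ioo_mem_nhdsGT hT] with y hy
    have hyx : y ≤ x := hy.2.le.trans (min_le_left _ _)
    have h1 := hsol.pairNorm_le hκ hz hy.1 hyx
    rw [coordPlus_freeSolution hz hy.1, coordMinus_freeSolution hz hy.1, pairNorm_mul,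
      Complex.norm_real, Real.norm_of_nonneg (Real.rpow_nonneg hy.1.le κ)] at h1
    refine h1.trans_eq ?_
    have hg : growth κ z y = y ^ κ := by
      rw [growth, min_eq_left (hy.2.le.trans (min_le_right _ _))]
    have : 0 < y ^ κ := Real.rpow_pos_of_pos hy.1 κ
    rw [hg]
    field_simp

theorem rpow_mul_pairNorm_free_le {κ : ℝ} (hκ : 0 ≤ κ) {R : ℝ} (hR : 0 < R) (θ : ℝ) :
    R ^ κ * pairNorm (freePlus κ (R * Complex.exp (Complex.I * θ)))
      (freeMinus κ (R * Complex.exp (Complex.I * θ)))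
      ≤ freeConst κ * (κ + 1) ^ κ * Real.exp (R * |Real.sin θ|) := by
  set z := Complex.exp (Complex.I * θ) with hz
  have hz0 : z ≠ 0 := Complex.exp_ne_zero _
  have hzn : ‖z‖ = 1 := by rw [hz, mul_comm, Complex.norm_exp_ofReal_mul_I]
  have him : z.im = Real.sin θ := by rw [hz, mul_comm, Complex.exp_ofReal_mul_I_im]
  have h := pairNorm_freeSolution_le hκ hz0 hR
  rw [coordPlus_freeSolution hz0 hR, coordMinus_freeSolution hz0 hR, pairNorm_mul,
    Complex.norm_real, Real.norm_of_nonneg (Real.rpow_nonneg hR.le κ), him, mul_comm z,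
    mul_comm |_| R] at h
  refine h.trans ?_
  have := freeConst_nonneg κ
  gcongr
  rw [growth, hzn, div_one]
  have h0 : 0 ≤ min R (κ + 1) := le_min hR.le (by linarith)
  gcongr
  exact min_le_right _ _

/-- On the half circle `w = R e^{iθ}`, `|θ| ≤ π/2`, the function `e^{-iw}` times `u₂ + i u₁`, after
the change of variables of `hasDerivAt_gauge`, varies by `O(1/R)` relative to `e^{Im w + |Im w|}`. -/
theorem norm_arc_sub_le {κ : ℝ} (hκ : 0 ≤ κ) {R : ℝ} (hR : 0 < R) {E : ℝ → ℂ}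
    (hE : ∀ θ : ℝ, E θ = Complex.exp (-(Complex.I * (R * Complex.exp (Complex.I * θ)))) *
      (((R ^ κ : ℝ) : ℂ) * Complex.exp (Complex.I * κ * θ) *
        freePlus κ (R * Complex.exp (Complex.I * θ))
      - Complex.I * κ / 2 / (R * Complex.exp (Complex.I * θ)) *
        (((R ^ κ : ℝ) : ℂ) * Complex.exp (Complex.I * κ * θ) *
          freeMinus κ (R * Complex.exp (Complex.I * θ)))))
    {θ₀ θ : ℝ} (h0 : -(Real.pi / 2) ≤ θ₀) (h01 : θ₀ ≤ θ) (h1 : θ ≤ Real.pi / 2) :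
    ‖E θ - E θ₀‖ ≤ κ * (κ + 1) / 2 * (freeConst κ * (κ + 1) ^ κ) * Real.pi / R *
      Real.exp (R * (Real.sin θ + |Real.sin θ|)) := by
  set C := freeConst κ * (κ + 1) ^ κ with hC
  have hC0 : 0 ≤ C := mul_nonneg (freeConst_nonneg κ) (by positivity)
  have hR' : (R : ℂ) ≠ 0 := by exact_mod_cast hR.ne'
  set w : ℝ → ℂ := fun t => R * Complex.exp (Complex.I * t) with hw
  have hw0 : ∀ t, w t ≠ 0 := fun t => mul_ne_zero hR' (Complex.exp_ne_zero _)
  have hwn : ∀ t, ‖w t‖ = R := by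
    intro t
    simp only [hw]
    rw [norm_mul, mul_comm Complex.I, Complex.norm_exp_ofReal_mul_I, Complex.norm_real,
      Real.norm_of_nonneg hR.le, mul_one]
  have hwim : ∀ t, (w t).im = R * Real.sin t := by
    intro t
    simp only [hw]
    rw [Complex.im_ofReal_mul, mul_comm Complex.I, Complex.exp_ofReal_mul_I_im]
  have hwd : ∀ t : ℝ, HasDerivAt w (Complex.I * w t) t := by
    intro t
    have h2 : HasDerivAt (fun s : ℝ => Complex.I * (s : ℂ)) Complex.I t := by
      simpa using (hasDerivAt_id t).ofReal_comp.const_mul Complex.I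
    refine (h2.cexp.const_mul (R : ℂ)).congr_deriv ?_
    simp only [hw]; ring
  set ph : ℝ → ℂ := fun t => ((R ^ κ : ℝ) : ℂ) * Complex.exp (Complex.I * κ * t) with hph
  have hphn : ∀ t, ‖ph t‖ = R ^ κ := by
    intro t
    simp only [hph]
    rw [norm_mul, Complex.norm_real, Real.norm_of_nonneg (Real.rpow_nonneg hR.le κ), mul_assoc,
      ← Complex.ofReal_mul, mul_comm Complex.I, Complex.norm_exp_ofReal_mul_I, mul_one]
  have hphd : ∀ t : ℝ, HasDerivAt ph (Complex.I * κ * ph t) t := by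
    intro t
    have h2 : HasDerivAt (fun s : ℝ => Complex.I * κ * (s : ℂ)) (Complex.I * κ) t := by
      simpa using (hasDerivAt_id t).ofReal_comp.const_mul (Complex.I * κ)
    refine (h2.cexp.const_mul (((R ^ κ : ℝ) : ℂ))).congr_deriv ?_
    simp only [hph]; ring
  set a : ℝ → ℂ := fun t => ph t * freePlus κ (w t) with ha
  set b : ℝ → ℂ := fun t => ph t * freeMinus κ (w t) with hb
  have had : ∀ t, HasDerivAt a (Complex.I * w t * (Complex.I * a t + κ / w t * b t)) t := by
    intro t
    obtain ⟨d1, d2⟩ := hasDerivAt_free (κ := κ) (hwd t) (hw0 t)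
    refine ((hphd t).mul (d2.add (d1.const_mul Complex.I))).congr_deriv ?_
    have := hw0 t
    simp only [ha, hb, freePlus, freeMinus, Pi.add_apply]
    field_simp
    ring_nf
    simp only [Complex.I_sq]
    ring
  have hbd : ∀ t, HasDerivAt b (Complex.I * w t * (-(Complex.I * b t) + κ / w t * a t)) t := by
    intro t
    obtain ⟨d1, d2⟩ := hasDerivAt_free (κ := κ) (hwd t) (hw0 t)
    refine ((hphd t).mul (d2.sub (d1.const_mul Complex.I))).congr_deriv ?_
    have := hw0 t
    simp only [ha, hb, freePlus, freeMinus, Pi.sub_apply]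
    field_simp
    ring_nf
    simp only [Complex.I_sq]
    ring
  set ex : ℝ → ℂ := fun t => Complex.exp (-(Complex.I * w t)) with hex
  have hexd : ∀ t, HasDerivAt ex (ex t * -(Complex.I * (Complex.I * w t))) t := fun t =>
    ((hwd t).const_mul Complex.I).fun_neg.cexp
  have hexn : ∀ t, ‖ex t‖ = Real.exp (R * Real.sin t) := by
    intro t
    simp only [hex]
    rw [Complex.norm_exp]
    congr 1
    rw [← hwim]
    simp
  have hEd : ∀ t, HasDerivAt E (-(ex t * (Complex.I * w t *
      (Complex.I * κ / 2 / w t ^ 2 * (κ * a t - b t))))) t := by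
    intro t
    have h2 := (hexd t).mul (hasDerivAt_gauge (hw0 t) (hwd t) (had t) (hbd t))
    have hEeq : E = fun t => ex t * (a t - Complex.I * κ / 2 / w t * b t) := funext hE
    rw [hEeq]
    refine h2.congr_deriv ?_
    ring
  -- The exponent is monotone in the angle, so the arc has to be followed upwards.
  have hmono : ∀ t ∈ Set.Ico θ₀ θ, Real.sin t + |Real.sin t| ≤ Real.sin θ + |Real.sin θ| := by
    intro t ht
    have hs : Real.sin t ≤ Real.sin θ :=
      Real.sin_le_sin_of_le_of_le_pi_div_two (by linarith [ht.1]) h1 ht.2.le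
    rcases abs_cases (Real.sin t) with h | h <;> rcases abs_cases (Real.sin θ) with h' | h' <;>
      linarith
  have hbound : ∀ t ∈ Set.Ico θ₀ θ, ‖-(ex t * (Complex.I * w t *
      (Complex.I * κ / 2 / w t ^ 2 * (κ * a t - b t))))‖
      ≤ κ * (κ + 1) / 2 * C / R * Real.exp (R * (Real.sin θ + |Real.sin θ|)) := by
    intro t ht
    have hr := norm_gauge_remainder hκ (w t) (a t) (b t)
    have hab : pairNorm (a t) (b t) ≤ C * Real.exp (R * |Real.sin t|) := by
      simp only [ha, hb]
      rw [pairNorm_mul, hphn]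
      exact rpow_mul_pairNorm_free_le hκ hR t
    rw [norm_neg, norm_mul, norm_mul, norm_mul, Complex.norm_I, one_mul, hexn, hwn]
    rw [hwn] at hr
    calc _ ≤ Real.exp (R * Real.sin t) * (R * (κ * (κ + 1) / 2 / R ^ 2 *
          (C * Real.exp (R * |Real.sin t|)))) := by
          gcongr
          exact hr.trans (by gcongr)
      _ = κ * (κ + 1) / 2 * C / R * (Real.exp (R * Real.sin t) * Real.exp (R * |Real.sin t|)) := by
          field_simp
      _ ≤ _ := by
          rw [← Real.exp_add, ← mul_add]
          have := hmono t ht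
          gcongr
  have := norm_image_sub_le_of_norm_deriv_le_segment' (fun t _ => (hEd t).hasDerivWithinAt) hbound θ
    (Set.right_mem_Icc.2 h01)
  refine this.trans ?_
  have hlen : θ - θ₀ ≤ Real.pi := by linarith
  calc _ ≤ κ * (κ + 1) / 2 * C / R * Real.exp (R * (Real.sin θ + |Real.sin θ|)) * Real.pi := by
        gcongr
    _ = _ := by ring

/-- The function of `norm_arc_sub_le`: `e^{-iw}` times `u₂ + i u₁` in the gauge of
`hasDerivAt_gauge`, at `w = R e^{iθ}`. -/
noncomputable def arcFun (κ R θ : ℝ) : ℂ :=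
  Complex.exp (-(Complex.I * (R * Complex.exp (Complex.I * θ)))) *
      (((R ^ κ : ℝ) : ℂ) * Complex.exp (Complex.I * κ * θ) *
        freePlus κ (R * Complex.exp (Complex.I * θ))
      - Complex.I * κ / 2 / (R * Complex.exp (Complex.I * θ)) *
        (((R ^ κ : ℝ) : ℂ) * Complex.exp (Complex.I * κ * θ) *
          freeMinus κ (R * Complex.exp (Complex.I * θ))))

/-- `e^{-iw} w^κ (u₂ + i u₁)` at `w = R e^{iθ}`. -/
noncomputable def arcPlus (κ R θ : ℝ) : ℂ :=
  Complex.exp (-(Complex.I * (R * Complex.exp (Complex.I * θ)))) *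
      (((R ^ κ : ℝ) : ℂ) * Complex.exp (Complex.I * κ * θ) *
        freePlus κ (R * Complex.exp (Complex.I * θ)))

theorem norm_arc_exp (R θ : ℝ) :
    ‖Complex.exp (-(Complex.I * (R * Complex.exp (Complex.I * θ))))‖ = Real.exp (R * Real.sin θ) := by
  rw [Complex.norm_exp]
  congr 1
  rw [mul_comm Complex.I (θ : ℂ), Complex.exp_mul_I]
  simp [← Complex.ofReal_sin, ← Complex.ofReal_cos]

theorem norm_arc_phase {R : ℝ} (hR : 0 < R) (κ θ : ℝ) :
    ‖((R ^ κ : ℝ) : ℂ) * Complex.exp (Complex.I * κ * θ)‖ = R ^ κ := by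
  rw [norm_mul, Complex.norm_real, Real.norm_of_nonneg (Real.rpow_nonneg hR.le κ), mul_assoc,
    ← Complex.ofReal_mul, mul_comm Complex.I, Complex.norm_exp_ofReal_mul_I, mul_one]

/-- A bound, uniform in `θ`, of the free regular solution on circles. -/
noncomputable def circleConst (κ : ℝ) : ℝ := freeConst κ * (κ + 1) ^ κ

theorem circleConst_nonneg {κ : ℝ} (hκ : 0 ≤ κ) : 0 ≤ circleConst κ :=
  mul_nonneg (freeConst_nonneg κ) (by positivity)

theorem norm_arcPlus {R : ℝ} (hR : 0 < R) (κ θ : ℝ) :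
    ‖arcPlus κ R θ‖ = Real.exp (R * Real.sin θ) *
      (R ^ κ * ‖freePlus κ (R * Complex.exp (Complex.I * θ))‖) := by
  rw [arcPlus, norm_mul, norm_mul, norm_arc_exp, norm_arc_phase hR]

theorem norm_arcPlus_sub_arcFun_le {κ : ℝ} (hκ : 0 ≤ κ) {R : ℝ} (hR : 0 < R) (θ : ℝ) :
    ‖arcPlus κ R θ - arcFun κ R θ‖
      ≤ κ / 2 * circleConst κ / R * Real.exp (R * (Real.sin θ + |Real.sin θ|)) := by
  have h := rpow_mul_pairNorm_free_le hκ hR θ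
  have hw : ‖(R * Complex.exp (Complex.I * θ) : ℂ)‖ = R := by
    rw [norm_mul, mul_comm Complex.I, Complex.norm_exp_ofReal_mul_I, Complex.norm_real,
      Real.norm_of_nonneg hR.le, mul_one]
  have hm := norm_le_pairNorm_right (freePlus κ (R * Complex.exp (Complex.I * θ)))
      (freeMinus κ (R * Complex.exp (Complex.I * θ)))
  rw [arcPlus, arcFun, ← mul_sub, sub_sub_cancel, norm_mul, norm_arc_exp, norm_mul,
    norm_gauge_coeff hκ, hw, norm_mul, norm_arc_phase hR, mul_add, Real.exp_add]
  have hRk : 0 ≤ R ^ κ := Real.rpow_nonneg hR.le κ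
  calc _ ≤ Real.exp (R * Real.sin θ) * (κ / (2 * R) *
        (circleConst κ * Real.exp (R * |Real.sin θ|))) := by
        gcongr ?_ * (?_ * ?_)
        exact (mul_le_mul_of_nonneg_left hm hRk).trans h
    _ = _ := by field_simp

theorem norm_arcFun_sub_le {κ : ℝ} (hκ : 0 ≤ κ) {R : ℝ} (hR : 0 < R)
    {θ₀ θ : ℝ} (h0 : -(Real.pi / 2) ≤ θ₀) (h01 : θ₀ ≤ θ) (h1 : θ ≤ Real.pi / 2) :
    ‖arcFun κ R θ - arcFun κ R θ₀‖ ≤ κ * (κ + 1) / 2 * circleConst κ * Real.pi / R *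
      Real.exp (R * (Real.sin θ + |Real.sin θ|)) :=
  norm_arc_sub_le hκ hR (E := arcFun κ R) (fun _ => rfl) h0 h01 h1

theorem exp_I_mul_pi_div_two : Complex.exp (Complex.I * (Real.pi / 2 : ℝ)) = Complex.I := by
  rw [mul_comm]
  push_cast
  exact Complex.exp_pi_div_two_mul_I

theorem exp_I_mul_neg_pi_div_two :
    Complex.exp (Complex.I * (-(Real.pi / 2) : ℝ)) = -Complex.I := by
  rw [mul_comm]
  push_cast
  rw [← neg_div]
  exact Complex.exp_neg_pi_div_two_mul_I

/-- On the positive imaginary axis the component `u₂ + i u₁` of the free solution is recessive: along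
the arc from the positive real axis, `e^{-iw} w^κ (u₂ + i u₁)` becomes at most `O(e^{2R} / R)`. -/
theorem tendsto_freePlus_I {κ : ℝ} (hκ : 0 ≤ κ) :
    Filter.Tendsto (fun R : ℝ => R ^ κ * Real.exp (-R) * ‖freePlus κ (R * Complex.I)‖)
      Filter.atTop (nhds 0) := by
  set C := circleConst κ
  set D := κ * (κ + 1) / 2 * C * Real.pi with hD
  have hC : 0 ≤ C := circleConst_nonneg hκ
  have hb : ∀ R : ℝ, 0 < R → R ^ κ * Real.exp (-R) * ‖freePlus κ (R * Complex.I)‖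
      ≤ Real.exp (-(2 * R)) * (C + κ / 2 * C / R) + (D / R + κ / 2 * C / R) := by
    intro R hR
    have h1 := norm_arcPlus_sub_arcFun_le hκ hR 0
    have h2 := norm_arcFun_sub_le hκ hR (θ₀ := 0) (θ := Real.pi / 2)
      (by linarith [Real.pi_pos]) (by linarith [Real.pi_pos]) le_rfl
    have h3 := norm_arcPlus_sub_arcFun_le hκ hR (Real.pi / 2)
    have h4 := norm_arcPlus hR κ 0
    have h5 := norm_arcPlus hR κ (Real.pi / 2)
    have h6 := (mul_le_mul_of_nonneg_left (norm_le_pairNorm_left _ _)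
      (Real.rpow_nonneg hR.le κ)).trans (rpow_mul_pairNorm_free_le hκ hR 0)
    simp only [Real.sin_zero, abs_zero, mul_zero, add_zero, Real.exp_zero, mul_one, one_mul,
      Real.sin_pi_div_two, abs_one] at h1 h2 h3 h4 h5 h6
    rw [exp_I_mul_pi_div_two] at h5
    rw [← h4] at h6
    have t1 : ‖arcFun κ R 0‖ ≤ C + κ / 2 * C / R := by
      have := norm_sub_norm_le (arcFun κ R 0) (arcPlus κ R 0)
      rw [norm_sub_rev] at this
      have h6' : ‖arcPlus κ R 0‖ ≤ C := h6
      linarith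
    have t2 : ‖arcPlus κ R (Real.pi / 2)‖ ≤ (C + κ / 2 * C / R)
        + (D / R + κ / 2 * C / R) * Real.exp (R * (1 + 1)) := by
      have a1 := norm_sub_norm_le (arcFun κ R (Real.pi / 2)) (arcFun κ R 0)
      have a2 := norm_sub_norm_le (arcPlus κ R (Real.pi / 2)) (arcFun κ R (Real.pi / 2))
      rw [add_mul]
      linarith
    have e1 : R ^ κ * Real.exp (-R) * ‖freePlus κ (R * Complex.I)‖
        = Real.exp (-(2 * R)) * ‖arcPlus κ R (Real.pi / 2)‖ := by
      rw [h5, ← mul_assoc, ← Real.exp_add, show -(2 * R) + R = -R by ring]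
      ring
    rw [e1]
    calc _ ≤ Real.exp (-(2 * R)) * ((C + κ / 2 * C / R)
        + (D / R + κ / 2 * C / R) * Real.exp (R * (1 + 1))) := by gcongr
      _ = Real.exp (-(2 * R)) * (C + κ / 2 * C / R)
        + (D / R + κ / 2 * C / R) * (Real.exp (-(2 * R)) * Real.exp (R * (1 + 1))) := by ring
      _ = _ := by rw [← Real.exp_add, show -(2 * R) + R * (1 + 1) = 0 by ring, Real.exp_zero, mul_one]
  have hinv : ∀ c : ℝ, Filter.Tendsto (fun R : ℝ => c / R) Filter.atTop (nhds 0) := fun c =>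
    tendsto_const_nhds.div_atTop Filter.tendsto_id
  have hexp : Filter.Tendsto (fun R : ℝ => Real.exp (-(2 * R))) Filter.atTop (nhds 0) :=
    Real.tendsto_exp_neg_atTop_nhds_zero.comp
      (Filter.tendsto_id.const_mul_atTop (by norm_num : (0 : ℝ) < 2))
  have hlim := (hexp.mul ((hinv (κ / 2 * C)).const_add C)).add
    ((hinv D).add (hinv (κ / 2 * C)))
  simp only [zero_mul, add_zero] at hlim
  refine tendsto_of_tendsto_of_tendsto_of_le_of_le' tendsto_const_nhds hlim ?_ ?_
  · filter_upwards [Filter.eventually_gt_atTop 0] with R hR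
    have := Real.rpow_nonneg hR.le κ
    positivity
  · filter_upwards [Filter.eventually_gt_atTop 0] with R hR using hb R hR

/-- The constant in the asymptotics of the free solution, read off on the negative imaginary axis,
where `u₂ + i u₁` is dominant. -/
theorem tendsto_arcFun_neg {κ : ℝ} (hκ : 0 ≤ κ) :
    Filter.Tendsto (fun R : ℝ => arcFun κ R (-(Real.pi / 2))) Filter.atTop
      (nhds (Complex.exp (-(Complex.I * (κ * Real.pi / 2))))) := by
  set A := Complex.exp (-(Complex.I * (κ * Real.pi / 2))) with hA
  have h1 := (tendsto_freeFst_neg_I hκ).const_mul A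
  rw [mul_one] at h1
  have h2 : Filter.Tendsto (fun R : ℝ => A * (1 + κ / 2 / (R : ℂ)) *
      (((R ^ κ * Real.exp (-R) : ℝ) : ℂ) * freeMinus κ (-Complex.I * R)))
      Filter.atTop (nhds 0) := by
    have h3 : Filter.Tendsto (fun R : ℝ => ((R ^ κ * Real.exp (-R) : ℝ) : ℂ)
        * freeMinus κ (-Complex.I * R)) Filter.atTop (nhds 0) := by
      rw [tendsto_zero_iff_norm_tendsto_zero]
      refine (tendsto_freePlus_I hκ).congr' ?_
      filter_upwards [Filter.eventually_gt_atTop 0] with R hR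
      have hc : freeMinus κ (-Complex.I * R)
          = (starRingEnd ℂ) (freePlus κ (R * Complex.I)) := by
        rw [conj_freePlus]
        congr 1
        simp [mul_comm]
      have := Real.rpow_nonneg hR.le κ
      rw [norm_mul, hc, Complex.norm_conj, Complex.norm_real, Real.norm_of_nonneg (by positivity)]
    have h4 : Filter.Tendsto (fun R : ℝ => A * (1 + κ / 2 / (R : ℂ))) Filter.atTop
        (nhds (A * (1 + 0))) := by
      refine (Filter.Tendsto.const_add 1 ?_).const_mul A
      have : Filter.Tendsto (fun R : ℝ => ((κ / 2 / R : ℝ) : ℂ)) Filter.atTop (nhds ((0 : ℝ) : ℂ)) :=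
        (Complex.continuous_ofReal.tendsto 0).comp
          (tendsto_const_nhds.div_atTop Filter.tendsto_id)
      simpa using this
    simpa using h4.mul h3
  have h5 := h1.add h2
  rw [add_zero] at h5
  refine h5.congr' ?_
  filter_upwards [Filter.eventually_gt_atTop 0] with R hR
  have hR' : (R : ℂ) ≠ 0 := by exact_mod_cast hR.ne'
  have hph : Complex.exp (Complex.I * κ * (-(Real.pi / 2) : ℝ)) = A := by
    rw [hA]; congr 1; push_cast; ring
  have hex : Complex.exp (-(Complex.I * (R * -Complex.I))) = ((Real.exp (-R) : ℝ) : ℂ) := by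
    rw [Complex.ofReal_exp]
    congr 1
    push_cast
    linear_combination (R : ℂ) * Complex.I_sq
  rw [arcFun, exp_I_mul_neg_pi_div_two, hph, hex, mul_comm (R : ℂ) (-Complex.I), freePlus, freeMinus]
  have hI : Complex.I * κ / 2 / (-Complex.I * R) = -(κ / 2 / R) := by
    have := Complex.I_ne_zero
    field_simp
  rw [hI]
  push_cast
  ring

/-- Asymptotics of the free regular solution in the closed right half-plane. -/
theorem exists_freePlus_asymptotics {κ : ℝ} (hκ : 0 ≤ κ) :
    ∃ ε : ℝ → ℝ, Filter.Tendsto ε Filter.atTop (nhds 0) ∧ ∀ w : ℂ, w ≠ 0 → 0 ≤ w.re →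
      ‖w ^ (κ : ℂ) * freePlus κ w - Complex.exp (Complex.I * (w - κ * Real.pi / 2))‖
        ≤ ε ‖w‖ * Real.exp |w.im| := by
  set C := circleConst κ
  set D := κ * (κ + 1) / 2 * C * Real.pi with hD
  set A := Complex.exp (-(Complex.I * (κ * Real.pi / 2))) with hA
  have hinv : ∀ c : ℝ, Filter.Tendsto (fun R : ℝ => c / R) Filter.atTop (nhds 0) := fun c =>
    tendsto_const_nhds.div_atTop Filter.tendsto_id
  refine ⟨fun R => ‖arcFun κ R (-(Real.pi / 2)) - A‖ + (D / R + κ / 2 * C / R), ?_, ?_⟩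
  · have := (tendsto_iff_norm_sub_tendsto_zero.1 (tendsto_arcFun_neg hκ)).add
      ((hinv D).add (hinv (κ / 2 * C)))
    simpa using this
  · intro w hw0 hre
    set R := ‖w‖ with hR
    set θ := w.arg with hθ
    have hR0 : 0 < R := norm_pos_iff.2 hw0
    have hθ' : |θ| ≤ Real.pi / 2 := Complex.abs_arg_le_pi_div_two_iff.2 hre
    obtain ⟨hθ1, hθ2⟩ := abs_le.1 hθ'
    have hw : (R * Complex.exp (Complex.I * θ) : ℂ) = w := by
      rw [mul_comm Complex.I]; exact Complex.norm_mul_exp_arg_mul_I w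
    have hpow : w ^ (κ : ℂ) = ((R ^ κ : ℝ) : ℂ) * Complex.exp (Complex.I * κ * θ) := by
      rw [Complex.cpow_def_of_ne_zero hw0, Complex.log, ← hR, ← hθ,
        Real.rpow_def_of_pos hR0, Complex.ofReal_exp, ← Complex.exp_add]
      congr 1
      push_cast
      ring
    have him : R * Real.sin θ = w.im := Complex.norm_mul_sin_arg w
    have habs : R * |Real.sin θ| = |w.im| := by rw [← him, abs_mul, abs_of_pos hR0]
    have h1 := norm_arcFun_sub_le hκ hR0 le_rfl hθ1 hθ2
    have h2 := norm_arcPlus_sub_arcFun_le hκ hR0 θ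
    rw [mul_add R, him, habs] at h1 h2
    have hP : arcPlus κ R θ = Complex.exp (-(Complex.I * w)) * (w ^ (κ : ℂ) * freePlus κ w) := by
      rw [arcPlus, hw, hpow]
    have hexn : ‖Complex.exp (Complex.I * w)‖ = Real.exp (-w.im) := by
      rw [Complex.norm_exp]; simp
    have hid : w ^ (κ : ℂ) * freePlus κ w - Complex.exp (Complex.I * (w - κ * Real.pi / 2))
        = Complex.exp (Complex.I * w) * (arcPlus κ R θ - A) := by
      have e1 : Complex.exp (Complex.I * w) * Complex.exp (-(Complex.I * w)) = 1 := by
        rw [← Complex.exp_add, add_neg_cancel, Complex.exp_zero]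
      have e2 : Complex.exp (Complex.I * (w - κ * Real.pi / 2)) = Complex.exp (Complex.I * w) * A := by
        rw [hA, ← Complex.exp_add]; congr 1; ring
      rw [hP, e2]
      linear_combination (-(w ^ (κ : ℂ) * freePlus κ w)) * e1
    have h3 : 1 ≤ Real.exp (w.im + |w.im|) :=
      Real.one_le_exp (by linarith [neg_abs_le w.im])
    have h4 : ‖arcPlus κ R θ - A‖ ≤ (‖arcFun κ R (-(Real.pi / 2)) - A‖
        + (D / R + κ / 2 * C / R)) * Real.exp (w.im + |w.im|) := by
      have e1 : arcPlus κ R θ - A = (arcPlus κ R θ - arcFun κ R θ)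
        + (arcFun κ R θ - arcFun κ R (-(Real.pi / 2))) + (arcFun κ R (-(Real.pi / 2)) - A) := by ring
      rw [e1]
      refine (norm_add₃_le).trans ?_
      have h5 : ‖arcFun κ R (-(Real.pi / 2)) - A‖
          ≤ ‖arcFun κ R (-(Real.pi / 2)) - A‖ * Real.exp (w.im + |w.im|) :=
        le_mul_of_one_le_right (norm_nonneg _) h3
      rw [add_mul, add_mul]
      linarith
    rw [hid, norm_mul, hexn]
    calc _ ≤ Real.exp (-w.im) * ((‖arcFun κ R (-(Real.pi / 2)) - A‖
        + (D / R + κ / 2 * C / R)) * Real.exp (w.im + |w.im|)) := by gcongr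
      _ = (‖arcFun κ R (-(Real.pi / 2)) - A‖ + (D / R + κ / 2 * C / R)) *
          (Real.exp (-w.im) * Real.exp (w.im + |w.im|)) := by ring
      _ = _ := by rw [← Real.exp_add]; congr 2; ring

/-- Asymptotics of both coordinates; `u₂ - i u₁` follows from `u₂ + i u₁` by complex conjugation. -/
theorem exists_free_asymptotics {κ : ℝ} (hκ : 0 ≤ κ) :
    ∃ ε : ℝ → ℝ, Filter.Tendsto ε Filter.atTop (nhds 0) ∧ ∀ w : ℂ, w ≠ 0 → 0 ≤ w.re →
      ‖w ^ (κ : ℂ) * freePlus κ w - Complex.exp (Complex.I * (w - κ * Real.pi / 2))‖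
        ≤ ε ‖w‖ * Real.exp |w.im| ∧
      ‖w ^ (κ : ℂ) * freeMinus κ w - Complex.exp (-(Complex.I * (w - κ * Real.pi / 2)))‖
        ≤ ε ‖w‖ * Real.exp |w.im| := by
  obtain ⟨ε, hε, h⟩ := exists_freePlus_asymptotics hκ
  refine ⟨ε, hε, fun w hw hre => ⟨h w hw hre, ?_⟩⟩
  have hc := h ((starRingEnd ℂ) w) (by simpa using hw) (by simpa using hre)
  rw [Complex.norm_conj, Complex.conj_im, abs_neg, ← Complex.norm_conj] at hc
  convert hc using 2
  have harg : w.arg ≠ Real.pi := by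
    have := (abs_le.1 (Complex.abs_arg_le_pi_div_two_iff.2 hre)).2
    have hp := Real.pi_pos
    intro h0
    linarith
  rw [map_sub, map_mul, conj_freePlus, Complex.conj_conj, ← Complex.exp_conj]
  congr 1
  · rw [← Complex.cpow_conj _ _ harg, Complex.conj_ofReal]
  · congr 1
    simp [map_ofNat]

open MeasureTheory Filter Topology Set

/-! ### A Riemann-Lebesgue lemma and a Gronwall lemma along a filter -/

/-- The Riemann-Lebesgue lemma for indicator functions, by induction on Borel sets. -/
theorem tendsto_setIntegral_of_tendsto_primitive {ι : Type*} {l : Filter ι} {X M : ℝ}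
    {f : ι → ℝ → ℂ}
    (hf : ∀ᶠ i in l, IntegrableOn (f i) (Ioc 0 X))
    (hM : ∀ᶠ i in l, ∀ y ∈ Ioc 0 X, ‖f i y‖ ≤ M)
    (hlim : ∀ a ∈ Ioc 0 X, Tendsto (fun i => ∫ y in Ioc 0 a, f i y) l (𝓝 0))
    {s : Set ℝ} (hs : MeasurableSet s) :
    Tendsto (fun i => ∫ y in s, f i y ∂(volume.restrict (Ioc 0 X))) l (𝓝 0) := by
  rcases le_or_gt X 0 with hX | hX
  · simpa [Ioc_eq_empty_of_le hX] using tendsto_const_nhds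
  induction s, hs using MeasurableSpace.induction_on_inter
    (borel_eq_generateFrom_Iic ℝ ▸ BorelSpace.measurable_eq) isPiSystem_Iic with
  | empty => simpa using tendsto_const_nhds
  | basic t ht =>
    obtain ⟨a, rfl⟩ := ht
    have h1 : Iic a ∩ Ioc 0 X = Ioc 0 (min a X) := by
      ext y; simp only [mem_inter_iff, mem_Iic, mem_Ioc, le_min_iff]; tauto
    simp only [Measure.restrict_restrict measurableSet_Iic, h1]
    rcases le_or_gt (min a X) 0 with h | h
    · simpa [Ioc_eq_empty_of_le h] using tendsto_const_nhds
    · exact hlim _ ⟨h, min_le_right _ _⟩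
  | compl t ht ih =>
    have h1 := (hlim X ⟨hX, le_rfl⟩).sub ih
    rw [sub_zero] at h1
    refine h1.congr' ?_
    filter_upwards [hf] with i hi
    rw [← integral_add_compl ht hi, add_sub_cancel_left]
  | iUnion s hd hsm ih =>
    have h1 : Tendsto (fun i => ∑' n, ∫ y in s n, f i y ∂(volume.restrict (Ioc 0 X))) l
        (𝓝 (∑' _ : ℕ, (0 : ℂ))) := by
      refine tendsto_tsum_of_dominated_convergence
        (bound := fun n => M * (volume.restrict (Ioc 0 X)).real (s n)) ?_ ih ?_
      · refine Summable.mul_left _ ?_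
        refine ENNReal.summable_toReal ?_
        rw [← measure_iUnion hd hsm]
        exact (measure_lt_top _ _).ne
      · filter_upwards [hM] with i hi n
        refine norm_setIntegral_le_of_norm_le_const_ae' (measure_lt_top _ _) ?_
        filter_upwards [ae_restrict_mem measurableSet_Ioc] with y hy _ using hi y hy
    rw [tsum_zero] at h1
    refine h1.congr' ?_
    filter_upwards [hf] with i hi
    exact (integral_iUnion hsm hd hi.integrableOn).symm

/-- An abstract Riemann-Lebesgue lemma: if the bounded functions `f i` have primitives tending to
`0`, then they tend to `0` weakly against integrable functions. -/
theorem tendsto_integral_mul_of_tendsto_primitive {ι : Type*} {l : Filter ι} {X M : ℝ}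
    {f : ι → ℝ → ℂ}
    (hf : ∀ᶠ i in l, IntegrableOn (f i) (Ioc 0 X))
    (hM : ∀ᶠ i in l, ∀ y ∈ Ioc 0 X, ‖f i y‖ ≤ M)
    (hlim : ∀ a ∈ Ioc 0 X, Tendsto (fun i => ∫ y in Ioc 0 a, f i y) l (𝓝 0))
    {m : ℝ → ℂ} (hm : IntegrableOn m (Ioc 0 X)) :
    Tendsto (fun i => ∫ y in Ioc 0 X, m y * f i y) l (𝓝 0) := by
  have hint : ∀ g : ℝ → ℂ, IntegrableOn g (Ioc 0 X) →
      ∀ᶠ i in l, IntegrableOn (fun y => g y * f i y) (Ioc 0 X) := by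
    intro g hg
    filter_upwards [hf, hM] with i hi hiM
    refine hg.mul_bdd hi.aestronglyMeasurable (c := M) ?_
    filter_upwards [ae_restrict_mem measurableSet_Ioc] with y hy using hiM y hy
  refine Integrable.induction (μ := volume.restrict (Ioc 0 X))
    (P := fun m => Tendsto (fun i => ∫ y in Ioc 0 X, m y * f i y) l (𝓝 0)) ?_ ?_ ?_ ?_ hm
  · intro c s hs _
    have h1 := (tendsto_setIntegral_of_tendsto_primitive hf hM hlim hs).const_mul c
    rw [mul_zero] at h1
    refine h1.congr fun i => ?_
    rw [← integral_const_mul, ← integral_indicator hs]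
    congr 1
    ext y
    by_cases hy : y ∈ s <;> simp [hy]
  · intro g h _ hg hh ihg ihh
    have h1 := ihg.add ihh
    rw [add_zero] at h1
    refine h1.congr' ?_
    filter_upwards [hint g hg, hint h hh] with i hi hj
    rw [← integral_add hi hj]
    simp only [Pi.add_apply, add_mul]
  · rw [← isSeqClosed_iff_isClosed]
    intro u g hu hlimu
    rw [mem_ofPred_eq, Metric.tendsto_nhds]
    intro ε hε
    obtain ⟨n, hn⟩ := ((Metric.tendsto_atTop.1 hlimu) (ε / 2 / (|M| + 1)) (by positivity))
    have h2 := hn n le_rfl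
    rw [dist_comm, dist_eq_norm, L1.norm_eq_integral_norm] at h2
    filter_upwards [Metric.tendsto_nhds.1 (hu n) (ε / 2) (by positivity), hM,
      hint _ (L1.integrable_coeFn g), hint _ (L1.integrable_coeFn (u n))] with i hi hiM h3 h4
    rw [dist_zero_right] at hi ⊢
    have h5 : ‖(∫ y in Ioc 0 X, g y * f i y) - ∫ y in Ioc 0 X, u n y * f i y‖ ≤ ε / 2 := by
      rw [← integral_sub h3 h4]
      calc _ ≤ ∫ y in Ioc 0 X, ‖(g - u n : Lp ℂ 1 _) y‖ * (|M| + 1) := by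
            refine norm_integral_le_of_norm_le ((L1.integrable_coeFn _).norm.mul_const _) ?_
            filter_upwards [ae_restrict_mem measurableSet_Ioc, Lp.coeFn_sub g (u n)] with y hy hy2
            rw [← sub_mul, norm_mul, hy2, Pi.sub_apply]
            gcongr
            exact (hiM y hy).trans ((le_abs_self _).trans (by linarith))
        _ = (∫ y in Ioc 0 X, ‖(g - u n : Lp ℂ 1 _) y‖) * (|M| + 1) := integral_mul_const _ _
        _ ≤ ε / 2 / (|M| + 1) * (|M| + 1) := by gcongr
        _ = ε / 2 := by field_simp
    calc ‖∫ y in Ioc 0 X, g y * f i y‖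
        = ‖((∫ y in Ioc 0 X, g y * f i y) - ∫ y in Ioc 0 X, u n y * f i y)
          + ∫ y in Ioc 0 X, u n y * f i y‖ := by rw [sub_add_cancel]
      _ < ε := (norm_add_le _ _).trans_lt (by linarith)
  · intro g h hgh _ ihg
    refine ihg.congr fun i => integral_congr_ae ?_
    filter_upwards [hgh] with y hy
    rw [hy]

/-- One step of the Gronwall argument: if `∫₀ˣ ρ (e i)` tends to `0`, then so does `∫₀ˣ' ρ (e i)` for
`x' ≥ x` such that the `ρ`-mass of `(x, x']` is at most `1 / (2C)`. -/
theorem tendsto_primitive_step {ι : Type*} {l : Filter ι} {X C : ℝ}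
    {ρ : ℝ → ℝ} (hρ0 : ∀ y, 0 ≤ ρ y) (hC : 0 ≤ C) (hρ : IntegrableOn ρ (Ioc 0 X))
    {e d : ι → ℝ → ℝ} (he0 : ∀ i y, 0 ≤ e i y) (hd0 : ∀ i y, 0 ≤ d i y)
    (hei : ∀ᶠ i in l, IntegrableOn (fun y => ρ y * e i y) (Ioc 0 X))
    (hdi : ∀ᶠ i in l, IntegrableOn (fun y => ρ y * d i y) (Ioc 0 X))
    (hed : ∀ᶠ i in l, ∀ y ∈ Ioc 0 X, e i y ≤ d i y + C * ∫ t in Ioc 0 y, ρ t * e i t)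
    (hd : Tendsto (fun i => ∫ y in Ioc 0 X, ρ y * d i y) l (𝓝 0))
    {x x' : ℝ} (hx0 : 0 ≤ x) (hxx : x ≤ x') (hx' : x' ≤ X)
    (hsmall : C * ∫ t in Ioc x x', ρ t ≤ 1 / 2)
    (hx : Tendsto (fun i => ∫ t in Ioc 0 x, ρ t * e i t) l (𝓝 0)) :
    Tendsto (fun i => ∫ t in Ioc 0 x', ρ t * e i t) l (𝓝 0) := by
  have hlim : Tendsto (fun i => 2 * (∫ y in Ioc 0 X, ρ y * d i y)
      + 2 * ∫ t in Ioc 0 x, ρ t * e i t) l (𝓝 0) := by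
    simpa using (hd.const_mul 2).add (hx.const_mul 2)
  refine tendsto_of_tendsto_of_tendsto_of_le_of_le' tendsto_const_nhds hlim
    (Eventually.of_forall fun i =>
      integral_nonneg fun t => mul_nonneg (hρ0 t) (he0 i t)) ?_
  filter_upwards [hei, hdi, hed] with i hei hdi hed
  have hsub : Ioc x x' ⊆ Ioc 0 X := Ioc_subset_Ioc hx0 hx'
  have h1 : ∫ t in Ioc 0 x', ρ t * e i t
      = (∫ t in Ioc 0 x, ρ t * e i t) + ∫ t in Ioc x x', ρ t * e i t := by
    rw [← Ioc_union_Ioc_eq_Ioc hx0 hxx]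
    exact setIntegral_union (Ioc_disjoint_Ioc_of_le le_rfl) measurableSet_Ioc
      (hei.mono_set (Ioc_subset_Ioc le_rfl (hxx.trans hx'))) (hei.mono_set hsub)
  set I := ∫ t in Ioc 0 x', ρ t * e i t with hI
  have hI0 : 0 ≤ I := integral_nonneg fun t => mul_nonneg (hρ0 t) (he0 i t)
  have h2 : ∫ t in Ioc x x', ρ t * e i t
      ≤ ∫ t in Ioc x x', (ρ t * d i t + ρ t * (C * I)) := by
    refine setIntegral_mono_on (hei.mono_set hsub)
      ((hdi.mono_set hsub).add ((hρ.mono_set hsub).mul_const _)) measurableSet_Ioc ?_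
    intro t ht
    rw [← mul_add]
    refine mul_le_mul_of_nonneg_left ((hed t (hsub ht)).trans ?_) (hρ0 t)
    gcongr
    refine setIntegral_mono_set (hei.mono_set (Ioc_subset_Ioc le_rfl hx'))
      (Eventually.of_forall fun t => mul_nonneg (hρ0 t) (he0 i t))
      (Ioc_subset_Ioc le_rfl ht.2).eventuallyLE
  rw [integral_add (hdi.mono_set hsub) ((hρ.mono_set hsub).mul_const _), integral_mul_const] at h2
  have h3 : ∫ t in Ioc x x', ρ t * d i t ≤ ∫ y in Ioc 0 X, ρ y * d i y :=
    setIntegral_mono_set hdi (Eventually.of_forall fun t => mul_nonneg (hρ0 t) (hd0 i t))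
      hsub.eventuallyLE
  nlinarith

/-- A Gronwall lemma along a filter. No bound on the solutions `e i` that is uniform in `i` is
needed, since a partition of `(0, X]` into pieces of small `ρ`-mass does not depend on `i`. -/
theorem tendsto_zero_of_integral_inequality {ι : Type*} {l : Filter ι} [l.IsCountablyGenerated]
    {X C M : ℝ} (hX : 0 < X) (hC : 0 ≤ C)
    {ρ : ℝ → ℝ} (hρ0 : ∀ y, 0 ≤ ρ y) (hρ : IntegrableOn ρ (Ioc 0 X))
    {e d : ι → ℝ → ℝ} (he0 : ∀ i y, 0 ≤ e i y) (hd0 : ∀ i y, 0 ≤ d i y)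
    (hem : ∀ᶠ i in l, AEStronglyMeasurable (e i) (volume.restrict (Ioc 0 X)))
    (hei : ∀ᶠ i in l, IntegrableOn (fun y => ρ y * e i y) (Ioc 0 X))
    (hed : ∀ᶠ i in l, ∀ y ∈ Ioc 0 X, e i y ≤ d i y + C * ∫ t in Ioc 0 y, ρ t * e i t)
    (hdM : ∀ᶠ i in l, ∀ y ∈ Ioc 0 X, d i y ≤ M)
    (hd : ∀ y ∈ Ioc 0 X, Tendsto (fun i => d i y) l (𝓝 0)) :
    Tendsto (fun i => e i X) l (𝓝 0) := by
  -- The least admissible inhomogeneity is measurable, which `d i` need not be.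
  set D : ι → ℝ → ℝ := fun i y => max 0 (e i y - C * ∫ t in Ioc 0 y, ρ t * e i t) with hD
  have hD0 : ∀ i y, 0 ≤ D i y := fun i y => le_max_left _ _
  have hDd : ∀ᶠ i in l, ∀ y ∈ Ioc 0 X, D i y ≤ d i y := by
    filter_upwards [hed] with i hi y hy
    exact max_le (hd0 i y) (by linarith [hi y hy])
  have hDm : ∀ᶠ i in l, AEStronglyMeasurable (D i) (volume.restrict (Ioc 0 X)) := by
    filter_upwards [hem, hei] with i hi hi2
    refine aestronglyMeasurable_const.sup (hi.sub (AEStronglyMeasurable.const_mul ?_ C))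
    have h1 := intervalIntegral.continuousOn_primitive
      ((integrableOn_Icc_iff_integrableOn_Ioc (μ := volume)).2 hi2)
    exact (h1.mono Ioc_subset_Icc_self).aestronglyMeasurable measurableSet_Ioc
  have hDM : ∀ᶠ i in l, ∀ᵐ y ∂(volume.restrict (Ioc 0 X)), ‖D i y‖ ≤ M := by
    filter_upwards [hDd, hdM] with i h1 h2
    filter_upwards [ae_restrict_mem measurableSet_Ioc] with y hy
    rw [Real.norm_of_nonneg (hD0 i y)]
    exact (h1 y hy).trans (h2 y hy)
  have hDi : ∀ᶠ i in l, IntegrableOn (fun y => ρ y * D i y) (Ioc 0 X) := by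
    filter_upwards [hDm, hDM] with i h1 h2 using hρ.mul_bdd h1 h2
  have hDed : ∀ᶠ i in l, ∀ y ∈ Ioc 0 X, e i y ≤ D i y + C * ∫ t in Ioc 0 y, ρ t * e i t :=
    Eventually.of_forall fun i y _ => by
      linarith [le_max_right 0 (e i y - C * ∫ t in Ioc 0 y, ρ t * e i t)]
  have hDlim : Tendsto (fun i => ∫ y in Ioc 0 X, ρ y * D i y) l (𝓝 0) := by
    have h1 : Tendsto (fun i => ∫ y in Ioc 0 X, ρ y * D i y) l (𝓝 (∫ y in Ioc 0 X, (0 : ℝ))) := by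
      refine tendsto_integral_filter_of_dominated_convergence (fun y => ρ y * M) ?_ ?_
        (hρ.mul_const M) ?_
      · filter_upwards [hDi] with i hi using hi.aestronglyMeasurable
      · filter_upwards [hDM] with i hi
        filter_upwards [hi] with y hy
        rw [norm_mul, Real.norm_of_nonneg (hρ0 y)]
        exact mul_le_mul_of_nonneg_left hy (hρ0 y)
      · filter_upwards [ae_restrict_mem measurableSet_Ioc] with y hy
        have : Tendsto (fun i => D i y) l (𝓝 0) :=
          tendsto_of_tendsto_of_tendsto_of_le_of_le' tendsto_const_nhds (hd y hy)
            (Eventually.of_forall fun i => hD0 i y) (hDd.mono fun i hi => hi y hy)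
        simpa using this.const_mul (ρ y)
    simpa using h1
  have hunif := isCompact_Icc.uniformContinuousOn_of_continuous
    (intervalIntegral.continuousOn_primitive
      ((integrableOn_Icc_iff_integrableOn_Ioc (μ := volume)).2 hρ))
  obtain ⟨η, hη, hη2⟩ := Metric.uniformContinuousOn_iff.1 hunif (1 / (2 * (C + 1))) (by positivity)
  obtain ⟨N, hN⟩ := exists_nat_gt (X / η)
  have hN0 : (0 : ℝ) < N := lt_trans (by positivity) hN
  have hstep : ∀ k : ℕ, k ≤ N →
      Tendsto (fun i => ∫ t in Ioc 0 (k * X / N), ρ t * e i t) l (𝓝 0) := by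
    intro k
    induction k with
    | zero => simpa using tendsto_const_nhds
    | succ k ih =>
      intro hk
      have hk' : ((k : ℝ) + 1) ≤ N := by exact_mod_cast hk
      have a1 : (0 : ℝ) ≤ k * X / N := by positivity
      have a2 : k * X / N ≤ ((k + 1 : ℕ) : ℝ) * X / N := by push_cast; gcongr; linarith
      have a3 : ((k + 1 : ℕ) : ℝ) * X / N ≤ X := by
        rw [div_le_iff₀ hN0]; push_cast; nlinarith
      refine tendsto_primitive_step hρ0 hC hρ he0 hD0 hei hDi hDed hDlim a1 a2 a3 ?_
        (ih (by omega))
      have h1 := hη2 (((k + 1 : ℕ) : ℝ) * X / N) ⟨a1.trans a2, a3⟩ (k * X / N) ⟨a1, a2.trans a3⟩ (by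
        rw [Real.dist_eq, ← sub_div, ← sub_mul]
        push_cast
        rw [add_sub_cancel_left, one_mul, abs_of_pos (by positivity)]
        rw [div_lt_iff₀ hη] at hN
        rw [div_lt_iff₀ hN0]; linarith)
      have h2 : ∫ t in Ioc 0 (((k + 1 : ℕ) : ℝ) * X / N), ρ t
          = (∫ t in Ioc 0 (k * X / N), ρ t)
            + ∫ t in Ioc (k * X / N) (((k + 1 : ℕ) : ℝ) * X / N), ρ t := by
        rw [← Ioc_union_Ioc_eq_Ioc a1 a2]
        exact setIntegral_union (Ioc_disjoint_Ioc_of_le le_rfl) measurableSet_Ioc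
          (hρ.mono_set (Ioc_subset_Ioc le_rfl (a2.trans a3))) (hρ.mono_set (Ioc_subset_Ioc a1 a3))
      rw [Real.dist_eq, h2, add_sub_cancel_left] at h1
      have h3 := (le_abs_self _).trans h1.le
      calc _ ≤ C * (1 / (2 * (C + 1))) := by gcongr
        _ ≤ 1 / 2 := by
          rw [mul_one_div, div_le_div_iff₀ (by positivity) (by norm_num)]; linarith
  have hlast := hstep N le_rfl
  rw [mul_div_assoc, mul_div_cancel₀ _ hN0.ne'] at hlast
  have hlim := (hd X ⟨hX, le_rfl⟩).add (hlast.const_mul C)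
  rw [mul_zero, add_zero] at hlim
  exact tendsto_of_tendsto_of_tendsto_of_le_of_le' tendsto_const_nhds hlim
    (Eventually.of_forall fun i => he0 i X) (hed.mono fun i hi => hi X ⟨hX, le_rfl⟩)

/-! ### The oscillation of the first iterate -/

/-- The size of the regular solution of the free system at `x`, up to constant factors. -/
noncomputable def scale (κ : ℝ) (z : ℂ) (x : ℝ) : ℝ := growth κ z x * Real.exp (|z.im| * x)

theorem scale_pos {κ : ℝ} (hκ : 0 ≤ κ) {z : ℂ} (hz : z ≠ 0) {x : ℝ} (hx : 0 < x) :
    0 < scale κ z x := mul_pos (growth_pos hκ hz hx) (Real.exp_pos _)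

theorem scale_neg (κ : ℝ) (z : ℂ) (x : ℝ) : scale κ (-z) x = scale κ z x := by
  simp [scale, growth]

theorem growth_mono {κ : ℝ} (hκ : 0 ≤ κ) (z : ℂ) {x y : ℝ} (hx : 0 < x) (hxy : x ≤ y) :
    growth κ z x ≤ growth κ z y := by
  unfold growth
  have : 0 ≤ (κ + 1) / ‖z‖ := by positivity
  exact Real.rpow_le_rpow (le_min hx.le this) (min_le_min_right _ hxy) hκ

theorem continuous_scale {κ : ℝ} (hκ : 0 ≤ κ) (z : ℂ) :
    Continuous (scale κ z) := by
  unfold scale growth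
  exact ((continuous_id.min continuous_const).rpow_const fun _ => Or.inr hκ).mul (by fun_prop)

theorem norm_exp_I_mul_le (z : ℂ) {t T : ℝ} (h : |t| ≤ T) :
    ‖Complex.exp (Complex.I * z * t)‖ ≤ Real.exp (|z.im| * T) := by
  rw [norm_exp_I_mul, Real.exp_le_exp]
  calc -z.im * t ≤ |-z.im * t| := le_abs_self _
    _ = |z.im| * |t| := by rw [abs_mul, abs_neg]
    _ ≤ _ := by gcongr

theorem norm_integral_exp_le {z : ℂ} (hz : z ≠ 0) {s a X : ℝ} (hsa : s ≤ a) (haX : a ≤ X) :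
    ‖∫ y in s..a, Complex.exp (Complex.I * z * (X + s - 2 * y : ℝ))‖
      ≤ Real.exp (|z.im| * (X - s)) / ‖z‖ := by
  have hd : ∀ y ∈ uIcc s a, HasDerivAt
      (fun y : ℝ => Complex.exp (Complex.I * z * (X + s - 2 * y : ℝ)) / (-(2 * Complex.I * z)))
      (Complex.exp (Complex.I * z * (X + s - 2 * y : ℝ))) y := by
    intro y _
    have h1 : HasDerivAt (fun y : ℝ => ((X + s - 2 * y : ℝ) : ℂ)) ((-(2 * 1) : ℝ) : ℂ) y :=
      (((hasDerivAt_id y).const_mul 2).const_sub (X + s)).ofReal_comp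
    refine ((h1.const_mul (Complex.I * z)).cexp.div_const _).congr_deriv ?_
    have := Complex.I_ne_zero
    push_cast
    field_simp
  rw [intervalIntegral.integral_eq_sub_of_hasDerivAt hd
    (Continuous.intervalIntegrable (by fun_prop) _ _), ← sub_div, norm_div]
  have h2 : ‖-(2 * Complex.I * z)‖ = 2 * ‖z‖ := by simp
  rw [h2]
  have h3 := norm_exp_I_mul_le z (t := X + s - 2 * a) (T := X - s)
    (abs_le.2 ⟨by linarith, by linarith⟩)
  have h4 := norm_exp_I_mul_le z (t := X + s - 2 * s) (T := X - s)
    (abs_le.2 ⟨by linarith, by linarith⟩)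
  have hz' := norm_pos_iff.2 hz
  rw [div_le_div_iff₀ (by positivity) hz']
  have := norm_sub_le (Complex.exp (Complex.I * z * (X + s - 2 * a : ℝ)))
    (Complex.exp (Complex.I * z * (X + s - 2 * s : ℝ)))
  nlinarith

/-- If `A y` is transported from its value `η n(y)` at `y` by the free flow, where `(m, n)` is a
free solution, then `A y X` is close to `e^{iz(X + s - 2y)} η n(s)`, which oscillates in `y`. -/
theorem norm_sub_exp_le_of_transport {κ : ℝ} (hκ : 0 ≤ κ) {z : ℂ} {A B : ℝ → ℂ} {m n : ℝ → ℂ}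
    {C₀ : ℝ} (hmn : IsDiracSolution κ z m n)
    (hb : ∀ y, 0 < y → pairNorm (m y) (n y) ≤ C₀ * scale κ z y)
    (hC₀ : 0 ≤ C₀) (hAB : IsDiracSolution κ z A B) {η η' : ℂ} (hη : ‖η‖ = 1) (hη' : ‖η'‖ = 1)
    {s y X : ℝ} (hA : A y = η * n y) (hB : B y = η' * m y)
    (hs : 0 < s) (hzs : κ + 1 ≤ ‖z‖ * s) (hsy : s ≤ y) (hyX : y ≤ X) :
    ‖A X - Complex.exp (Complex.I * z * (X + s - 2 * y : ℝ)) * (η * n s)‖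
      ≤ 2 * (3 * Real.exp (2 * κ) * (κ + 1) ^ 2 * C₀ * (X / s ^ 2)) / ‖z‖ * scale κ z X := by
  have hy : 0 < y := hs.trans_le hsy
  have hX : 0 < X := hy.trans_le hyX
  have hz : z ≠ 0 := by rintro rfl; simp at hzs; linarith
  have hz' := norm_pos_iff.2 hz
  set D := 3 * Real.exp (2 * κ) * (κ + 1) ^ 2 with hD
  have hD0 : 0 ≤ D := by positivity
  have e1 := hAB.norm_sub_exp_le hκ hy (hzs.trans (by gcongr)) hyX
  have e2 := hmn.swap.norm_sub_exp_le hκ hs (by rwa [norm_neg]) hsy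
  have h1 : pairNorm (A y) (B y) = pairNorm (m y) (n y) := by
    refine (sq_eq_sq₀ (pairNorm_nonneg _ _) (pairNorm_nonneg _ _)).1 ?_
    rw [pairNorm_sq, pairNorm_sq, hA, hB, norm_mul, norm_mul, hη, hη']
    ring
  have hexp : Complex.exp (Complex.I * z * (X + s - 2 * y : ℝ))
      = Complex.exp (Complex.I * z * (X - y : ℝ)) * Complex.exp (Complex.I * -z * (y - s : ℝ)) := by
    rw [← Complex.exp_add]; congr 1; push_cast; ring
  have h2 : A X - Complex.exp (Complex.I * z * (X + s - 2 * y : ℝ)) * (η * n s)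
      = (A X - Complex.exp (Complex.I * z * (X - y : ℝ)) * A y)
        + Complex.exp (Complex.I * z * (X - y : ℝ)) * η
          * (n y - Complex.exp (Complex.I * -z * (y - s : ℝ)) * n s) := by
    rw [hexp, hA]; ring
  rw [← hD, h1] at e1
  rw [← hD, norm_neg, Complex.neg_im, abs_neg, pairNorm_comm] at e2
  have b1 : ‖A X - Complex.exp (Complex.I * z * (X - y : ℝ)) * A y‖
      ≤ D * C₀ * (X / s ^ 2) / ‖z‖ * scale κ z X := by
    refine e1.trans ?_
    calc D * (X / y ^ 2) / ‖z‖ * Real.exp (|z.im| * (X - y)) * pairNorm (m y) (n y)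
        ≤ D * (X / s ^ 2) / ‖z‖ * Real.exp (|z.im| * (X - y)) *
          (C₀ * (growth κ z X * Real.exp (|z.im| * y))) := by
          have := growth_mono hκ z hy hyX
          have hp := pairNorm_nonneg (m y) (n y)
          have := (hb y hy).trans (mul_le_mul_of_nonneg_left
            (mul_le_mul_of_nonneg_right this (Real.exp_pos _).le) hC₀)
          gcongr
      _ = _ := by
          rw [scale, show |z.im| * X = |z.im| * (X - y) + |z.im| * y by ring, Real.exp_add]
          ring
  have b2 : ‖Complex.exp (Complex.I * z * (X - y : ℝ)) * η
      * (n y - Complex.exp (Complex.I * -z * (y - s : ℝ)) * n s)‖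
      ≤ D * C₀ * (X / s ^ 2) / ‖z‖ * scale κ z X := by
    rw [norm_mul, norm_mul, hη, mul_one]
    calc _ ≤ Real.exp (|z.im| * (X - y)) * (D * (X / s ^ 2) / ‖z‖ * Real.exp (|z.im| * (y - s)) *
          (C₀ * (growth κ z X * Real.exp (|z.im| * s)))) := by
          have h3 := growth_mono hκ z hs (hsy.trans hyX)
          have h4 := (hb s hs).trans (mul_le_mul_of_nonneg_left
            (mul_le_mul_of_nonneg_right h3 (Real.exp_pos _).le) hC₀)
          have hp := pairNorm_nonneg (m s) (n s)
          refine mul_le_mul (norm_exp_I_mul_le z (abs_of_nonneg (sub_nonneg.2 hyX)).le)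
            (e2.trans ?_) (norm_nonneg _) (Real.exp_pos _).le
          gcongr
      _ = _ := by
          rw [scale, show |z.im| * X = |z.im| * (X - y) + |z.im| * (y - s) + |z.im| * s by ring,
            Real.exp_add, Real.exp_add]
          ring
  rw [h2]
  refine (norm_add_le _ _).trans ((add_le_add b1 b2).trans_eq ?_)
  ring

/-- The oscillation estimate behind the Riemann-Lebesgue argument. -/
theorem norm_integral_transport_le {κ : ℝ} (hκ : 0 ≤ κ) {z : ℂ} {A B : ℝ → ℝ → ℂ} {m n : ℝ → ℂ}
    {C₀ : ℝ} (hmn : IsDiracSolution κ z m n)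
    (hb : ∀ y, 0 < y → pairNorm (m y) (n y) ≤ C₀ * scale κ z y)
    (hC₀ : 0 ≤ C₀) (hAB : ∀ y, IsDiracSolution κ z (A y) (B y)) {η η' : ℂ} (hη : ‖η‖ = 1)
    (hη' : ‖η'‖ = 1) (hA : ∀ y, 0 < y → A y y = η * n y) (hB : ∀ y, 0 < y → B y y = η' * m y)
    {X : ℝ} (hcont : ContinuousOn (fun y => A y X) (Ioi 0))
    {s a : ℝ} (hs : 0 < s) (hzs : κ + 1 ≤ ‖z‖ * s) (hsa : s ≤ a) (haX : a ≤ X) :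
    ‖∫ y in s..a, A y X‖
      ≤ (2 * (3 * Real.exp (2 * κ) * (κ + 1) ^ 2 * C₀ * (X / s ^ 2)) * X + C₀) / ‖z‖
        * scale κ z X := by
  have hX : 0 < X := hs.trans_le (hsa.trans haX)
  have hz : z ≠ 0 := by rintro rfl; simp at hzs; linarith
  have hz' := norm_pos_iff.2 hz
  set E := 2 * (3 * Real.exp (2 * κ) * (κ + 1) ^ 2 * C₀ * (X / s ^ 2)) with hE
  have hE0 : 0 ≤ E := by positivity
  have hS := scale_pos hκ hz hX
  have hi1 : IntervalIntegrable (fun y => A y X) volume s a :=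
    (hcont.mono fun y hy => by
      rw [uIcc_of_le hsa] at hy; exact hs.trans_le hy.1).intervalIntegrable
  have hi2 : IntervalIntegrable
      (fun y : ℝ => Complex.exp (Complex.I * z * (X + s - 2 * y : ℝ)) * (η * n s)) volume s a :=
    Continuous.intervalIntegrable (by fun_prop) _ _
  have h1 : ‖(∫ y in s..a, A y X)
      - ∫ y in s..a, Complex.exp (Complex.I * z * (X + s - 2 * y : ℝ)) * (η * n s)‖
      ≤ E / ‖z‖ * scale κ z X * |a - s| := by
    rw [← intervalIntegral.integral_sub hi1 hi2]
    refine intervalIntegral.norm_integral_le_of_norm_le_const fun y hy => ?_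
    rw [uIoc_of_le hsa] at hy
    exact norm_sub_exp_le_of_transport hκ hmn hb hC₀ (hAB y) hη hη' (hA y (hs.trans hy.1))
      (hB y (hs.trans hy.1)) hs hzs hy.1.le (hy.2.trans haX)
  have h2 : ‖∫ y in s..a, Complex.exp (Complex.I * z * (X + s - 2 * y : ℝ)) * (η * n s)‖
      ≤ C₀ / ‖z‖ * scale κ z X := by
    rw [intervalIntegral.integral_mul_const, norm_mul, norm_mul, hη, one_mul]
    calc _ ≤ Real.exp (|z.im| * (X - s)) / ‖z‖ *
          (C₀ * (growth κ z X * Real.exp (|z.im| * s))) := by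
          have h3 := growth_mono hκ z hs (hsa.trans haX)
          have h4 := (hb s hs).trans (mul_le_mul_of_nonneg_left
            (mul_le_mul_of_nonneg_right h3 (Real.exp_pos _).le) hC₀)
          exact mul_le_mul (norm_integral_exp_le hz hsa haX)
            ((norm_le_pairNorm_right _ _).trans h4) (norm_nonneg _) (by positivity)
      _ = _ := by
          rw [scale, show |z.im| * X = |z.im| * (X - s) + |z.im| * s by ring, Real.exp_add]
          ring
  have h5 : |a - s| ≤ X := by rw [abs_of_nonneg (by linarith)]; linarith
  calc ‖∫ y in s..a, A y X‖ = ‖((∫ y in s..a, A y X)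
      - ∫ y in s..a, Complex.exp (Complex.I * z * (X + s - 2 * y : ℝ)) * (η * n s))
      + ∫ y in s..a, Complex.exp (Complex.I * z * (X + s - 2 * y : ℝ)) * (η * n s)‖ := by
        rw [sub_add_cancel]
    _ ≤ E / ‖z‖ * scale κ z X * X + C₀ / ‖z‖ * scale κ z X :=
        (norm_add_le _ _).trans (add_le_add (h1.trans (by gcongr)) h2)
    _ = _ := by ring

/-- The Riemann-Lebesgue lemma for functions of `z` that oscillate only on `(s, X]` with `s` of the
order `1/|z|` or larger: near `0`, their boundedness is enough. -/
theorem tendsto_integral_mul_of_oscillation {f : ℂ → ℝ → ℂ} {X M c : ℝ} {C : ℝ → ℝ}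
    (hcont : ∀ z ≠ 0, ContinuousOn (f z) (Ioi 0))
    (hM : ∀ z ≠ 0, ∀ y ∈ Ioc 0 X, ‖f z y‖ ≤ M)
    (hosc : ∀ s a, 0 < s → s ≤ a → a ≤ X → ∀ z ≠ 0, c ≤ ‖z‖ * s →
      ‖∫ y in s..a, f z y‖ ≤ C s / ‖z‖)
    {m : ℝ → ℂ} (hm : IntegrableOn m (Ioc 0 X)) :
    Tendsto (fun z => ∫ y in Ioc 0 X, m y * f z y) (Bornology.cobounded ℂ) (𝓝 0) := by
  have hne : ∀ᶠ z in Bornology.cobounded ℂ, z ≠ (0 : ℂ) := by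
    filter_upwards [(tendsto_norm_cobounded_atTop (E := ℂ)).eventually_gt_atTop 0] with z hz
    exact norm_pos_iff.1 hz
  have hint : ∀ z ≠ 0, IntegrableOn (f z) (Ioc 0 X) := fun z hz =>
    IntegrableOn.of_bound measure_Ioc_lt_top
      (((hcont z hz).mono Ioc_subset_Ioi_self).aestronglyMeasurable measurableSet_Ioc) M
      (by filter_upwards [ae_restrict_mem measurableSet_Ioc] with y hy using hM z hz y hy)
  refine tendsto_integral_mul_of_tendsto_primitive (M := M) (hne.mono hint) (hne.mono hM) ?_ hm
  intro a ha
  rw [Metric.tendsto_nhds]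
  intro ε hε
  set s := min a (ε / 2 / (|M| + 1)) with hs
  have hs0 : 0 < s := lt_min ha.1 (by positivity)
  have hn := tendsto_norm_cobounded_atTop (E := ℂ)
  filter_upwards [hne, hn.eventually_ge_atTop (c / s),
    hn.eventually_gt_atTop (2 * |C s| / ε)] with z hz h1 h2
  have hz' := norm_pos_iff.2 hz
  rw [div_le_iff₀ hs0] at h1
  rw [div_lt_iff₀ hε] at h2
  have h3 := hosc s a hs0 (min_le_left _ _) ha.2 z hz h1
  have h4 : ‖∫ y in Ioc 0 s, f z y‖ ≤ M * volume.real (Ioc 0 s) := by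
    refine norm_setIntegral_le_of_norm_le_const measure_Ioc_lt_top fun y hy => ?_
    exact hM z hz y ⟨hy.1, hy.2.trans ((min_le_left _ _).trans ha.2)⟩
  rw [Real.volume_real_Ioc_of_le hs0.le, sub_zero] at h4
  have h5 : M * s ≤ ε / 2 := by
    calc M * s ≤ (|M| + 1) * (ε / 2 / (|M| + 1)) := by
          refine mul_le_mul ((le_abs_self M).trans (by linarith)) (min_le_right _ _) hs0.le
            (by positivity)
      _ = ε / 2 := by field_simp
  have h6 : C s / ‖z‖ < ε / 2 := by
    rw [div_lt_iff₀ hz']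
    linarith [le_abs_self (C s)]
  have h7 : ∫ y in Ioc 0 a, f z y = (∫ y in Ioc 0 s, f z y) + ∫ y in s..a, f z y := by
    rw [intervalIntegral.integral_of_le (min_le_left _ _),
      ← Ioc_union_Ioc_eq_Ioc hs0.le (min_le_left _ _)]
    exact setIntegral_union (Ioc_disjoint_Ioc_of_le le_rfl) measurableSet_Ioc
      ((hint z hz).mono_set (Ioc_subset_Ioc le_rfl ((min_le_left _ _).trans ha.2)))
      ((hint z hz).mono_set (Ioc_subset_Ioc hs0.le ha.2))
  rw [dist_zero_right, h7]
  exact (norm_add_le _ _).trans_lt (by linarith)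

/-! ### The perturbation terms of the integral equation -/

/-- `coordPlus` as a continuous linear map. -/
noncomputable def coordPlusCLM : (Fin 2 → ℂ) →L[ℂ] ℂ :=
  ContinuousLinearMap.proj 1 + Complex.I • ContinuousLinearMap.proj 0

/-- `coordMinus` as a continuous linear map. -/
noncomputable def coordMinusCLM : (Fin 2 → ℂ) →L[ℂ] ℂ :=
  ContinuousLinearMap.proj 1 - Complex.I • ContinuousLinearMap.proj 0

theorem coordPlusCLM_apply (v : Fin 2 → ℂ) : coordPlusCLM v = coordPlus v := by
  simp [coordPlusCLM, coordPlus]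

theorem coordMinusCLM_apply (v : Fin 2 → ℂ) : coordMinusCLM v = coordMinus v := by
  simp [coordMinusCLM, coordMinus]

/-- The Euclidean norm of the pair of coordinates `(coordPlus v, coordMinus v)`, which is `√2` times
the Euclidean norm of `v`. -/
noncomputable def coordNorm (v : Fin 2 → ℂ) : ℝ := pairNorm (coordPlus v) (coordMinus v)

theorem coordNorm_nonneg (v : Fin 2 → ℂ) : 0 ≤ coordNorm v := pairNorm_nonneg _ _

theorem norm_toLp_le_coordNorm (v : Fin 2 → ℂ) : ‖WithLp.toLp 2 v‖ ≤ coordNorm v := by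
  refine (abs_le_of_sq_le_sq' ?_ (coordNorm_nonneg v)).2
  rw [coordNorm, pairNorm_sq, EuclideanSpace.norm_sq_eq, Fin.sum_univ_two]
  have h := parallelogram_law_with_norm ℝ (v 1) (Complex.I * v 0)
  simp only [norm_mul, Complex.norm_I, one_mul] at h
  simp only [coordPlus, coordMinus]
  nlinarith [sq_nonneg ‖v 0‖, sq_nonneg ‖v 1‖]

theorem coordNorm_add_le (v w : Fin 2 → ℂ) : coordNorm (v + w) ≤ coordNorm v + coordNorm w := by
  simp only [coordNorm, ← coordPlusCLM_apply, ← coordMinusCLM_apply, map_add]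
  exact pairNorm_add_le _ _ _ _

theorem coordNorm_neg (v : Fin 2 → ℂ) : coordNorm (-v) = coordNorm v := by
  have h := pairNorm_mul (-1) (coordPlus v) (coordMinus v)
  simp only [neg_mul, one_mul, norm_neg, norm_one] at h
  simpa only [coordNorm, ← coordPlusCLM_apply, ← coordMinusCLM_apply, map_neg] using h

theorem coordNorm_le (v : Fin 2 → ℂ) : coordNorm v ≤ 4 * ‖v‖ := by
  have h0 := norm_le_pi_norm v 0
  have h1 := norm_le_pi_norm v 1
  have h2 : ‖Complex.I * v 0‖ ≤ ‖v‖ := by simpa using h0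
  refine (pairNorm_le_add _ _).trans ?_
  have h3 := norm_add_le (v 1) (Complex.I * v 0)
  have h4 := norm_sub_le (v 1) (Complex.I * v 0)
  simp only [coordPlus, coordMinus]
  linarith

theorem continuous_coordNorm : Continuous coordNorm := by
  have : coordNorm = fun v => √(‖coordPlusCLM v‖ ^ 2 + ‖coordMinusCLM v‖ ^ 2) := by
    funext v
    rw [coordPlusCLM_apply, coordMinusCLM_apply, ← pairNorm_sq, Real.sqrt_sq (pairNorm_nonneg _ _),
      coordNorm]
  rw [this]
  fun_prop

theorem coordNorm_freeSolution_le {κ : ℝ} (hκ : 0 ≤ κ) {z : ℂ} (hz : z ≠ 0) {x : ℝ} (hx : 0 < x) :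
    coordNorm (freeSolution κ z x) ≤ freeConst κ * scale κ z x :=
  (pairNorm_freeSolution_le hκ hz hx).trans_eq (mul_assoc _ _ _)

theorem coordNorm_diracKernel_le {κ : ℝ} (hκ : 0 ≤ κ) {z : ℂ} (hz : z ≠ 0) {y x : ℝ} (hy : 0 < y)
    (hyx : y ≤ x) (c : Fin 2 → ℂ) :
    coordNorm ((diracKernel κ z x y).mulVec c)
      ≤ 3 * Real.exp (2 * κ) * (scale κ z x / scale κ z y) * coordNorm c := by
  obtain ⟨h1, h2, -⟩ := diracKernel_isDiracSolution (κ := κ) hz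
  have h3 := (h1 y c).pairNorm_le hκ hz hy hyx
  simp only [h2 y c hy] at h3
  have h4 : pairNorm (-Complex.I * coordPlus c) (Complex.I * coordMinus c) = coordNorm c := by
    rw [neg_mul, pairNorm_neg_left, pairNorm_mul, Complex.norm_I, one_mul, coordNorm]
  rw [h4] at h3
  refine h3.trans_eq ?_
  rw [scale, scale, mul_div_mul_comm, ← Real.exp_sub, mul_sub]
  ring

/-- A trace-free symmetric matrix interchanges the coordinates. -/
theorem coord_mulVec {p : Matrix (Fin 2) (Fin 2) ℝ} (h1 : p 1 1 = -p 0 0) (h2 : p 1 0 = p 0 1)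
    (v : Fin 2 → ℂ) :
    coordPlus ((p.map (fun r : ℝ => (r : ℂ))).mulVec v)
      = (-(p 0 0) + Complex.I * p 0 1) * coordMinus v ∧
    coordMinus ((p.map (fun r : ℝ => (r : ℂ))).mulVec v)
      = (-(p 0 0) - Complex.I * p 0 1) * coordPlus v := by
  simp only [coordPlus, coordMinus, Matrix.mulVec, dotProduct, Fin.sum_univ_two, Matrix.map_apply,
    h1, h2, Complex.ofReal_neg]
  constructor
  · linear_combination (p 0 1 * v 0 : ℂ) * Complex.I_sq
  · linear_combination (p 0 1 * v 0 : ℂ) * Complex.I_sq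

theorem coordNorm_mulVec_le {p : Matrix (Fin 2) (Fin 2) ℝ} (h1 : p 1 1 = -p 0 0)
    (h2 : p 1 0 = p 0 1) (v : Fin 2 → ℂ) :
    coordNorm ((p.map (fun r : ℝ => (r : ℂ))).mulVec v) ≤ (|p 0 0| + |p 0 1|) * coordNorm v := by
  obtain ⟨e1, e2⟩ := coord_mulVec h1 h2 v
  have b1 : ‖(-(p 0 0 : ℂ) + Complex.I * p 0 1)‖ ≤ |p 0 0| + |p 0 1| := by
    refine (norm_add_le _ _).trans_eq ?_
    simp
  have b2 : ‖(-(p 0 0 : ℂ) - Complex.I * p 0 1)‖ ≤ |p 0 0| + |p 0 1| := by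
    refine (norm_sub_le _ _).trans_eq ?_
    simp
  refine (abs_le_of_sq_le_sq' ?_ (mul_nonneg (by positivity) (coordNorm_nonneg v))).2
  rw [mul_pow, coordNorm, coordNorm, pairNorm_sq, pairNorm_sq, e1, e2, norm_mul, norm_mul, mul_pow,
    mul_pow, mul_add, add_comm]
  gcongr

theorem continuousOn_freeSolution {κ : ℝ} {z : ℂ} (hz : z ≠ 0) :
    ContinuousOn (freeSolution κ z) (Ioi 0) := by
  have hx : ContinuousOn (fun x : ℝ => ((x ^ κ : ℝ) : ℂ)) (Ioi 0) :=
    Complex.continuous_ofReal.comp_continuousOn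
      (continuousOn_id.rpow_const fun x hx => Or.inl (ne_of_gt hx))
  have h1 := continuous_freeFst κ
  have h2 := continuous_freeSnd κ
  refine continuousOn_pi.2 fun i => ?_
  fin_cases i
  · exact (hx.mul (Continuous.continuousOn (s := Ioi 0) (f := fun x : ℝ => freeFst κ (z * x))
      (by fun_prop))).congr fun x hx => (freeSolution_eq hz hx).1
  · exact (hx.mul (Continuous.continuousOn (s := Ioi 0) (f := fun x : ℝ => freeSnd κ (z * x))
      (by fun_prop))).congr fun x hx => (freeSolution_eq hz hx).2

theorem continuousOn_diracKernel_mulVec {κ : ℝ} {z : ℂ} (hz : z ≠ 0) {X : ℝ} (hX : 0 < X)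
    {u : ℝ → Fin 2 → ℂ} {s : Set ℝ} (hs : s ⊆ Ioi 0) (hu : ContinuousOn u s) :
    ContinuousOn (fun y => (diracKernel κ z X y).mulVec (u y)) s := by
  obtain ⟨-, -, h3⟩ := diracKernel_isDiracSolution (κ := κ) hz
  refine continuousOn_pi.2 fun i => ?_
  simp only [Matrix.mulVec, dotProduct, Fin.sum_univ_two]
  exact (((h3 X hX i 0).mono hs).mul (continuousOn_pi.1 hu 0)).add
    (((h3 X hX i 1).mono hs).mul (continuousOn_pi.1 hu 1))

theorem coordNorm_eq_of_interchange {v w : Fin 2 → ℂ} {α β : ℂ} (hα : ‖α‖ = 1) (hβ : ‖β‖ = 1)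
    (hp : coordPlus w = α * coordMinus v) (hm : coordMinus w = β * coordPlus v) :
    coordNorm w = coordNorm v := by
  refine (sq_eq_sq₀ (pairNorm_nonneg _ _) (pairNorm_nonneg _ _)).1 ?_
  rw [pairNorm_sq, pairNorm_sq, hp, hm, norm_mul, norm_mul, hα, hβ]
  ring

theorem continuousOn_diracKernel_freeSolution {κ : ℝ} {X : ℝ} (hX : 0 < X)
    (σ : Matrix (Fin 2) (Fin 2) ℂ) {z : ℂ} (hz : z ≠ 0) :
    ContinuousOn (fun y => (diracKernel κ z X y).mulVec (σ.mulVec (freeSolution κ z y)))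
      (Ioi 0) := by
  refine continuousOn_diracKernel_mulVec hz hX subset_rfl ?_
  exact (Continuous.matrix_mulVec continuous_const continuous_id).comp_continuousOn
    (continuousOn_freeSolution hz)

theorem coordNorm_diracKernel_freeSolution_le {κ : ℝ} (hκ : 0 ≤ κ)
    {σ : Matrix (Fin 2) (Fin 2) ℂ} (hσ : ∀ v, coordNorm (σ.mulVec v) = coordNorm v)
    {z : ℂ} (hz : z ≠ 0) {X y : ℝ} (hy : y ∈ Ioc 0 X) :
    coordNorm ((diracKernel κ z X y).mulVec (σ.mulVec (freeSolution κ z y)))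
      ≤ 3 * Real.exp (2 * κ) * freeConst κ * scale κ z X := by
  have hS := scale_pos hκ hz hy.1
  have hS' := scale_pos hκ hz (hy.1.trans_le hy.2)
  refine (coordNorm_diracKernel_le hκ hz hy.1 hy.2 _).trans ?_
  rw [hσ]
  calc _ ≤ 3 * Real.exp (2 * κ) * (scale κ z X / scale κ z y) * (freeConst κ * scale κ z y) := by
        gcongr; exact coordNorm_freeSolution_le hκ hz hy.1
    _ = _ := by field_simp

theorem integrableOn_mul_diracKernel {κ : ℝ} (hκ : 0 ≤ κ) {X : ℝ} (hX : 0 < X)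
    {σ : Matrix (Fin 2) (Fin 2) ℂ} (hσ : ∀ v, coordNorm (σ.mulVec v) = coordNorm v)
    {z : ℂ} (hz : z ≠ 0) {L : (Fin 2 → ℂ) →L[ℂ] ℂ} (hL : ∀ v, ‖L v‖ ≤ coordNorm v)
    {m : ℝ → ℂ} (hm : IntegrableOn m (Ioc 0 X)) :
    IntegrableOn (fun y => m y * L ((diracKernel κ z X y).mulVec
      (σ.mulVec (freeSolution κ z y)))) (Ioc 0 X) := by
  refine hm.mul_bdd (c := 3 * Real.exp (2 * κ) * freeConst κ * scale κ z X) ?_ ?_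
  · exact ((L.continuous.comp_continuousOn
      (continuousOn_diracKernel_freeSolution hX σ hz)).mono
        Ioc_subset_Ioi_self).aestronglyMeasurable measurableSet_Ioc
  · filter_upwards [ae_restrict_mem measurableSet_Ioc] with y hy
    exact (hL _).trans (coordNorm_diracKernel_freeSolution_le hκ hσ hz hy)

/-- If the constant matrix `σ` interchanges the coordinates up to phases, then the free regular
solution, multiplied by `σ` and transported to `X`, tends to `0` weakly relative to its size. -/
theorem tendsto_integral_diracKernel {κ : ℝ} (hκ : 0 ≤ κ) {X : ℝ} (hX : 0 < X)
    {σ : Matrix (Fin 2) (Fin 2) ℂ} {α β : ℂ} (hα : ‖α‖ = 1) (hβ : ‖β‖ = 1)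
    (hp : ∀ v, coordPlus (σ.mulVec v) = α * coordMinus v)
    (hm : ∀ v, coordMinus (σ.mulVec v) = β * coordPlus v)
    {m : ℝ → ℂ} (hmi : IntegrableOn m (Ioc 0 X)) :
    Tendsto (fun z => (∫ y in Ioc 0 X, m y * coordPlus ((diracKernel κ z X y).mulVec
      (σ.mulVec (freeSolution κ z y)))) / scale κ z X) (Bornology.cobounded ℂ) (𝓝 0) ∧
    Tendsto (fun z => (∫ y in Ioc 0 X, m y * coordMinus ((diracKernel κ z X y).mulVec
      (σ.mulVec (freeSolution κ z y)))) / scale κ z X) (Bornology.cobounded ℂ) (𝓝 0) := by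
  have hcont := fun z (hz : z ≠ 0) => continuousOn_diracKernel_freeSolution (κ := κ) hX σ hz
  have hM := fun z (hz : z ≠ 0) y (hy : y ∈ Ioc 0 X) => coordNorm_diracKernel_freeSolution_le hκ
    (fun v => coordNorm_eq_of_interchange hα hβ (hp v) (hm v)) hz hy
  have hdiv : ∀ (g : ℝ → ℂ) (S : ℂ), ∫ y in Ioc 0 X, m y * (g y / S)
      = (∫ y in Ioc 0 X, m y * g y) / S := fun g S => by
    simp_rw [← mul_div_assoc]
    exact integral_div _ _
  have hnd : ∀ z ≠ 0, ∀ w : ℂ, ∀ C : ℝ, ‖w‖ ≤ C * scale κ z X → ‖w / scale κ z X‖ ≤ C := by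
    intro z hz w C h
    have hS := scale_pos hκ hz hX
    rwa [norm_div, Complex.norm_real, Real.norm_of_nonneg hS.le, div_le_iff₀ hS]
  constructor
  · have key := tendsto_integral_mul_of_oscillation (X := X) (c := κ + 1)
      (M := 3 * Real.exp (2 * κ) * freeConst κ)
      (C := fun s => 2 * (3 * Real.exp (2 * κ) * (κ + 1) ^ 2 * freeConst κ * (X / s ^ 2)) * X
        + freeConst κ)
      (f := fun z y => coordPlus ((diracKernel κ z X y).mulVec
        (σ.mulVec (freeSolution κ z y))) / scale κ z X) ?_ ?_ ?_ hmi
    · simpa only [hdiv] using key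
    · intro z hz
      simp only [← coordPlusCLM_apply]
      exact (coordPlusCLM.continuous.comp_continuousOn (hcont z hz)).div_const _
    · intro z hz y hy
      exact hnd z hz _ _ ((norm_le_pairNorm_left _ _).trans (hM z hz y hy))
    · intro s a hs hsa haX z hz hzs
      obtain ⟨h1, h2, -⟩ := diracKernel_isDiracSolution (κ := κ) hz
      rw [intervalIntegral.integral_div]
      refine hnd z hz _ _ ?_
      refine norm_integral_transport_le (η := -Complex.I * α) (η' := Complex.I * β) hκ
        (freeSolution_isDiracSolution hκ hz)
        (fun y hy => coordNorm_freeSolution_le hκ hz hy) (freeConst_nonneg κ)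
        (fun y => h1 y _) (by simp [hα]) (by simp [hβ]) (fun y hy => ?_) (fun y hy => ?_) ?_
        hs hzs hsa haX
      · rw [(h2 y _ hy).1, hp, mul_assoc]
      · rw [(h2 y _ hy).2, hm, mul_assoc]
      · simp only [← coordPlusCLM_apply]
        exact coordPlusCLM.continuous.comp_continuousOn (hcont z hz)
  · have key := tendsto_integral_mul_of_oscillation (X := X) (c := κ + 1)
      (M := 3 * Real.exp (2 * κ) * freeConst κ)
      (C := fun s => 2 * (3 * Real.exp (2 * κ) * (κ + 1) ^ 2 * freeConst κ * (X / s ^ 2)) * X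
        + freeConst κ)
      (f := fun z y => coordMinus ((diracKernel κ z X y).mulVec
        (σ.mulVec (freeSolution κ z y))) / scale κ z X) ?_ ?_ ?_ hmi
    · simpa only [hdiv] using key
    · intro z hz
      simp only [← coordMinusCLM_apply]
      exact (coordMinusCLM.continuous.comp_continuousOn (hcont z hz)).div_const _
    · intro z hz y hy
      exact hnd z hz _ _ ((norm_le_pairNorm_right _ _).trans (hM z hz y hy))
    · intro s a hs hsa haX z hz hzs
      obtain ⟨h1, h2, -⟩ := diracKernel_isDiracSolution (κ := κ) hz
      rw [intervalIntegral.integral_div]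
      refine hnd z hz _ _ ?_
      -- The reflection `z ↦ -z` interchanges the two coordinates.
      rw [← scale_neg, ← norm_neg z]
      refine norm_integral_transport_le (η := Complex.I * β) (η' := -Complex.I * α) hκ
        (freeSolution_isDiracSolution hκ hz).swap
        (fun y hy => ?_) (freeConst_nonneg κ)
        (fun y => (h1 y _).swap) (by simp [hβ]) (by simp [hα]) (fun y hy => ?_) (fun y hy => ?_) ?_
        hs (by rwa [norm_neg]) hsa haX
      · rw [pairNorm_comm, scale_neg]
        exact coordNorm_freeSolution_le hκ hz hy
      · rw [(h2 y _ hy).2, hm, mul_assoc]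
      · rw [(h2 y _ hy).1, hp, mul_assoc]
      · simp only [← coordMinusCLM_apply]
        exact coordMinusCLM.continuous.comp_continuousOn (hcont z hz)

/-! ### The perturbed regular solution is asymptotic to the free one -/

/-- The integrand of the Volterra equation. -/
noncomputable def volterraIntegrand (κ : ℝ) (P : ℝ → Matrix (Fin 2) (Fin 2) ℝ) (z : ℂ) (x : ℝ)
    (u : ℝ → Fin 2 → ℂ) (y : ℝ) : Fin 2 → ℂ :=
  (diracKernel κ z x y * (P y).map (fun r : ℝ => (r : ℂ))).mulVec (u y)

/-- The size of a trace-free symmetric matrix potential. -/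
def potentialNorm (P : ℝ → Matrix (Fin 2) (Fin 2) ℝ) (y : ℝ) : ℝ := |P y 0 0| + |P y 0 1|

theorem potentialNorm_nonneg (P : ℝ → Matrix (Fin 2) (Fin 2) ℝ) (y : ℝ) :
    0 ≤ potentialNorm P y := by unfold potentialNorm; positivity

theorem coordNorm_volterraIntegrand_le {κ : ℝ} (hκ : 0 ≤ κ)
    {P : ℝ → Matrix (Fin 2) (Fin 2) ℝ} {z : ℂ} (hz : z ≠ 0) (u : ℝ → Fin 2 → ℂ) {x y : ℝ}
    (hy : y ∈ Ioc 0 x) (h1 : P y 1 1 = -P y 0 0) (h2 : P y 1 0 = P y 0 1) :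
    coordNorm (volterraIntegrand κ P z x u y)
      ≤ 3 * Real.exp (2 * κ) * scale κ z x
        * (potentialNorm P y * (coordNorm (u y) / scale κ z y)) := by
  rw [volterraIntegrand, ← Matrix.mulVec_mulVec]
  have hS := scale_pos hκ hz hy.1
  have hS' := scale_pos hκ hz (hy.1.trans_le hy.2)
  refine (coordNorm_diracKernel_le hκ hz hy.1 hy.2 _).trans ?_
  calc _ ≤ 3 * Real.exp (2 * κ) * (scale κ z x / scale κ z y)
        * (potentialNorm P y * coordNorm (u y)) := by
        gcongr; exact coordNorm_mulVec_le h1 h2 _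
    _ = _ := by field_simp

theorem map_eq_pauli {p : Matrix (Fin 2) (Fin 2) ℝ} (h1 : p 1 1 = -p 0 0) (h2 : p 1 0 = p 0 1) :
    p.map (fun r : ℝ => (r : ℂ))
      = (p 0 0 : ℂ) • !![1, 0; 0, -1] + (p 0 1 : ℂ) • !![0, 1; 1, 0] := by
  ext i j
  fin_cases i <;> fin_cases j <;> simp [h1, h2]

theorem coord_pauli_diag (v : Fin 2 → ℂ) :
    coordPlus ((!![1, 0; 0, -1] : Matrix (Fin 2) (Fin 2) ℂ).mulVec v) = -1 * coordMinus v ∧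
    coordMinus ((!![1, 0; 0, -1] : Matrix (Fin 2) (Fin 2) ℂ).mulVec v) = -1 * coordPlus v := by
  constructor <;> simp [coordPlus, coordMinus, Matrix.mulVec, dotProduct, Fin.sum_univ_two] <;> ring

theorem coord_pauli_offDiag (v : Fin 2 → ℂ) :
    coordPlus ((!![0, 1; 1, 0] : Matrix (Fin 2) (Fin 2) ℂ).mulVec v)
      = Complex.I * coordMinus v ∧
    coordMinus ((!![0, 1; 1, 0] : Matrix (Fin 2) (Fin 2) ℂ).mulVec v)
      = -Complex.I * coordPlus v := by
  simp only [coordPlus, coordMinus, Matrix.mulVec, dotProduct, Fin.sum_univ_two]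
  constructor
  · simp
    linear_combination (v 0 : ℂ) * Complex.I_sq
  · simp
    linear_combination (v 0 : ℂ) * Complex.I_sq

theorem map_volterraIntegrand_freeSolution (L : (Fin 2 → ℂ) →L[ℂ] ℂ) (κ : ℝ)
    {P : ℝ → Matrix (Fin 2) (Fin 2) ℝ} (z : ℂ) (x : ℝ) {y : ℝ}
    (h1 : P y 1 1 = -P y 0 0) (h2 : P y 1 0 = P y 0 1) :
    L (volterraIntegrand κ P z x (freeSolution κ z) y)
      = (P y 0 0 : ℂ) * L ((diracKernel κ z x y).mulVec
          ((!![1, 0; 0, -1] : Matrix (Fin 2) (Fin 2) ℂ).mulVec (freeSolution κ z y)))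
        + (P y 0 1 : ℂ) * L ((diracKernel κ z x y).mulVec
          ((!![0, 1; 1, 0] : Matrix (Fin 2) (Fin 2) ℂ).mulVec (freeSolution κ z y))) := by
  rw [volterraIntegrand, ← Matrix.mulVec_mulVec, map_eq_pauli h1 h2, Matrix.add_mulVec,
    Matrix.smul_mulVec, Matrix.smul_mulVec, Matrix.mulVec_add, Matrix.mulVec_smul,
    Matrix.mulVec_smul, map_add, map_smul, map_smul, smul_eq_mul, smul_eq_mul]

section

variable {κ : ℝ} {X : ℝ} {P : ℝ → Matrix (Fin 2) (Fin 2) ℝ}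

theorem coordNorm_pauli_diag (v : Fin 2 → ℂ) :
    coordNorm ((!![1, 0; 0, -1] : Matrix (Fin 2) (Fin 2) ℂ).mulVec v) = coordNorm v :=
  coordNorm_eq_of_interchange (by simp) (by simp) (coord_pauli_diag v).1 (coord_pauli_diag v).2

theorem coordNorm_pauli_offDiag (v : Fin 2 → ℂ) :
    coordNorm ((!![0, 1; 1, 0] : Matrix (Fin 2) (Fin 2) ℂ).mulVec v) = coordNorm v :=
  coordNorm_eq_of_interchange (by simp) (by simp) (coord_pauli_offDiag v).1
    (coord_pauli_offDiag v).2

theorem integrableOn_volterraIntegrand_freeSolution (hκ : 0 ≤ κ) (hX : 0 < X)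
    (hP : ∀ᵐ y ∂(volume.restrict (Ioc 0 X)), P y 1 1 = -P y 0 0 ∧ P y 1 0 = P y 0 1)
    (hq : IntegrableOn (fun y => P y 0 0) (Ioc 0 X))
    (hr : IntegrableOn (fun y => P y 0 1) (Ioc 0 X))
    {z : ℂ} (hz : z ≠ 0) {L : (Fin 2 → ℂ) →L[ℂ] ℂ} (hL : ∀ v, ‖L v‖ ≤ coordNorm v) :
    IntegrableOn (fun y => L (volterraIntegrand κ P z X (freeSolution κ z) y)) (Ioc 0 X) := by
  refine Integrable.congr
    ((integrableOn_mul_diracKernel hκ hX coordNorm_pauli_diag hz hL hq.ofReal).add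
      (integrableOn_mul_diracKernel hκ hX coordNorm_pauli_offDiag hz hL hr.ofReal)) ?_
  filter_upwards [hP] with y hy
  exact (map_volterraIntegrand_freeSolution L κ z X hy.1 hy.2).symm

theorem tendsto_integral_volterraIntegrand_freeSolution (hκ : 0 ≤ κ) (hX : 0 < X)
    (hP : ∀ᵐ y ∂(volume.restrict (Ioc 0 X)), P y 1 1 = -P y 0 0 ∧ P y 1 0 = P y 0 1)
    (hq : IntegrableOn (fun y => P y 0 0) (Ioc 0 X))
    (hr : IntegrableOn (fun y => P y 0 1) (Ioc 0 X))
    {L : (Fin 2 → ℂ) →L[ℂ] ℂ} (hL : L = coordPlusCLM ∨ L = coordMinusCLM) :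
    Tendsto (fun z => (∫ y in Ioc 0 X, L (volterraIntegrand κ P z X (freeSolution κ z) y))
      / scale κ z X) (Bornology.cobounded ℂ) (𝓝 0) := by
  have hL' : ∀ v, ‖L v‖ ≤ coordNorm v := by
    rcases hL with rfl | rfl <;> intro v
    · rw [coordPlusCLM_apply]; exact norm_le_pairNorm_left _ _
    · rw [coordMinusCLM_apply]; exact norm_le_pairNorm_right _ _
  have t1 := tendsto_integral_diracKernel hκ hX (α := -1) (β := -1) (by simp) (by simp)
    (fun v => (coord_pauli_diag v).1) (fun v => (coord_pauli_diag v).2) hq.ofReal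
  have t2 := tendsto_integral_diracKernel hκ hX (α := Complex.I) (β := -Complex.I) (by simp)
    (by simp) (fun v => (coord_pauli_offDiag v).1) (fun v => (coord_pauli_offDiag v).2) hr.ofReal
  have t3 : Tendsto (fun z => (∫ y in Ioc 0 X, (P y 0 0 : ℂ) * L ((diracKernel κ z X y).mulVec
          ((!![1, 0; 0, -1] : Matrix (Fin 2) (Fin 2) ℂ).mulVec (freeSolution κ z y))))
            / scale κ z X
        + (∫ y in Ioc 0 X, (P y 0 1 : ℂ) * L ((diracKernel κ z X y).mulVec
          ((!![0, 1; 1, 0] : Matrix (Fin 2) (Fin 2) ℂ).mulVec (freeSolution κ z y))))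
            / scale κ z X) (Bornology.cobounded ℂ) (𝓝 0) := by
    rcases hL with rfl | rfl
    · simpa [coordPlusCLM_apply] using t1.1.add t2.1
    · simpa [coordMinusCLM_apply] using t1.2.add t2.2
  refine t3.congr' ?_
  filter_upwards [(tendsto_norm_cobounded_atTop (E := ℂ)).eventually_gt_atTop 0] with z hz
  have hz := norm_pos_iff.1 hz
  rw [← add_div]
  congr 1
  refine (integral_add
    (integrableOn_mul_diracKernel hκ hX coordNorm_pauli_diag hz hL' hq.ofReal)
    (integrableOn_mul_diracKernel hκ hX coordNorm_pauli_offDiag hz hL' hr.ofReal)).symm.trans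
    (integral_congr_ae ?_)
  filter_upwards [hP] with y hy
  exact (map_volterraIntegrand_freeSolution L κ z X hy.1 hy.2).symm

/-- The integral equation for the difference of the perturbed and the free regular solutions, in
one coordinate. -/
theorem norm_map_sub_le (hκ : 0 ≤ κ) (hX : 0 < X)
    (hP : ∀ᵐ y ∂(volume.restrict (Ioc 0 X)), P y 1 1 = -P y 0 0 ∧ P y 1 0 = P y 0 1)
    (hq : IntegrableOn (fun y => P y 0 0) (Ioc 0 X))
    (hr : IntegrableOn (fun y => P y 0 1) (Ioc 0 X))
    {z : ℂ} (hz : z ≠ 0) {L : (Fin 2 → ℂ) →L[ℂ] ℂ} (hL : ∀ v, ‖L v‖ ≤ coordNorm v)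
    {u : ℝ → Fin 2 → ℂ} (hu : IntegrableOn (volterraIntegrand κ P z X u) (Ioc 0 X))
    (heq : u X = freeSolution κ z X + ∫ y in Ioc 0 X, volterraIntegrand κ P z X u y)
    (hi : IntegrableOn (fun y => potentialNorm P y *
      (coordNorm (u y - freeSolution κ z y) / scale κ z y)) (Ioc 0 X)) :
    ‖L (u X - freeSolution κ z X)‖
      ≤ ‖∫ y in Ioc 0 X, L (volterraIntegrand κ P z X (freeSolution κ z) y)‖
        + 3 * Real.exp (2 * κ) * scale κ z X * ∫ y in Ioc 0 X, potentialNorm P y *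
          (coordNorm (u y - freeSolution κ z y) / scale κ z y) := by
  have hf := integrableOn_volterraIntegrand_freeSolution hκ hX hP hq hr hz hL
  have hLu : IntegrableOn (fun y => L (volterraIntegrand κ P z X u y)) (Ioc 0 X) :=
    L.integrable_comp hu
  have hsub : ∀ y, L (volterraIntegrand κ P z X (fun y => u y - freeSolution κ z y) y)
      = L (volterraIntegrand κ P z X u y) - L (volterraIntegrand κ P z X (freeSolution κ z) y) := by
    intro y
    simp only [volterraIntegrand, Matrix.mulVec_sub, map_sub]
  have h1 : L (u X - freeSolution κ z X)
      = (∫ y in Ioc 0 X, L (volterraIntegrand κ P z X (freeSolution κ z) y))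
        + ∫ y in Ioc 0 X, L (volterraIntegrand κ P z X (fun y => u y - freeSolution κ z y) y) := by
    simp only [hsub]
    rw [integral_sub hLu hf, add_sub_cancel, L.integral_comp_comm hu, heq, add_sub_cancel_left]
  rw [h1]
  refine (norm_add_le _ _).trans (add_le_add le_rfl ?_)
  rw [← integral_const_mul]
  refine norm_integral_le_of_norm_le (hi.const_mul _) ?_
  filter_upwards [hP, ae_restrict_mem measurableSet_Ioc] with y hy hyX
  exact (hL _).trans (coordNorm_volterraIntegrand_le hκ hz _ hyX hy.1 hy.2)

end

theorem continuousOn_coordNorm_div {κ : ℝ} (hκ : 0 ≤ κ) {X : ℝ} {z : ℂ} (hz : z ≠ 0)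
    {u : ℝ → Fin 2 → ℂ} (hu : ContinuousOn u (Ioc 0 X)) :
    ContinuousOn (fun y => coordNorm (u y - freeSolution κ z y) / scale κ z y) (Ioc 0 X) :=
  (continuous_coordNorm.comp_continuousOn
    (hu.sub ((continuousOn_freeSolution hz).mono Ioc_subset_Ioi_self))).div
    (continuous_scale hκ z).continuousOn fun _ hy => (scale_pos hκ hz hy.1).ne'

/-- For fixed `z`, the relative size of a function `O(x ^ κ)` is bounded. This makes the Gronwall
argument possible; the bound may depend on `z` in an arbitrary way. -/
theorem exists_coordNorm_div_le {κ : ℝ} (hκ : 0 ≤ κ) {X : ℝ} {z : ℂ} (hz : z ≠ 0)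
    {u : ℝ → Fin 2 → ℂ} (hu : ContinuousOn u (Ioc 0 X))
    (hreg : u =O[𝓝[>] 0] fun x : ℝ => x ^ κ) :
    ∃ M, ∀ y ∈ Ioc 0 X, coordNorm (u y - freeSolution κ z y) / scale κ z y ≤ M := by
  have hz' := norm_pos_iff.2 hz
  obtain ⟨C, hC⟩ := hreg.bound
  obtain ⟨δ, hδ, hδ2⟩ := mem_nhdsGT_iff_exists_Ioo_subset.1 hC
  rw [mem_Ioi] at hδ
  set δ' := min (δ / 2) ((κ + 1) / ‖z‖) with hδ'
  have hδ0 : 0 < δ' := lt_min (by linarith) (by positivity)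
  have hcont := (continuousOn_coordNorm_div hκ hz hu).mono
    (show Icc δ' X ⊆ Ioc 0 X from fun y hy => ⟨hδ0.trans_le hy.1, hy.2⟩)
  obtain ⟨M, hM⟩ := isCompact_Icc.exists_bound_of_continuousOn hcont
  refine ⟨max M (4 * C + freeConst κ), fun y hy => ?_⟩
  have hS := scale_pos hκ hz hy.1
  rcases le_total δ' y with h | h
  · exact ((le_abs_self _).trans (hM y ⟨h, hy.2⟩)).trans (le_max_left _ _)
  · refine le_trans ?_ (le_max_right _ _)
    have h1 : ‖u y‖ ≤ C * ‖y ^ κ‖ :=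
      hδ2 ⟨hy.1, (h.trans (min_le_left _ _)).trans_lt (by linarith)⟩
    have hyκ : 0 < y ^ κ := Real.rpow_pos_of_pos hy.1 κ
    rw [Real.norm_of_nonneg hyκ.le] at h1
    have h2 : y ^ κ ≤ scale κ z y := by
      rw [scale, growth, min_eq_left (h.trans (min_le_right _ _))]
      exact le_mul_of_one_le_right hyκ.le (Real.one_le_exp (by have := hy.1; positivity))
    have hC0 : 0 ≤ C := by
      by_contra hneg
      nlinarith [norm_nonneg (u y)]
    rw [div_le_iff₀ hS, sub_eq_add_neg]
    refine (coordNorm_add_le _ _).trans ?_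
    rw [coordNorm_neg]
    have h3 := coordNorm_freeSolution_le hκ hz hy.1
    have h4 := coordNorm_le (u y)
    nlinarith

/-- For large `|z|`, the perturbation is negligible relative to the size of the free solution. -/
theorem tendsto_coordNorm_sub_div {κ : ℝ} (hκ : 0 ≤ κ) {X : ℝ} (hX : 0 < X)
    {P : ℝ → Matrix (Fin 2) (Fin 2) ℝ}
    (hP : ∀ᵐ y ∂(volume.restrict (Ioc 0 X)), P y 1 1 = -P y 0 0 ∧ P y 1 0 = P y 0 1)
    (hq : IntegrableOn (fun y => P y 0 0) (Ioc 0 X))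
    (hr : IntegrableOn (fun y => P y 0 1) (Ioc 0 X))
    {u : ℂ → ℝ → Fin 2 → ℂ} (hcont : ∀ z ≠ 0, ContinuousOn (u z) (Ioc 0 X))
    (hreg : ∀ z ≠ 0, u z =O[𝓝[>] 0] fun x : ℝ => x ^ κ)
    (hint : ∀ z ≠ 0, ∀ x ∈ Ioc 0 X,
      IntegrableOn (volterraIntegrand κ P z x (u z)) (Ioc 0 x))
    (heq : ∀ z ≠ 0, ∀ x ∈ Ioc 0 X,
      u z x = freeSolution κ z x + ∫ y in Ioc 0 x, volterraIntegrand κ P z x (u z) y) :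
    Tendsto (fun z => coordNorm (u z X - freeSolution κ z X) / scale κ z X)
      (Bornology.cobounded ℂ) (𝓝 0) := by
  have : (Bornology.cobounded ℂ).IsCountablyGenerated := by
    rw [← comap_norm_atTop]; infer_instance
  have hne : ∀ᶠ z in Bornology.cobounded ℂ, z ≠ (0 : ℂ) := by
    filter_upwards [(tendsto_norm_cobounded_atTop (E := ℂ)).eventually_gt_atTop 0] with z hz
    exact norm_pos_iff.1 hz
  have hρ : IntegrableOn (potentialNorm P) (Ioc 0 X) := hq.abs.add hr.abs
  have hLp : ∀ v, ‖coordPlusCLM v‖ ≤ coordNorm v := fun v => by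
    rw [coordPlusCLM_apply]; exact norm_le_pairNorm_left _ _
  have hLm : ∀ v, ‖coordMinusCLM v‖ ≤ coordNorm v := fun v => by
    rw [coordMinusCLM_apply]; exact norm_le_pairNorm_right _ _
  set K := 3 * Real.exp (2 * κ) with hK
  have hK0 : 0 ≤ K := by positivity
  -- The absolute values only matter for `y ≤ 0`.
  set e : ℂ → ℝ → ℝ := fun z y => |coordNorm (u z y - freeSolution κ z y) / scale κ z y| with he
  set J : ((Fin 2 → ℂ) →L[ℂ] ℂ) → ℂ → ℝ → ℂ := fun L z x =>
    (∫ y in Ioc 0 x, L (volterraIntegrand κ P z x (freeSolution κ z) y)) / scale κ z x with hJ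
  have hepos : ∀ z ≠ 0, ∀ y ∈ Ioc 0 X,
      e z y = coordNorm (u z y - freeSolution κ z y) / scale κ z y := fun z hz y hy =>
    abs_of_nonneg (div_nonneg (coordNorm_nonneg _) (scale_pos hκ hz hy.1).le)
  have hei : ∀ z ≠ 0, IntegrableOn (fun y => potentialNorm P y *
      (coordNorm (u z y - freeSolution κ z y) / scale κ z y)) (Ioc 0 X) := by
    intro z hz
    obtain ⟨M, hM⟩ := exists_coordNorm_div_le hκ hz (hcont z hz) (hreg z hz)
    refine hρ.mul_bdd (c := M) ((continuousOn_coordNorm_div hκ hz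
      (hcont z hz)).aestronglyMeasurable measurableSet_Ioc) ?_
    filter_upwards [ae_restrict_mem measurableSet_Ioc] with y hy
    rw [Real.norm_of_nonneg (div_nonneg (coordNorm_nonneg _) (scale_pos hκ hz hy.1).le)]
    exact hM y hy
  have hcongr : ∀ z ≠ 0, ∀ x ∈ Ioc 0 X, ∫ y in Ioc 0 x, potentialNorm P y * e z y
      = ∫ y in Ioc 0 x, potentialNorm P y *
        (coordNorm (u z y - freeSolution κ z y) / scale κ z y) := fun z hz x hx =>
    setIntegral_congr_fun measurableSet_Ioc fun y hy => by
      rw [hepos z hz y ⟨hy.1, hy.2.trans hx.2⟩]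
  have hmain : Tendsto (fun z => e z X) (Bornology.cobounded ℂ) (𝓝 0) := by
    refine tendsto_zero_of_integral_inequality (C := 2 * K)
      (M := 2 * (K * freeConst κ * ∫ y in Ioc 0 X, potentialNorm P y))
      (d := fun z x => ‖J coordPlusCLM z x‖ + ‖J coordMinusCLM z x‖)
      hX (by positivity) (potentialNorm_nonneg P) hρ (fun _ _ => abs_nonneg _)
      (fun _ _ => by positivity) ?_ ?_ ?_ ?_ ?_
    · filter_upwards [hne] with z hz
      exact ((continuousOn_coordNorm_div hκ hz (hcont z hz)).abs).aestronglyMeasurable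
        measurableSet_Ioc
    · filter_upwards [hne] with z hz
      refine (hei z hz).congr ?_
      filter_upwards [ae_restrict_mem measurableSet_Ioc] with y hy
      rw [hepos z hz y hy]
    · filter_upwards [hne] with z hz x hx
      have hsub : Ioc 0 x ⊆ Ioc 0 X := Ioc_subset_Ioc le_rfl hx.2
      have hS := scale_pos hκ hz hx.1
      have hPx := ae_restrict_of_ae_restrict_of_subset hsub hP
      have b1 := norm_map_sub_le hκ hx.1 hPx (hq.mono_set hsub) (hr.mono_set hsub) hz hLp
        (hint z hz x hx) (heq z hz x hx) ((hei z hz).mono_set hsub)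
      have b2 := norm_map_sub_le hκ hx.1 hPx (hq.mono_set hsub) (hr.mono_set hsub) hz hLm
        (hint z hz x hx) (heq z hz x hx) ((hei z hz).mono_set hsub)
      rw [hepos z hz x hx, hcongr z hz x hx, div_le_iff₀ hS]
      have b3 := pairNorm_le_add (coordPlus (u z x - freeSolution κ z x))
        (coordMinus (u z x - freeSolution κ z x))
      rw [← coordPlusCLM_apply, ← coordMinusCLM_apply] at b3
      have hJn : ∀ L, ‖J L z x‖ * scale κ z x
          = ‖∫ y in Ioc 0 x, L (volterraIntegrand κ P z x (freeSolution κ z) y)‖ := by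
        intro L
        rw [hJ]
        dsimp only
        rw [norm_div, Complex.norm_real, Real.norm_of_nonneg hS.le, div_mul_cancel₀ _ hS.ne']
      rw [add_mul, add_mul, hJn, hJn]
      rw [coordNorm, ← coordPlusCLM_apply, ← coordMinusCLM_apply]
      linarith
    · filter_upwards [hne] with z hz x hx
      have hsub : Ioc 0 x ⊆ Ioc 0 X := Ioc_subset_Ioc le_rfl hx.2
      have hS := scale_pos hκ hz hx.1
      have hbd : ∀ L : (Fin 2 → ℂ) →L[ℂ] ℂ, (∀ v, ‖L v‖ ≤ coordNorm v) →
          ‖J L z x‖ ≤ K * freeConst κ * ∫ y in Ioc 0 X, potentialNorm P y := by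
        intro L hL
        have h1 : ‖∫ y in Ioc 0 x, L (volterraIntegrand κ P z x (freeSolution κ z) y)‖
            ≤ ∫ y in Ioc 0 x, K * scale κ z x * (potentialNorm P y * freeConst κ) := by
          refine norm_integral_le_of_norm_le (((hρ.mono_set hsub).mul_const _).const_mul _) ?_
          filter_upwards [ae_restrict_of_ae_restrict_of_subset hsub hP,
            ae_restrict_mem measurableSet_Ioc] with y hy hyx
          refine ((hL _).trans (coordNorm_volterraIntegrand_le hκ hz _ hyx hy.1 hy.2)).trans ?_
          have h2 := potentialNorm_nonneg P y
          have h3 : coordNorm (freeSolution κ z y) / scale κ z y ≤ freeConst κ := by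
            rw [div_le_iff₀ (scale_pos hκ hz hyx.1)]
            exact coordNorm_freeSolution_le hκ hz hyx.1
          gcongr
        rw [integral_const_mul, integral_mul_const] at h1
        have h4 : ∫ y in Ioc 0 x, potentialNorm P y ≤ ∫ y in Ioc 0 X, potentialNorm P y :=
          setIntegral_mono_set hρ (Eventually.of_forall (potentialNorm_nonneg P))
            hsub.eventuallyLE
        rw [hJ]
        dsimp only
        rw [norm_div, Complex.norm_real, Real.norm_of_nonneg hS.le, div_le_iff₀ hS]
        have h5 := freeConst_nonneg κ
        calc _ ≤ _ := h1
          _ ≤ K * scale κ z x * ((∫ y in Ioc 0 X, potentialNorm P y) * freeConst κ) := by gcongr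
          _ = _ := by ring
      linarith [hbd _ hLp, hbd _ hLm]
    · intro x hx
      have hsub : Ioc 0 x ⊆ Ioc 0 X := Ioc_subset_Ioc le_rfl hx.2
      have hPx := ae_restrict_of_ae_restrict_of_subset hsub hP
      have t1 := tendsto_integral_volterraIntegrand_freeSolution hκ hx.1 hPx (hq.mono_set hsub)
        (hr.mono_set hsub) (Or.inl rfl)
      have t2 := tendsto_integral_volterraIntegrand_freeSolution hκ hx.1 hPx (hq.mono_set hsub)
        (hr.mono_set hsub) (Or.inr rfl)
      have t3 := t1.norm.add t2.norm
      rw [norm_zero, add_zero] at t3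
      exact t3
  refine hmain.congr' ?_
  filter_upwards [hne] with z hz
  exact hepos z hz X ⟨hX, le_rfl⟩

/-! ### The free solution in sectors -/

/-- The leading term of the asymptotics of the regular solution. -/
noncomputable def wave (κ x : ℝ) (z : ℂ) : Fin 2 → ℂ :=
  z ^ (-(κ : ℂ)) • ![Complex.sin (z * x - κ * Real.pi / 2), Complex.cos (z * x - κ * Real.pi / 2)]

theorem coordPlus_wave (κ x : ℝ) (z : ℂ) : coordPlus (wave κ x z)
    = z ^ (-(κ : ℂ)) * Complex.exp (Complex.I * (z * x - κ * Real.pi / 2)) := by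
  rw [mul_comm Complex.I, Complex.exp_mul_I]
  simp [coordPlus, wave]
  ring

theorem coordMinus_wave (κ x : ℝ) (z : ℂ) : coordMinus (wave κ x z)
    = z ^ (-(κ : ℂ)) * Complex.exp (-(Complex.I * (z * x - κ * Real.pi / 2))) := by
  rw [mul_comm Complex.I, ← neg_mul, Complex.exp_mul_I, Complex.cos_neg, Complex.sin_neg]
  simp [coordMinus, wave]
  ring

theorem norm_exp_phase (κ x : ℝ) (z : ℂ) :
    ‖Complex.exp (Complex.I * (z * x - κ * Real.pi / 2))‖ = Real.exp (-(z.im * x)) := by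
  rw [Complex.norm_exp]
  congr 1
  have : (κ : ℂ) * Real.pi / 2 = ((κ * Real.pi / 2 : ℝ) : ℂ) := by push_cast; rfl
  rw [this]
  simp

theorem norm_exp_neg_phase (κ x : ℝ) (z : ℂ) :
    ‖Complex.exp (-(Complex.I * (z * x - κ * Real.pi / 2)))‖ = Real.exp (z.im * x) := by
  rw [Complex.exp_neg, norm_inv, norm_exp_phase, ← Real.exp_neg, neg_neg]

theorem norm_cpow_neg_ofReal (κ : ℝ) (z : ℂ) : ‖z ^ (-(κ : ℂ))‖ = ‖z‖ ^ (-κ) := by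
  rw [← Complex.ofReal_neg, Complex.norm_cpow_real]

/-- The size of the regular solution for large `|z|`. -/
noncomputable def waveSize (κ x : ℝ) (z : ℂ) : ℝ := ‖z‖ ^ (-κ) * Real.exp (|z.im| * x)

theorem waveSize_nonneg (κ x : ℝ) (z : ℂ) : 0 ≤ waveSize κ x z := by unfold waveSize; positivity

theorem waveSize_neg (κ x : ℝ) (z : ℂ) : waveSize κ x (-z) = waveSize κ x z := by simp [waveSize]

theorem waveSize_le_coordNorm (κ x : ℝ) (z : ℂ) :
    waveSize κ x z ≤ coordNorm (wave κ x z) := by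
  have h1 := norm_le_pairNorm_left (coordPlus (wave κ x z)) (coordMinus (wave κ x z))
  have h2 := norm_le_pairNorm_right (coordPlus (wave κ x z)) (coordMinus (wave κ x z))
  rw [coordPlus_wave, norm_mul, norm_exp_phase, norm_cpow_neg_ofReal, ← coordPlus_wave] at h1
  rw [coordMinus_wave, norm_mul, norm_exp_neg_phase, norm_cpow_neg_ofReal,
    ← coordMinus_wave] at h2
  unfold waveSize
  rcases abs_cases z.im with ⟨h, _⟩ | ⟨h, _⟩ <;> rw [h]
  · exact h2
  · rw [neg_mul]; exact h1

theorem coordNorm_le_two_mul (v : Fin 2 → ℂ) : coordNorm v ≤ 2 * ‖WithLp.toLp 2 v‖ := by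
  refine (abs_le_of_sq_le_sq' ?_ (by positivity)).2
  rw [coordNorm, pairNorm_sq, mul_pow, EuclideanSpace.norm_sq_eq, Fin.sum_univ_two]
  have h := parallelogram_law_with_norm ℝ (v 1) (Complex.I * v 0)
  simp only [norm_mul, Complex.norm_I, one_mul] at h
  simp only [coordPlus, coordMinus]
  nlinarith [sq_nonneg ‖v 0‖, sq_nonneg ‖v 1‖]

theorem cpow_neg_mul_cpow_mul_ofReal (κ : ℝ) {z : ℂ} (hz : z ≠ 0) {x : ℝ} (hx : 0 < x) :
    z ^ (-(κ : ℂ)) * (z * x) ^ (κ : ℂ) = ((x ^ κ : ℝ) : ℂ) := by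
  have hx' : (x : ℂ) ≠ 0 := by exact_mod_cast hx.ne'
  rw [Complex.cpow_def_of_ne_zero hz, Complex.cpow_def_of_ne_zero (mul_ne_zero hz hx'),
    Complex.log_mul_ofReal x hx z hz, ← Complex.exp_add, Complex.ofReal_cpow hx.le,
    Complex.cpow_def_of_ne_zero hx', Complex.ofReal_log hx.le]
  congr 1
  ring

/-- The change of branch of `z ^ (-κ)` under `z ↦ -z`, in the upper half plane. -/
theorem cpow_neg_neg_of_im_pos (κ : ℝ) {z : ℂ} (hz : 0 < z.im) :
    (-z) ^ (-(κ : ℂ)) = z ^ (-(κ : ℂ)) * Complex.exp (Complex.I * (κ * Real.pi)) := by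
  have h0 : z ≠ 0 := by rintro rfl; simp at hz
  rw [Complex.cpow_def_of_ne_zero (neg_ne_zero.2 h0), Complex.cpow_def_of_ne_zero h0,
    ← Complex.exp_add, Complex.log, Complex.log, Complex.arg_neg_eq_arg_sub_pi_of_im_pos hz,
    norm_neg]
  congr 1
  push_cast
  ring

theorem cpow_neg_neg_of_im_neg (κ : ℝ) {z : ℂ} (hz : z.im < 0) :
    (-z) ^ (-(κ : ℂ)) = z ^ (-(κ : ℂ)) * Complex.exp (-(Complex.I * (κ * Real.pi))) := by
  have h0 : z ≠ 0 := by rintro rfl; simp at hz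
  rw [Complex.cpow_def_of_ne_zero (neg_ne_zero.2 h0), Complex.cpow_def_of_ne_zero h0,
    ← Complex.exp_add, Complex.log, Complex.log, Complex.arg_neg_eq_arg_add_pi_of_im_neg hz,
    norm_neg]
  congr 1
  push_cast
  ring

/-- Parity of the free solution in `z`. -/
theorem coord_freeSolution_neg {κ : ℝ} {z : ℂ} (hz : z ≠ 0) {x : ℝ} (hx : 0 < x) :
    coordPlus (freeSolution κ (-z) x) = coordMinus (freeSolution κ z x) ∧
    coordMinus (freeSolution κ (-z) x) = coordPlus (freeSolution κ z x) := by
  have hz' := neg_ne_zero.2 hz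
  rw [coordPlus_freeSolution hz' hx, coordMinus_freeSolution hz' hx, coordPlus_freeSolution hz hx,
    coordMinus_freeSolution hz hx, freePlus, freeMinus, freePlus, freeMinus, neg_mul, freeFst_neg,
    freeSnd_neg]
  constructor <;> ring

/-- On the right half plane, the asymptotics of the free solution in terms of `z`. -/
theorem norm_coord_freeSolution_sub_wave_le {κ : ℝ} {ε : ℝ → ℝ}
    (hε : ∀ w : ℂ, w ≠ 0 → 0 ≤ w.re →
      ‖w ^ (κ : ℂ) * freePlus κ w - Complex.exp (Complex.I * (w - κ * Real.pi / 2))‖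
        ≤ ε ‖w‖ * Real.exp |w.im| ∧
      ‖w ^ (κ : ℂ) * freeMinus κ w - Complex.exp (-(Complex.I * (w - κ * Real.pi / 2)))‖
        ≤ ε ‖w‖ * Real.exp |w.im|)
    {z : ℂ} (hz : z ≠ 0) (hre : 0 ≤ z.re) {x : ℝ} (hx : 0 < x) :
    ‖coordPlus (freeSolution κ z x) - coordPlus (wave κ x z)‖
      ≤ waveSize κ x z * ε (‖z‖ * x) ∧
    ‖coordMinus (freeSolution κ z x) - coordMinus (wave κ x z)‖
      ≤ waveSize κ x z * ε (‖z‖ * x) := by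
  have hx' : (x : ℂ) ≠ 0 := by exact_mod_cast hx.ne'
  obtain ⟨h1, h2⟩ := hε (z * x) (mul_ne_zero hz hx') (by simp; positivity)
  have him : |(z * x).im| = |z.im| * x := by simp [abs_mul, abs_of_pos hx]
  have hn : ‖z * x‖ = ‖z‖ * x := by simp [abs_of_pos hx]
  rw [him, hn] at h1 h2
  have hp := cpow_neg_mul_cpow_mul_ofReal κ hz hx
  constructor
  · rw [coordPlus_wave, coordPlus_freeSolution hz hx, ← hp, mul_assoc, ← mul_sub, norm_mul,
      norm_cpow_neg_ofReal, waveSize, mul_assoc, mul_comm (Real.exp _)]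
    gcongr
  · rw [coordMinus_wave, coordMinus_freeSolution hz hx, ← hp, mul_assoc, ← mul_sub, norm_mul,
      norm_cpow_neg_ofReal, waveSize, mul_assoc, mul_comm (Real.exp _)]
    gcongr

/-- Of the two waves `e^{±izx}`, one is exponentially small relative to `waveSize` off the real
axis. -/
theorem norm_coord_wave (κ x : ℝ) (z : ℂ) :
    (0 ≤ z.im → ‖coordPlus (wave κ x z)‖ = waveSize κ x z * Real.exp (-(2 * |z.im| * x))) ∧
    (z.im ≤ 0 → ‖coordMinus (wave κ x z)‖ = waveSize κ x z * Real.exp (-(2 * |z.im| * x))) := by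
  constructor <;> intro h
  · rw [coordPlus_wave, norm_mul, norm_exp_phase, norm_cpow_neg_ofReal, waveSize, mul_assoc,
      ← Real.exp_add, abs_of_nonneg h]
    congr 2; ring
  · rw [coordMinus_wave, norm_mul, norm_exp_neg_phase, norm_cpow_neg_ofReal, waveSize,
      mul_assoc, ← Real.exp_add, abs_of_nonpos h]
    congr 2; ring

theorem im_ge_of_abs_arg_lt {δ : ℝ} (hδ : 0 < δ) {z : ℂ} (hre : z.re < 0)
    (harg : |Complex.arg z| < Real.pi - δ) : ‖z‖ * Real.sin δ ≤ |z.im| := by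
  have h1 : Real.pi / 2 < |Complex.arg z| := by
    by_contra h
    exact absurd (Complex.abs_arg_le_pi_div_two_iff.1 (not_lt.1 h)) (not_le.2 hre)
  have h2 : Real.sin δ ≤ Real.sin |Complex.arg z| := by
    rw [← Real.sin_pi_sub |Complex.arg z|]
    exact Real.sin_le_sin_of_le_of_le_pi_div_two (by linarith) (by linarith) (by linarith)
  have h3 : |z.im| = ‖z‖ * Real.sin |Complex.arg z| := by
    have h4 : z.im = ‖z‖ * Real.sin (Complex.arg z) := (Complex.norm_mul_sin_arg z).symm
    have h5 : 0 ≤ Real.sin |Complex.arg z| :=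
      Real.sin_nonneg_of_nonneg_of_le_pi (abs_nonneg _) (Complex.abs_arg_le_pi z)
    rw [h4, abs_mul, abs_norm]
    congr 1
    rcases abs_cases (Complex.arg z) with ⟨h, _⟩ | ⟨h, _⟩ <;> rw [h] at h5 ⊢
    · exact abs_of_nonneg h5
    · rw [Real.sin_neg] at h5 ⊢
      exact abs_of_nonpos (by linarith)
  rw [h3]
  gcongr

/-- The free solution in the sector `|arg z| < π - δ`. For `Re z < 0` it is obtained by parity from
`-z`; one coordinate of the leading term is then the same function, while the other one, whose phase
does change, is exponentially small since `|Im z|` is large. -/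
theorem exists_coordNorm_freeSolution_sub_wave_le {κ : ℝ} (hκ : 0 ≤ κ) {x : ℝ} (hx : 0 < x) {δ : ℝ}
    (hδ : 0 < δ) :
    ∃ η : ℝ → ℝ, Tendsto η atTop (𝓝 0) ∧ ∀ z : ℂ, z ≠ 0 → |Complex.arg z| < Real.pi - δ →
      coordNorm (freeSolution κ z x - wave κ x z) ≤ waveSize κ x z * η ‖z‖ := by
  obtain ⟨ε, hε0, hε⟩ := exists_free_asymptotics hκ
  set δ' := min δ (Real.pi / 2) with hδ'
  have hδ0 : 0 < δ' := lt_min hδ (by positivity)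
  have hsin : 0 < Real.sin δ' := Real.sin_pos_of_pos_of_lt_pi hδ0
    ((min_le_right _ _).trans_lt (by linarith [Real.pi_pos]))
  refine ⟨fun R => 2 * (|ε (R * x)| + 2 * Real.exp (-(2 * (R * Real.sin δ') * x))), ?_, ?_⟩
  · have h1 : Tendsto (fun R : ℝ => R * x) atTop atTop := tendsto_id.atTop_mul_const hx
    have h2 : Tendsto (fun R : ℝ => 2 * (R * Real.sin δ') * x) atTop atTop :=
      ((tendsto_id.atTop_mul_const hsin).const_mul_atTop (by norm_num)).atTop_mul_const hx
    have h3 := Real.tendsto_exp_neg_atTop_nhds_zero.comp h2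
    simpa using (((hε0.comp h1).abs).add (h3.const_mul 2)).const_mul 2
  intro z hz harg
  have hw := waveSize_nonneg κ x z
  set E := Real.exp (-(2 * (‖z‖ * Real.sin δ') * x)) with hE
  have hE0 : 0 < E := Real.exp_pos _
  -- It suffices to bound each coordinate.
  suffices h : ‖coordPlus (freeSolution κ z x) - coordPlus (wave κ x z)‖
        ≤ waveSize κ x z * (|ε (‖z‖ * x)| + 2 * E) ∧
      ‖coordMinus (freeSolution κ z x) - coordMinus (wave κ x z)‖
        ≤ waveSize κ x z * (|ε (‖z‖ * x)| + 2 * E) by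
    have h1 := pairNorm_le_add (coordPlus (freeSolution κ z x - wave κ x z))
      (coordMinus (freeSolution κ z x - wave κ x z))
    rw [← coordPlusCLM_apply, ← coordMinusCLM_apply, map_sub, map_sub] at h1
    simp only [coordPlusCLM_apply, coordMinusCLM_apply] at h1
    rw [coordNorm, ← coordPlusCLM_apply, ← coordMinusCLM_apply, map_sub, map_sub]
    simp only [coordPlusCLM_apply, coordMinusCLM_apply]
    linarith [h.1, h.2]
  have hle : waveSize κ x z * ε (‖z‖ * x) ≤ waveSize κ x z * (|ε (‖z‖ * x)| + 2 * E) := by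
    gcongr
    linarith [le_abs_self (ε (‖z‖ * x))]
  rcases le_or_gt 0 z.re with hre | hre
  · obtain ⟨h1, h2⟩ := norm_coord_freeSolution_sub_wave_le hε hz hre hx
    exact ⟨h1.trans hle, h2.trans hle⟩
  have him := im_ge_of_abs_arg_lt hδ0 hre
    (harg.trans_le (by linarith [min_le_left δ (Real.pi / 2)]))
  have hexp : Real.exp (-(2 * |z.im| * x)) ≤ E := by
    rw [hE, Real.exp_le_exp]
    have : 2 * (‖z‖ * Real.sin δ') * x ≤ 2 * |z.im| * x := by gcongr
    linarith
  obtain ⟨h1, h2⟩ := norm_coord_freeSolution_sub_wave_le hε (neg_ne_zero.2 hz)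
    (by rw [Complex.neg_re]; linarith) hx
  rw [(coord_freeSolution_neg hz hx).1, waveSize_neg, norm_neg] at h1
  rw [(coord_freeSolution_neg hz hx).2, waveSize_neg, norm_neg] at h2
  obtain ⟨n1, n2⟩ := norm_coord_wave κ x z
  obtain ⟨m1, m2⟩ := norm_coord_wave κ x (-z)
  rw [waveSize_neg, Complex.neg_im, abs_neg] at m1 m2
  have small : ∀ a b c : ℂ, ‖a - b‖ ≤ waveSize κ x z * ε (‖z‖ * x) →
      ‖b‖ = waveSize κ x z * Real.exp (-(2 * |z.im| * x)) →
      ‖c‖ = waveSize κ x z * Real.exp (-(2 * |z.im| * x)) →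
      ‖a - c‖ ≤ waveSize κ x z * (|ε (‖z‖ * x)| + 2 * E) := by
    intro a b c hab hb hc
    have e1 : ‖a - c‖ ≤ ‖a - b‖ + (‖b‖ + ‖c‖) := by
      calc ‖a - c‖ = ‖(a - b) + (b - c)‖ := by rw [sub_add_sub_cancel]
        _ ≤ _ := (norm_add_le _ _).trans (add_le_add le_rfl (norm_sub_le _ _))
    have e2 := mul_le_mul_of_nonneg_left (le_abs_self (ε (‖z‖ * x))) hw
    have e3 := mul_le_mul_of_nonneg_left hexp hw
    linarith
  have him0 : z.im ≠ 0 := by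
    intro h0
    rw [h0, abs_zero] at him
    have := mul_pos (norm_pos_iff.2 hz) hsin
    linarith
  rcases lt_or_gt_of_ne him0 with hneg | hpos
  · have heq : coordMinus (wave κ x (-z)) = coordPlus (wave κ x z) := by
      rw [coordMinus_wave, coordPlus_wave, cpow_neg_neg_of_im_neg κ hneg, mul_assoc,
        ← Complex.exp_add]
      congr 2
      ring
    refine ⟨heq ▸ h2.trans hle, small _ _ _ h1 ?_ (n2 hneg.le)⟩
    exact m1 (by linarith)
  · have heq : coordPlus (wave κ x (-z)) = coordMinus (wave κ x z) := by
      rw [coordMinus_wave, coordPlus_wave, cpow_neg_neg_of_im_pos κ hpos, mul_assoc,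
        ← Complex.exp_add]
      congr 2
      ring
    refine ⟨small _ _ _ h2 ?_ (n1 hpos.le), heq ▸ h1.trans hle⟩
    exact m2 (by linarith)

/-! ### Asymptotics of the perturbed regular solution -/

theorem integrableOn_of_weight {κ : ℝ} {p : ℝ → ℝ} {X : ℝ}
    (h : IntegrableOn (fun x => weight κ x * p x) (Ioo 0 X)) : IntegrableOn p (Ioc 0 X) := by
  rw [integrableOn_Ioc_iff_integrableOn_Ioo]
  have h1 : ∀ x, 1 ≤ weight κ x := fun x => by
    unfold weight; split_ifs
    · linarith [abs_nonneg (Real.log x)]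
    · exact le_rfl
  have hm : Measurable (weight κ) := by
    unfold weight
    by_cases hκ : κ = 1 / 2
    · simp only [hκ, if_true]
      exact measurable_const.add (Real.measurable_log.abs)
    · simp only [hκ, if_false]
      exact measurable_const
  refine (h.bdd_mul (f := fun x => (weight κ x)⁻¹) (c := 1)
    hm.inv.aestronglyMeasurable (Eventually.of_forall fun x => ?_)).congr
    (Eventually.of_forall fun x => ?_)
  · rw [norm_inv, Real.norm_of_nonneg (zero_le_one.trans (h1 x))]
    exact inv_le_one_of_one_le₀ (h1 x)
  · exact inv_mul_cancel_left₀ (zero_lt_one.trans_le (h1 x)).ne' (p x)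

theorem scale_le_waveSize {κ : ℝ} (hκ : 0 ≤ κ) {z : ℂ} (hz : z ≠ 0) {x : ℝ} (hx : 0 < x) :
    scale κ z x ≤ (κ + 1) ^ κ * waveSize κ x z := by
  have hz' := norm_pos_iff.2 hz
  have h1 : growth κ z x ≤ (κ + 1) ^ κ * ‖z‖ ^ (-κ) := by
    rw [Real.rpow_neg hz'.le, ← div_eq_mul_inv, ← Real.div_rpow (by linarith) hz'.le]
    exact Real.rpow_le_rpow (le_min hx.le (by positivity)) (min_le_right _ _) hκ
  rw [scale, waveSize, ← mul_assoc]
  gcongr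

/-- The perturbed regular solution differs from the free one by `o(|z|^{-κ} e^{|Im z| x})`. -/
theorem isLittleO_coordNorm_sub {κ : ℝ} (hκ : 0 ≤ κ) {b : EReal}
    {P : ℝ → Matrix (Fin 2) (Fin 2) ℝ} (hP : IsRadialPerturbation κ b P)
    (htrace : ∀ᵐ x : ℝ, 0 < x → (x : EReal) < b → (P x).trace = 0)
    {Φ : ℂ → ℝ → Fin 2 → ℂ} (hΦ : ∀ z : ℂ, z ≠ 0 → IsRegularSolution κ b P z (Φ z))
    {x : ℝ} (hx : 0 < x) (hxb : (x : EReal) < b) :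
    (fun z : ℂ => coordNorm (Φ z x - freeSolution κ z x))
      =o[Bornology.cobounded ℂ] waveSize κ x := by
  have hlt : ∀ y ∈ Ioc 0 x, (y : EReal) < b := fun y hy =>
    (EReal.coe_le_coe_iff.2 hy.2).trans_lt hxb
  have hP' : ∀ᵐ y ∂(volume.restrict (Ioc 0 x)), P y 1 1 = -P y 0 0 ∧ P y 1 0 = P y 0 1 := by
    filter_upwards [ae_restrict_of_ae hP.symm, ae_restrict_of_ae htrace,
      ae_restrict_mem measurableSet_Ioc] with y h1 h2 hy
    have h3 := h2 hy.1 (hlt y hy)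
    rw [Matrix.trace_fin_two] at h3
    exact ⟨by linarith, (h1 hy.1 (hlt y hy)).apply 0 1⟩
  have key := tendsto_coordNorm_sub_div (u := Φ) hκ hx hP'
    (integrableOn_of_weight (hP.integrable x hx hxb 0 0))
    (integrableOn_of_weight (hP.integrable x hx hxb 0 1))
    (fun z hz => (hΦ z hz).continuousOn.mono fun y hy => ⟨hy.1, hlt y hy⟩)
    (fun z hz => (hΦ z hz).regular)
    (fun z hz y hy => (intervalIntegrable_iff_integrableOn_Ioc_of_le hy.1.le).1
      ((hΦ z hz).integrable y hy.1 (hlt y hy)))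
    (fun z hz y hy => by
      rw [(hΦ z hz).equation y hy.1 (hlt y hy), intervalIntegral.integral_of_le hy.1.le]
      rfl)
  rw [Asymptotics.isLittleO_iff]
  intro c hc
  have hK : 0 < (κ + 1) ^ κ := Real.rpow_pos_of_pos (by linarith) κ
  filter_upwards [key.eventually_lt_const (show 0 < c / (κ + 1) ^ κ by positivity),
    (tendsto_norm_cobounded_atTop (E := ℂ)).eventually_gt_atTop 0] with z h1 hz
  have hz := norm_pos_iff.1 hz
  rw [div_lt_iff₀ (scale_pos hκ hz hx)] at h1
  rw [Real.norm_of_nonneg (coordNorm_nonneg _), Real.norm_of_nonneg (waveSize_nonneg κ x z)]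
  calc _ ≤ c / (κ + 1) ^ κ * ((κ + 1) ^ κ * waveSize κ x z) :=
        h1.le.trans (by gcongr; exact scale_le_waveSize hκ hz hx)
    _ = _ := by field_simp

/-- Equivalence follows from errors that are small relative to `waveSize`, as the latter is a lower
bound of the leading term. -/
theorem isEquivalent_of_isLittleO {κ x : ℝ} {Φ F V : ℂ → Fin 2 → ℂ} {s : Set ℂ}
    (h1 : (fun z => coordNorm (Φ z - F z)) =o[Bornology.cobounded ℂ] waveSize κ x)
    {η : ℝ → ℝ} (hη : Tendsto η atTop (𝓝 0))
    (h2 : ∀ z ≠ 0, z ∈ s → coordNorm (F z - V z) ≤ waveSize κ x z * η ‖z‖)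
    (h3 : ∀ z, waveSize κ x z ≤ coordNorm (V z)) :
    Asymptotics.IsEquivalent (Bornology.cobounded ℂ ⊓ 𝓟 s)
      (fun z => WithLp.toLp 2 (Φ z)) (fun z => WithLp.toLp 2 (V z)) := by
  rw [Asymptotics.IsEquivalent, Asymptotics.isLittleO_iff]
  intro c hc
  have hn := tendsto_norm_cobounded_atTop (E := ℂ)
  have e1 := Asymptotics.isLittleO_iff.1 h1 (show 0 < c / 4 by positivity)
  have e2 := (hη.comp hn).eventually_lt_const (show 0 < c / 4 by positivity)
  filter_upwards [e1.filter_mono inf_le_left, e2.filter_mono inf_le_left,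
    (hn.eventually_gt_atTop 0).filter_mono inf_le_left, mem_inf_of_right (mem_principal_self s)] with z h4 h5 hz hs
  rw [Real.norm_of_nonneg (coordNorm_nonneg _), Real.norm_of_nonneg (waveSize_nonneg κ x z)] at h4
  have h6 := (h2 z (norm_pos_iff.1 hz) hs).trans
    (mul_le_mul_of_nonneg_left (le_of_lt h5) (waveSize_nonneg κ x z))
  have h7 := coordNorm_add_le (Φ z - F z) (F z - V z)
  rw [sub_add_sub_cancel] at h7
  have h8 := norm_toLp_le_coordNorm (Φ z - V z)
  have h9 := (h3 z).trans (coordNorm_le_two_mul (V z))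
  rw [Pi.sub_apply, ← WithLp.toLp_sub]
  nlinarith

theorem coordNorm_reflect (v : Fin 2 → ℂ) : coordNorm ![-v 0, v 1] = coordNorm v := by
  rw [coordNorm, pairNorm_comm]
  congr 1 <;> simp [coordPlus, coordMinus, sub_eq_add_neg]

theorem reflect_freeSolution_neg {κ : ℝ} {z : ℂ} (hz : z ≠ 0) {x : ℝ} (hx : 0 < x) :
    ![-freeSolution κ (-z) x 0, freeSolution κ (-z) x 1] = freeSolution κ z x := by
  have e1 := freeSolution_eq (κ := κ) hz hx
  have e2 := freeSolution_eq (κ := κ) (neg_ne_zero.2 hz) hx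
  ext i
  fin_cases i
  · simp [e1.1, e2.1, neg_mul, freeFst_neg]
  · simp [e1.2, e2.2, neg_mul, freeSnd_neg]

theorem reflect_wave_neg (κ x : ℝ) (z : ℂ) :
    ((-z) ^ (-(κ : ℂ)) • ![Complex.sin (z * x + κ * Real.pi / 2),
      Complex.cos (z * x + κ * Real.pi / 2)] : Fin 2 → ℂ)
      = ![-wave κ x (-z) 0, wave κ x (-z) 1] := by
  have h1 : -z * x - κ * Real.pi / 2 = -(z * x + κ * Real.pi / 2) := by ring
  rw [wave, h1, Complex.sin_neg, Complex.cos_neg]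
  ext i
  fin_cases i <;> simp

end RadialDirac

theorem lemma7p3 (κ : ℝ) (hκ : 0 ≤ κ) (b : EReal) (hb : 0 < b)
    (P : ℝ → Matrix (Fin 2) (Fin 2) ℝ)
    (hP : RadialDirac.IsRadialPerturbation κ b P)
    (htrace : ∀ᵐ x : ℝ, 0 < x → (x : EReal) < b → (P x).trace = 0)
    (Φ : ℂ → ℝ → Fin 2 → ℂ)
    (hΦ : ∀ z : ℂ, z ≠ 0 → RadialDirac.IsRegularSolution κ b P z (Φ z))
    (x : ℝ) (hx : 0 < x) (hxb : (x : EReal) < b) :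
    ((fun z : ℂ => ‖WithLp.toLp 2 (Φ z x - RadialDirac.freeSolution κ z x)‖)
        =o[Bornology.cobounded ℂ] fun z : ℂ => ‖z‖ ^ (-κ) * Real.exp (|z.im| * x)) ∧
    ∀ δ : ℝ, 0 < δ →
      Asymptotics.IsEquivalent
        (Bornology.cobounded ℂ ⊓ Filter.principal {z : ℂ | |Complex.arg z| < Real.pi - δ})
        (fun z : ℂ => WithLp.toLp 2 (Φ z x))
        (fun z : ℂ => WithLp.toLp 2
          (z ^ (-(κ : ℂ)) • ![Complex.sin (z * x - κ * Real.pi / 2),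
            Complex.cos (z * x - κ * Real.pi / 2)])) ∧
      Asymptotics.IsEquivalent
        (Bornology.cobounded ℂ ⊓ Filter.principal {z : ℂ | |Complex.arg (-z)| < Real.pi - δ})
        (fun z : ℂ => WithLp.toLp 2 (Φ z x))
        (fun z : ℂ => WithLp.toLp 2
          ((-z) ^ (-(κ : ℂ)) • ![Complex.sin (z * x + κ * Real.pi / 2),
            Complex.cos (z * x + κ * Real.pi / 2)])) := by
  open RadialDirac in
  have h := isLittleO_coordNorm_sub hκ hP htrace hΦ hx hxb
  refine ⟨?_, fun δ hδ => ?_⟩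
  · refine Asymptotics.IsBigO.trans_isLittleO (Asymptotics.isBigO_of_le _ fun z => ?_) h
    rw [norm_norm, Real.norm_of_nonneg (coordNorm_nonneg _)]
    exact norm_toLp_le_coordNorm _
  obtain ⟨η, hη, hη2⟩ := exists_coordNorm_freeSolution_sub_wave_le hκ hx hδ
  refine ⟨isEquivalent_of_isLittleO h hη hη2 (waveSize_le_coordNorm κ x),
    isEquivalent_of_isLittleO (V := fun z => ((-z) ^ (-(κ : ℂ)) •
      ![Complex.sin (z * x + κ * Real.pi / 2), Complex.cos (z * x + κ * Real.pi / 2)])) h hη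
      (fun z hz hs => ?_) fun z => ?_⟩
  · have h2 := hη2 (-z) (neg_ne_zero.2 hz) hs
    rw [waveSize_neg, norm_neg, ← coordNorm_reflect] at h2
    refine le_of_eq_of_le ?_ h2
    rw [reflect_wave_neg, ← reflect_freeSolution_neg hz hx]
    congr 1
    ext i
    fin_cases i
    · simp
      ring
    · simp
  · rw [reflect_wave_neg, coordNorm_reflect, ← waveSize_neg]
    exact waveSize_le_coordNorm κ x (-z)
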